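/- Let $L_x,L_y\ge 1$ be integers and consider spinless fermions $a_{\mathbf i},a_{\mathbf i}^\dagger$ on the periodic lattice of sites $\mathbf i=(i_x,i_y)$, $0\le i_x<L_x$, $0\le i_y<L_y$, with Hamiltonian $$H=-\tfrac12\sum_{i_x,i_y}\big(a^\dagger_{i_x,i_y}a_{i_x+1,i_y}+a^\dagger_{i_x,i_y}a_{i_x,i_y+1}+\mathrm{H.c.}\big)$$ (indices modulo $L_x$, $L_y$). Let $k$ divide $L_y$, and let $|\psi_0\rangle$ be a unit vector in Fock space that satisfies Wick's theorem (it is Gaussian: every correlator of creation and annihilation operators is the signed sum over pairings of products of two-point functions, and odd correlators vanish) and is invariant, up to a phase, under translation by $k$ sites in the $y$-direction. For $t\in\mathbb R$ put $|\psi(t)\rangle=e^{-itH}|\psi_0\rangle$. Let $0\le\ell\le L_x$, let $A=\{\mathbf i: i_x<\ell\}$ be the strip, $B$ its complement, and $\rho_A(t)=\mathrm{Tr}_B|\psi(t)\rangle\langle\psi(t)|$. For a density matrix $\rho$ and real $n>0$ let $S_n(\rho)=\frac1{1-n}\log\mathrm{Tr}\,\rho^n$ if $n\ne1$ and $S_1(\rho)=-\mathrm{Tr}\,\rho\log\rho$.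 With $\mathbf a_{\mathbf i}=(a_{\mathbf i}^\dagger,a_{\mathbf i})$, the correlation matrix of $A$ is the $2\ell L_y\times2\ell L_y$ matrix with blocks $\Gamma_{\mathbf i,\mathbf i'}=2\langle\psi(t)|\mathbf a_{\mathbf i}^\dagger\mathbf a_{\mathbf i'}|\psi(t)\rangle-\delta_{\mathbf i,\mathbf i'}$, $\mathbf i,\mathbf i'\in A$. For real $q$ put $c_{i_x,q}=L_y^{-1/2}\sum_{i_y}e^{-iqi_y}a_{i_x,i_y}$ and $\mathbf c_{i_x,q}=(c^\dagger_{i_x,q},c_{i_x,-q})$. For $q_y=2\pi n_y/L_y$, $0\le n_y<L_y/k$, let $\Gamma^{(k)}_{q_y}$ be the $2k\ell\times2k\ell$ matrix with blocks $$2\langle\psi(t)|\,\mathbf c^\dagger_{i_x,\,q_y+2\pi p/k}\,\mathbf c_{i_x',\,q_y+2\pi p'/k}|\psi(t)\rangle-\delta_{i_x,i_x'}\delta_{p,p'},\qquad 0\le i_x,i_x'<\ell,\ 0\le p,p'<k .$$ Let $h_n(x)=\frac1{1-n}\log\big[(\frac{1+x}2)^n+(\frac{1-x}2)^n\big]$ for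 $n\neq1$, $h_1(x)=-\frac{1+x}2\log\frac{1+x}2-\frac{1-x}2\log\frac{1-x}2$ (with $0\log0=0$), let $a_n(m)$ be the Taylor coefficients of $h_n$ at $0$, and for a Hermitian correlation matrix put $S_n(\Gamma)=\frac12\mathrm{Tr}\,h_n(\Gamma)$. Then, for all $t$ and all finite $L_x,L_y$: 1. $\Gamma$ and all $\Gamma^{(k)}_{q_y}$ are Hermitian, and the partial Fourier transform in the $y$-direction, with entries $W_{(n_y,p,i_x),(i_x',i_y)}=\delta_{i_x,i_x'}L_y^{-1/2}e^{-i(q_y+2\pi p/k)i_y}$ (the identity on the two components), is unitary and block-diagonalizes $\Gamma$: $$W\,\Gamma\,W^\dagger=\bigoplus_{n_y=0}^{L_y/k-1}\Gamma^{(k)}_{q_y}.$$ 2. For every real $n>0$, $$S_n(\rho_A(t))=\sum_{n_y=0}^{L_y/k-1}S_n\big(\Gamma^{(k)}_{q_y}\big),$$ and, for each $n_y$, if the series $\frac12\sum_{m\ge0}a_n(2m)\,\mathrm{Tr}\big[(\Gamma^{(k)}_{q_y})^{2m}\big]$ converges, then its sum is $S_n(\Gamma^{(k)}_{q_y})$.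 3. For every real $n>0$ and every $n_y$, $S_n(\Gamma^{(k)}_{q_y})$ is the single-interval Rényi entropy of a 1D chain: in any Gaussian state (density matrix satisfying Wick's theorem) of a chain of $N\ge\ell$ cells with $k$ fermionic orbitals each, such that the correlation matrix of the interval of the first $\ell$ cells is $\Gamma^{(k)}_{q_y}$, the Rényi entropy $S_n$ of that interval equals $S_n(\Gamma^{(k)}_{q_y})$. -/

import Mathlib

open scoped Matrix ComplexOrder

noncomputable section

namespace FreeFermion

/-! ### Fermionic Fock space

The Fock space of spinless fermions on a finite, linearly ordered set `Λ` of sites has the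
orthonormal basis `e_S`, `S : Finset Λ`, where `e_S = a†_{i₁} ⋯ a†_{iᵣ} |0⟩` for
`S = {i₁ < ⋯ < iᵣ}`.  Operators are matrices in this basis. -/

section Fock

variable (Λ : Type) [Fintype Λ] [LinearOrder Λ]

/-- Operators on the Fock space over `Λ`. -/
abbrev Op : Type := Matrix (Finset Λ) (Finset Λ) ℂ

variable {Λ}

/-- The annihilation operator `a_i`: `a_i e_T = (-1)^{#{j ∈ T : j < i}} e_{T \ {i}}` if `i ∈ T`,
and `a_i e_T = 0` otherwise. The creation operator is its adjoint `(ann i)ᴴ`. -/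
def ann (i : Λ) : Op Λ :=
  Matrix.of fun S T =>
    if i ∈ T ∧ S = T.erase i then (-1 : ℂ) ^ (T.filter (fun j => j < i)).card else 0

/-- The vacuum vector `|0⟩ = e_∅`. -/
def vacuum : Finset Λ → ℂ := Pi.single ∅ 1

/-- The density matrix `|ψ⟩⟨ψ|`. -/
def pureState (ψ : Finset Λ → ℂ) : Op Λ := Matrix.vecMulVec ψ (star ψ)

/-- The expectation value `Tr (ρ O)`. -/
def expect (ρ O : Op Λ) : ℂ := (ρ * O).trace

/-- `ρ` is a density matrix: positive semidefinite of trace one. -/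
def IsDensity {m : Type} [Fintype m] (ρ : Matrix m m ℂ) : Prop := ρ.PosSemidef ∧ ρ.trace = 1

/-- From a family of annihilation operators `a_i` and a second family `b_i`, the Nambu doublets
`(a_i†, b_i)`: component `0` is `a_i†`, component `1` is `b_i`. -/
def doublet {ι : Type} (a b : ι → Op Λ) (u : ι × Fin 2) : Op Λ := ![(a u.1)ᴴ, b u.1] u.2

/-- The elementary field operators: `field (i, 0) = a_i†` and `field (i, 1) = a_i`. -/
def field (u : Λ × Fin 2) : Op Λ := doublet ann ann u

/-- Wick's theorem holds in the state `ρ` (that is, `ρ` is Gaussian): the expectation value of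
every product of creation and annihilation operators is the signed sum over pairings of the
products of two-point functions. It is written as the expansion with respect to the partner of the
leftmost operator; for `l = []` it says `⟨F⟩ = 0`, and so all odd correlators vanish. -/
def SatisfiesWick (ρ : Op Λ) : Prop :=
  ∀ (u : Λ × Fin 2) (l : List (Λ × Fin 2)),
    expect ρ (field u * (l.map field).prod) =
      ∑ j : Fin l.length,
        (-1 : ℂ) ^ (j : ℕ) * expect ρ (field u * field (l.get j)) *
          expect ρ ((l.eraseIdx j).map field).prod

/-- The two-point correlation matrix `2 ⟨B_u† B_v⟩ - δ_{uv}` of a family `B` of operators. -/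
def corr {κ : Type} [DecidableEq κ] (ρ : Op Λ) (B : κ → Op Λ) : Matrix κ κ ℂ :=
  Matrix.of fun u v => 2 * expect ρ ((B u)ᴴ * B v) - (if u = v then 1 else 0)

/-- The second quantization of a map `σ` of the sites: it fixes the vacuum and sends
`a†_{i₁} ⋯ a†_{iᵣ} |0⟩` to `a†_{σ i₁} ⋯ a†_{σ iᵣ} |0⟩`. -/
def secondQuantize (σ : Λ → Λ) : Op Λ :=
  Matrix.of fun S T => (((T.sort.map fun i => (ann (σ i))ᴴ).prod) *ᵥ vacuum) S

end Fock

/-! ### Entropies -/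

/-- The Rényi entropy `S_n(ρ) = (1 - n)⁻¹ log Tr ρ^n` for `n ≠ 1`, and the von Neumann entropy
`S_1(ρ) = - Tr (ρ log ρ)`, of a density matrix. -/
def renyiEntropy {m : Type} [Fintype m] [DecidableEq m] (n : ℝ) (ρ : Matrix m m ℂ) : ℝ :=
  if n = 1 then (cfc (fun x : ℝ => Real.negMulLog x) ρ).trace.re
  else (1 - n)⁻¹ * Real.log (cfc (fun x : ℝ => x ^ n) ρ).trace.re

/-- `h_n(x) = (1 - n)⁻¹ log [((1+x)/2)^n + ((1-x)/2)^n]`, and its limit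
`- (1+x)/2 log ((1+x)/2) - (1-x)/2 log ((1-x)/2)` for `n = 1`. -/
def hFun (n x : ℝ) : ℝ :=
  if n = 1 then Real.negMulLog ((1 + x) / 2) + Real.negMulLog ((1 - x) / 2)
  else (1 - n)⁻¹ * Real.log (((1 + x) / 2) ^ n + ((1 - x) / 2) ^ n)

/-- The Taylor coefficient of order `m` of `h_n` at `0`. -/
def hCoeff (n : ℝ) (m : ℕ) : ℝ := iteratedDeriv m (hFun n) 0 / (m.factorial : ℝ)

/-- The Rényi entropy `S_n(Γ) = ½ Tr h_n(Γ)` attached to a correlation matrix `Γ`, that is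
`1 / (2 (1 - n)) Tr log [((1 + Γ)/2)^n + ((1 - Γ)/2)^n]` for `n ≠ 1`. -/
def corrEntropy {m : Type} [Fintype m] [DecidableEq m] (n : ℝ) (Γ : Matrix m m ℂ) : ℝ :=
  (1 / 2) * (cfc (hFun n) Γ).trace.re

/-! ### The lattice and the strip -/

/-- The sites `(i_x, i_y)`, ordered lexicographically (by `i_x` first). -/
abbrev Site (Lx Ly : ℕ) : Type := Fin Lx ×ₗ Fin Ly

section Strip

variable {Lx Ly : ℕ}

/-- The strip `A` of the sites with `i_x ∈ [0, ℓ - 1]`. -/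
def strip (Lx Ly ℓ : ℕ) : Finset (Site Lx Ly) :=
  Finset.univ.filter fun i => ((ofLex i).1 : ℕ) < ℓ

/-- The reduced density matrix `ρ_A = Tr_B ρ` of the strip `A`, in the basis `e_S`, `S ⊆ A`.
All sites of `A` precede those of the complement `B`, so `e_{S ∪ R} = a†_S a†_R |0⟩` for
`S ⊆ A` and `R ⊆ B`, and the partial trace involves no signs. -/
def reducedDensity (ℓ : ℕ) (ρ : Op (Site Lx Ly)) :
    Matrix ↥(strip Lx Ly ℓ).powerset ↥(strip Lx Ly ℓ).powerset ℂ :=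
  Matrix.of fun S S' =>
    ∑ R ∈ (strip Lx Ly ℓ)ᶜ.powerset, ρ (S.1 ∪ R) (S'.1 ∪ R)

/-- The correlation matrix `Γ_{i,i'} = 2 ⟨𝐚_i† 𝐚_{i'}⟩ - δ_{i,i'}`, `𝐚_i = (a_i†, a_i)`, of the
strip `A`; its rows and columns are indexed by `((i_x, i_y), component)`. -/
def stripCorr {ℓ : ℕ} (hℓ : ℓ ≤ Lx) (ρ : Op (Site Lx Ly)) :
    Matrix ((Fin ℓ × Fin Ly) × Fin 2) ((Fin ℓ × Fin Ly) × Fin 2) ℂ :=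
  corr ρ fun u => field (toLex (Fin.castLE hℓ u.1.1, u.1.2), u.2)

/-- The operators in the mixed space-momentum basis,
`c_{i_x,q} = L_y^{-1/2} ∑_{i_y} e^{-i q i_y} a_{i_x,i_y}`. -/
def mixedAnn (x : Fin Lx) (q : ℝ) : Op (Site Lx Ly) :=
  ((1 / Real.sqrt Ly : ℝ) : ℂ) •
    ∑ y : Fin Ly, Complex.exp (-Complex.I * q * (y : ℕ)) • ann (toLex (x, y))

/-- The transverse momentum `q_y + 2π p / k`, where `q_y = 2π n_y / L_y`. -/
def momentum (Ly k n p : ℕ) : ℝ := 2 * Real.pi * n / Ly + 2 * Real.pi * p / k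

/-- The correlation matrix `Γ_{q_y}^{(k)}` in the mixed basis for the transverse momentum sector
`q_y = 2π n_y / L_y`, built from `𝐜_{i_x,q_y + 2πp/k}`, `0 ≤ p < k`, where
`𝐜_{i_x,q} = (c_{i_x,q}†, c_{i_x,-q})`; its indices are `((i_x, p), component)`. -/
def sectorCorr {ℓ : ℕ} (hℓ : ℓ ≤ Lx) (k : ℕ) (ρ : Op (Site Lx Ly)) (n : ℕ) :
    Matrix ((Fin ℓ × Fin k) × Fin 2) ((Fin ℓ × Fin k) × Fin 2) ℂ :=
  corr ρ fun u =>
    doublet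
      (fun v : Fin ℓ × Fin k => mixedAnn (Fin.castLE hℓ v.1) (momentum Ly k n v.2))
      (fun v : Fin ℓ × Fin k => mixedAnn (Fin.castLE hℓ v.1) (-momentum Ly k n v.2)) u

/-- The partial Fourier transform in the `y`-direction. The rows are indexed by
`(((i_x, p), component), n_y)`, i.e. by the momentum `q = 2π n_y / L_y + 2π p / k`, the columns by
`((i_x, i_y), component)`; it is `L_y^{-1/2} e^{-i q i_y}` on equal `i_x` and component. -/
def fourierY (ℓ Ly k : ℕ) :
    Matrix (((Fin ℓ × Fin k) × Fin 2) × Fin (Ly / k)) ((Fin ℓ × Fin Ly) × Fin 2) ℂ :=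
  Matrix.of fun r s =>
    if r.1.1.1 = s.1.1 ∧ r.1.2 = s.2 then
      ((1 / Real.sqrt Ly : ℝ) : ℂ) *
        Complex.exp (-Complex.I * momentum Ly k r.2 r.1.1.2 * (s.1.2 : ℕ))
    else 0

end Strip

/-! ### Dynamics on the periodic lattice -/

section Dynamics

variable {Lx Ly : ℕ} [NeZero Lx] [NeZero Ly]

/-- The hopping Hamiltonian `H = -½ ∑_{⟨i,i'⟩} a_i† a_{i'} + h.c.`, with one bond from each site to
its right and one to its upper neighbour (addition in `Fin` is modular). -/
def hamiltonian (Lx Ly : ℕ) [NeZero Lx] [NeZero Ly] : Op (Site Lx Ly) :=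
  (-(1 / 2 : ℂ)) • ∑ x : Fin Lx, ∑ y : Fin Ly,
    (((ann (toLex (x, y)))ᴴ * ann (toLex (x + 1, y)) +
        (ann (toLex (x + 1, y)))ᴴ * ann (toLex (x, y))) +
      ((ann (toLex (x, y)))ᴴ * ann (toLex (x, y + 1)) +
        (ann (toLex (x, y + 1)))ᴴ * ann (toLex (x, y))))

/-- The time-evolved vector `ψ(t) = e^{-itH} ψ₀`. -/
def evolve (t : ℝ) (ψ₀ : Finset (Site Lx Ly) → ℂ) : Finset (Site Lx Ly) → ℂ :=
  NormedSpace.exp (-(Complex.I * t) • hamiltonian Lx Ly) *ᵥ ψ₀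

/-- The operator on Fock space that translates by `k` sites in the `y`-direction. -/
def translateY (Lx Ly k : ℕ) [NeZero Ly] : Op (Site Lx Ly) :=
  secondQuantize fun i => toLex ((ofLex i).1, (ofLex i).2 + Fin.ofNat Ly k)

/-- The state given by `ψ` is invariant under `k`-site translations in the `y`-direction. A state
is a ray, so the vector may acquire a phase (a reordering of fermions already gives a sign). -/
def IsTranslationInvariant (k : ℕ) (ψ : Finset (Site Lx Ly) → ℂ) : Prop :=
  ∃ c : ℂ, translateY Lx Ly k *ᵥ ψ = c • ψ

end Dynamics

end FreeFermion

end

open FreeFermion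

open scoped Matrix ComplexOrder

noncomputable section

namespace FreeFermion

set_option linter.unusedSectionVars false
set_option linter.unusedSimpArgs false

/-! ### Canonical anticommutation relations and the operator algebra. -/

section CAR

variable {Λ : Type} [Fintype Λ] [LinearOrder Λ]

/-! For an operator of trace one, Wick's theorem is equivalent to evenness together with a linear
relation: every field f has a partner f' in the span of the fields with ρ f = ρ f' + f' ρ
(`SatisfiesWick.intertwines`, `Intertwines.satisfiesWick`). Any conjugation that preserves the span
of the fields preserves this relation. The Hamiltonian is quadratic, so conjugation by e^{-itH} is
of this kind, and the state remains Gaussian at all times (`SatisfiesWick.exp_conj`).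

The entropy of a Gaussian state is a function of its correlation matrix Γ. The map f ↦ f' is (1 -
Γ)/2, particle-hole symmetry pairs the eigenvalues a and -a, and the eigenvectors with a > 0 define
fermionic modes b with (1 + a) ρ b = (1 - a) b ρ. The state with independent occupations of
probabilities (1 ± a)/2, maximally mixed on the kernel of Γ, obeys the same relations. These
relations fix all correlators, so it equals ρ (`gaussian_normal_form`), and the entropy becomes a
sum over modes (`renyiEntropy_gaussian`). The strip is an initial segment of the ordered sites, so
no sign strings arise and its reduced state is again Gaussian (`renyiEntropy_reducedDensity`). The
same theorem, applied to a chain, gives the last claim.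

Translation by k sites is a unitary that commutes with H and fixes the density matrix. It multiplies
an operator of momentum q by e^{-iqk}, which depends on n_y alone and separates the sectors, so
correlators between different sectors vanish (`fourierY_block`). Traces of powers of Γ, hence
entropies, are then sums over sectors.

For the moment series, convergence bounds its terms. Thus the Taylor series of h_n reaches at least
the radius |a| for each eigenvalue a, where the identity theorem equates it with h_n; Abel's theorem
and continuity of h_n on [-1, 1] supply the endpoint (`moment_series_eq`). -/

/-- The sign `(-1)^{#{j ∈ T : j < i}}`. -/
def sgn (i : Λ) (T : Finset Λ) : ℂ := (-1) ^ (T.filter (fun j => j < i)).card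

lemma sgn_mul_self (i : Λ) (T : Finset Λ) : sgn i T * sgn i T = 1 := by
  simp [sgn, ← mul_pow]

lemma star_sgn (i : Λ) (T : Finset Λ) : star (sgn i T) = sgn i T := by
  simp [sgn]

lemma sgn_insert (i j : Λ) (T : Finset Λ) (hj : j ∉ T) :
    sgn i (insert j T) = (if j < i then -1 else 1) * sgn i T := by
  unfold sgn
  rw [Finset.filter_insert]
  split_ifs with h
  · rw [Finset.card_insert_of_notMem (by simp [hj])]; ring
  · simp

lemma sgn_erase (i j : Λ) (T : Finset Λ) (hj : j ∈ T) :
    sgn i (T.erase j) = (if j < i then -1 else 1) * sgn i T := by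
  conv_rhs => rw [← Finset.insert_erase hj]
  rw [sgn_insert _ _ _ (by simp)]
  split_ifs <;> ring

lemma mul_ann_apply (M : Op Λ) (i : Λ) (S T : Finset Λ) :
    (M * ann i) S T = if i ∈ T then sgn i T * M S (T.erase i) else 0 := by
  rw [Matrix.mul_apply]
  simp only [ann, Matrix.of_apply]
  split_ifs with h
  · rw [Finset.sum_eq_single (T.erase i)]
    · simp [h, sgn, mul_comm]
    · intro b _ hb
      simp [hb]
    · simp
  · simp [h]

lemma mul_conjTranspose_ann_apply (M : Op Λ) (i : Λ) (S T : Finset Λ) :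
    (M * (ann i)ᴴ) S T = if i ∈ T then 0 else sgn i T * M S (insert i T) := by
  rw [Matrix.mul_apply]
  simp only [Matrix.conjTranspose_apply, ann, Matrix.of_apply]
  split_ifs with h
  · refine Finset.sum_eq_zero fun U _ => ?_
    rw [if_neg]
    · simp
    · rintro ⟨_, rfl⟩
      simp at h
  · rw [Finset.sum_eq_single (insert i T)]
    · have := sgn_insert i i T h
      simp only [lt_irrefl, if_false, one_mul] at this
      rw [if_pos ⟨Finset.mem_insert_self _ _, by rw [Finset.erase_insert h]⟩]
      change _ * star (sgn i (insert i T)) = _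
      rw [this, star_sgn, mul_comm]
    · intro U _ hU
      rw [if_neg]
      · simp
      · rintro ⟨h1, rfl⟩
        exact hU (Finset.insert_erase h1).symm
    · simp

lemma ann_anticomm_ann (i j : Λ) : ann i * ann j + ann j * ann i = 0 := by
  ext S T
  have h1 : ∀ i j : Λ, (ann i * ann j) S T = if j ∈ T ∧ i ∈ T ∧ i ≠ j then
      sgn j T * (sgn i (T.erase j)) * (1 : Op Λ) S ((T.erase j).erase i) else 0 := by
    intro i j
    rw [mul_ann_apply]
    have := mul_ann_apply (1 : Op Λ) i S (T.erase j)
    rw [one_mul] at this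
    rw [this]
    by_cases hj : j ∈ T <;> by_cases hi : i ∈ T <;> by_cases hij : i = j <;> simp [*, mul_assoc]
  rw [Matrix.add_apply, h1, h1]
  rcases eq_or_ne i j with rfl | hij
  · simp
  by_cases hj : j ∈ T <;> by_cases hi : i ∈ T <;>
    simp only [hj, hi, hij, ne_eq, not_true, not_false_eq_true, and_true, and_false, if_true,
      if_false, true_and, false_and, add_zero, Matrix.zero_apply, hij.symm]
  rw [sgn_erase _ _ _ hj, sgn_erase _ _ _ hi, Finset.erase_right_comm]
  rcases lt_or_gt_of_ne hij with h | h
  · simp [h, h.not_gt]; ring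
  · simp [h, h.not_gt]; ring

lemma ann_anticomm_conjTranspose_ann (i j : Λ) :
    ann i * (ann j)ᴴ + (ann j)ᴴ * ann i = if i = j then 1 else 0 := by
  ext S T
  have h1 := mul_ann_apply (1 : Op Λ) i S (insert j T)
  have h2 := mul_conjTranspose_ann_apply (1 : Op Λ) j S (T.erase i)
  rw [one_mul] at h1 h2
  rw [Matrix.add_apply, mul_ann_apply, mul_conjTranspose_ann_apply, h1, h2]
  by_cases hij : i = j
  · subst hij
    by_cases hi : i ∈ T
    · simp only [hi, Finset.insert_erase, if_true, Finset.mem_erase, ne_eq, not_true, false_and,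
        if_false, zero_add]
      rw [sgn_erase _ _ _ hi]
      simp [← mul_assoc, sgn_mul_self, Finset.insert_erase hi, Matrix.one_apply]
    · simp only [hi, if_false, Finset.mem_insert_self, if_true, Finset.erase_insert hi, add_zero]
      rw [sgn_insert _ _ _ hi]
      simp [← mul_assoc, sgn_mul_self, Finset.erase_insert hi, Matrix.one_apply]
  · by_cases hj : j ∈ T <;> by_cases hi : i ∈ T <;>
      simp only [hj, hi, hij, Ne.symm hij, if_true, if_false, Finset.mem_erase, Finset.mem_insert,
        or_true, ne_eq, not_true, not_false_eq_true, and_true, and_false, mul_zero, add_zero,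
        Matrix.zero_apply, or_self]
    rw [sgn_erase _ _ _ hi, sgn_insert _ _ _ hj, Finset.erase_insert_of_ne (Ne.symm hij)]
    rcases lt_or_gt_of_ne hij with h | h
    · simp [h, h.not_gt]; ring
    · simp [h, h.not_gt]; ring

/-- Exchange of the creation and the annihilation operator of a site. -/
def dual (u : Λ × Fin 2) : Λ × Fin 2 := (u.1, Fin.rev u.2)

@[simp] lemma dual_dual (u : Λ × Fin 2) : dual (dual u) = u := by simp [dual]

lemma conjTranspose_field (u : Λ × Fin 2) : (field u)ᴴ = field (dual u) := by
  obtain ⟨i, c⟩ := u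
  fin_cases c <;> simp [field, doublet, dual]

lemma field_anticomm (u w : Λ × Fin 2) :
    field u * field w + field w * field u = if w = dual u then 1 else 0 := by
  obtain ⟨i, c⟩ := u
  obtain ⟨j, d⟩ := w
  have h0 : (ann i)ᴴ * (ann j)ᴴ + (ann j)ᴴ * (ann i)ᴴ = 0 := by
    rw [← Matrix.conjTranspose_mul, ← Matrix.conjTranspose_mul, ← Matrix.conjTranspose_add,
      ann_anticomm_ann, Matrix.conjTranspose_zero]
  have h1 := ann_anticomm_ann i j
  have h2 := ann_anticomm_conjTranspose_ann i j
  have h3 := ann_anticomm_conjTranspose_ann j i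
  rw [add_comm] at h3
  fin_cases c <;> fin_cases d <;> simp [field, doublet, dual, Prod.ext_iff, h0, h1, h2, h3, eq_comm]

variable (Λ) in
/-- The span of the creation and annihilation operators. -/
def fieldSpan : Submodule ℂ (Op Λ) := Submodule.span ℂ (Set.range field)

lemma field_mem (u : Λ × Fin 2) : field u ∈ fieldSpan Λ := Submodule.subset_span ⟨u, rfl⟩

/-- The linear combination `∑ v_u B_u` of the fields. -/
def lin : (Λ × Fin 2 → ℂ) →ₗ[ℂ] Op Λ := Fintype.linearCombination ℂ field

lemma lin_apply (v : Λ × Fin 2 → ℂ) : lin v = ∑ u, v u • field u := by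
  simp [lin, Fintype.linearCombination_apply]

lemma lin_single (u : Λ × Fin 2) : lin (Pi.single u 1) = field u := by
  simp [lin]

lemma mem_fieldSpan_iff {b : Op Λ} : b ∈ fieldSpan Λ ↔ ∃ v, lin v = b := by
  rw [fieldSpan, ← Fintype.range_linearCombination]
  rfl

lemma lin_mem (v : Λ × Fin 2 → ℂ) : lin v ∈ fieldSpan Λ := mem_fieldSpan_iff.2 ⟨v, rfl⟩

lemma lin_anticomm (v w : Λ × Fin 2 → ℂ) :
    lin v * lin w + lin w * lin v = (∑ u, v u * w (dual u)) • (1 : Op Λ) := by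
  have : ∀ v w : Λ × Fin 2 → ℂ, lin v * lin w = ∑ u, ∑ x, (v u * w x) • (field u * field x) := by
    intro v w
    rw [lin_apply, lin_apply, Finset.sum_mul_sum]
    simp [smul_smul, mul_comm]
  rw [this, this, Finset.sum_comm (f := fun u x => (w u * v x) • (field u * field x)),
    ← Finset.sum_add_distrib, Finset.sum_smul]
  refine Finset.sum_congr rfl fun u _ => ?_
  rw [← Finset.sum_add_distrib, Finset.sum_eq_single (dual u)]
  · rw [mul_comm (w _), ← smul_add, field_anticomm]; simp
  · intro x _ hx
    rw [mul_comm (w _), ← smul_add, field_anticomm, if_neg hx, smul_zero]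
  · simp

lemma fieldSpan_anticomm {b c : Op Λ} (hb : b ∈ fieldSpan Λ) (hc : c ∈ fieldSpan Λ) :
    ∃ z : ℂ, b * c + c * b = z • 1 := by
  obtain ⟨v, rfl⟩ := mem_fieldSpan_iff.1 hb
  obtain ⟨w, rfl⟩ := mem_fieldSpan_iff.1 hc
  exact ⟨_, lin_anticomm v w⟩

/-- The product of a list of fields. -/
def mono (l : List (Λ × Fin 2)) : Op Λ := (l.map field).prod

@[simp] lemma mono_nil : mono ([] : List (Λ × Fin 2)) = 1 := rfl

@[simp] lemma mono_cons (u : Λ × Fin 2) (l : List (Λ × Fin 2)) :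
    mono (u :: l) = field u * mono l := by simp [mono]

/-- Moving a linear combination of fields through a product of fields. -/
lemma graded_comm_mono {b : Op Λ} (c : Λ × Fin 2 → ℂ)
    (hc : ∀ u, b * field u + field u * b = c u • 1) (l : List (Λ × Fin 2)) :
    b * mono l = (-1 : ℂ) ^ l.length • (mono l * b) +
      ∑ j : Fin l.length, ((-1 : ℂ) ^ (j : ℕ) * c (l.get j)) • mono (l.eraseIdx j) := by
  induction l with
  | nil => simp
  | cons u l ih =>
    have h := eq_sub_of_add_eq (hc u)
    have : b * mono (u :: l) = c u • mono l - field u * (b * mono l) := by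
      rw [mono_cons, ← mul_assoc, h, sub_mul, smul_mul_assoc, one_mul, mul_assoc]
    have e1 : (-1 : ℂ) ^ (u :: l).length = -(-1) ^ l.length := by
      rw [List.length_cons, pow_succ]; ring
    have e2 : ∀ j : Fin l.length, ((-1 : ℂ) ^ ((Fin.succ j : Fin (l.length + 1)) : ℕ) *
        c ((u :: l).get (Fin.succ j))) • mono ((u :: l).eraseIdx (Fin.succ j : Fin (l.length + 1))) =
        -(field u * (((-1 : ℂ) ^ (j : ℕ) * c (l.get j)) • mono (l.eraseIdx j))) := by
      intro j
      simp [pow_succ]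
    rw [this, ih, e1]
    refine .trans ?_ (congrArg₂ (· + ·) rfl (Fin.sum_univ_succ (n := l.length) _).symm)
    refine .trans ?_ (congrArg₂ (· + ·) rfl (congrArg₂ (· + ·) rfl
      (Finset.sum_congr rfl fun j _ => (e2 j).symm)))
    simp only [mul_add, Finset.sum_neg_distrib, Finset.mul_sum, mono_cons, mul_smul_comm,
      mul_assoc, neg_smul, Fin.val_zero, pow_zero, one_mul, List.eraseIdx_cons_zero]
    change c u • mono l - _ = -_ + (c u • mono l + -_)
    abel

/-- The parity operator `(-1)^N`. -/
def parity : Op Λ := Matrix.diagonal fun S => (-1) ^ S.card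

lemma parity_mul_self : (parity : Op Λ) * parity = 1 := by
  simp [parity, ← mul_pow]

lemma parity_ann (i : Λ) : parity * ann i = -(ann i * parity) := by
  ext S T
  rw [parity, Matrix.diagonal_mul, Matrix.neg_apply, Matrix.mul_diagonal]
  simp only [ann, Matrix.of_apply]
  split_ifs with h
  · obtain ⟨h, rfl⟩ := h
    rw [← Finset.card_erase_add_one h]; ring
  · simp

lemma conjTranspose_parity : (parity : Op Λ)ᴴ = parity := by
  simp [parity, Matrix.diagonal_conjTranspose, funext_iff, Pi.star_def]

lemma parity_field (u : Λ × Fin 2) : parity * field u = -(field u * parity) := by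
  obtain ⟨i, c⟩ := u
  fin_cases c
  · have := congrArg Matrix.conjTranspose (parity_ann i)
    rw [Matrix.conjTranspose_neg, Matrix.conjTranspose_mul, Matrix.conjTranspose_mul,
      conjTranspose_parity] at this
    simp [field, doublet, this]
  · simp [field, doublet, parity_ann]

lemma parity_fieldSpan {b : Op Λ} (hb : b ∈ fieldSpan Λ) : parity * b = -(b * parity) := by
  induction hb using Submodule.span_induction with
  | mem x hx => obtain ⟨u, rfl⟩ := hx; exact parity_field u
  | zero => simp
  | add x y _ _ hx hy => rw [mul_add, hx, hy, add_mul, neg_add]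
  | smul c x _ hx => simp [hx]

lemma parity_mono (l : List (Λ × Fin 2)) :
    parity * mono l = (-1 : ℂ) ^ l.length • (mono l * parity) := by
  induction l with
  | nil => simp
  | cons u l ih =>
    rw [mono_cons, ← mul_assoc, parity_field, neg_mul, mul_assoc, ih]
    simp [pow_succ, mul_assoc]

/-! ### The fields generate all operators -/

lemma ann_eq_smul (i : Λ) (T : Finset Λ) (h : i ∈ T) :
    ann i * Matrix.single T T (1 : ℂ) = sgn i T • Matrix.single (T.erase i) T 1 := by
  ext S U
  rw [Matrix.mul_apply]
  by_cases hU : T = U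
  · subst hU
    simp [Matrix.single_apply, ann, h, eq_comm, sgn]
  · simp [Matrix.single_apply, hU]

lemma number_eq (i : Λ) :
    (ann i)ᴴ * ann i = Matrix.diagonal fun S => if i ∈ S then (1 : ℂ) else 0 := by
  ext S T
  have h2 := mul_conjTranspose_ann_apply (1 : Op Λ) i S (T.erase i)
  rw [one_mul] at h2
  rw [mul_ann_apply, h2]
  by_cases h : i ∈ T
  · simp only [h, Finset.mem_erase, ne_eq, not_true, false_and, if_true, if_false,
      Finset.insert_erase]
    rw [sgn_erase _ _ _ h]
    simp only [lt_irrefl, if_false, one_mul, ← mul_assoc, sgn_mul_self]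
    by_cases hS : S = T
    · subst hS; simp [h, Matrix.one_apply, Finset.insert_erase h]
    · simp [hS, Matrix.one_apply, Finset.insert_erase h]
  · simp only [h, if_false]
    by_cases hS : S = T
    · subst hS; simp [h]
    · simp [hS]

/-- The projection onto e_T is a product of number operators and their complements. Annihilators
carry it down to the matrix unit from e_T to the vacuum, and adjoints and products of such units
give all matrix units. -/
lemma adjoin_field_eq_top : Algebra.adjoin ℂ (Set.range (field : Λ × Fin 2 → Op Λ)) = ⊤ := by
  set 𝒜 := Algebra.adjoin ℂ (Set.range (field : Λ × Fin 2 → Op Λ)) with h𝒜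
  have hf : ∀ u, (field u : Op Λ) ∈ 𝒜 := fun u => Algebra.subset_adjoin ⟨u, rfl⟩
  have ha : ∀ i : Λ, ann i ∈ 𝒜 := fun i => by simpa [field, doublet] using hf (i, 1)
  have ha' : ∀ i : Λ, (ann i)ᴴ ∈ 𝒜 := fun i => by simpa [field, doublet] using hf (i, 0)
  have hdiag : ∀ T : Finset Λ, Matrix.single T T (1 : ℂ) ∈ 𝒜 := by
    intro T
    have h1 : ∀ i : Λ, (fun S : Finset Λ => if i ∈ S then (1 : ℂ) else 0) ∈
        𝒜.comap (Matrix.diagonalAlgHom ℂ) := by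
      intro i
      rw [Subalgebra.mem_comap, Matrix.diagonalAlgHom_apply, ← number_eq]
      exact mul_mem (ha' i) (ha i)
    have h2 : (∏ i : Λ, if i ∈ T then (fun S : Finset Λ => if i ∈ S then (1 : ℂ) else 0)
        else 1 - (fun S : Finset Λ => if i ∈ S then (1 : ℂ) else 0)) ∈
        𝒜.comap (Matrix.diagonalAlgHom ℂ) := by
      refine Subalgebra.prod_mem _ fun i _ => ?_
      split_ifs
      · exact h1 i
      · exact sub_mem (one_mem _) (h1 i)
    rw [Subalgebra.mem_comap, Matrix.diagonalAlgHom_apply] at h2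
    convert h2 using 1
    ext S U
    rw [Matrix.single_apply, Matrix.diagonal_apply]
    by_cases hSU : S = U
    · subst hSU
      simp only [and_self, if_true, Finset.prod_apply]
      split_ifs with hT
      · subst hT
        refine (Finset.prod_eq_one fun i _ => ?_).symm
        by_cases hi : i ∈ T <;> simp [hi]
      · obtain ⟨i, hi⟩ := not_forall.1 (fun h => hT (Finset.ext h))
        refine (Finset.prod_eq_zero (Finset.mem_univ i) ?_).symm
        by_cases h : i ∈ T <;> by_cases h' : i ∈ S <;> simp_all
    · rw [if_neg hSU, if_neg]
      rintro ⟨rfl, rfl⟩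
      exact hSU rfl
  have hdown : ∀ T : Finset Λ, Matrix.single ∅ T (1 : ℂ) ∈ 𝒜 := by
    intro T
    induction T using Finset.induction_on with
    | empty => exact hdiag ∅
    | insert i T hi ih =>
      have h := ann_eq_smul i (insert i T) (by simp)
      rw [Finset.erase_insert hi] at h
      have h3 : Matrix.single T (insert i T) (1 : ℂ) =
          sgn i (insert i T) • (ann i * Matrix.single (insert i T) (insert i T) (1 : ℂ)) := by
        rw [h, smul_smul, sgn_mul_self, one_smul]
      have h4 : Matrix.single (∅ : Finset Λ) (insert i T) (1 : ℂ) =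
          Matrix.single (∅ : Finset Λ) T (1 : ℂ) * Matrix.single T (insert i T) (1 : ℂ) := by simp
      rw [h4, h3]
      exact mul_mem ih (Subalgebra.smul_mem _ (mul_mem (ha i) (hdiag _)) _)
  have hstar : ∀ X ∈ 𝒜, Xᴴ ∈ 𝒜 := by
    intro X hX
    rw [h𝒜] at hX
    induction hX using Algebra.adjoin_induction with
    | mem x hx => obtain ⟨u, rfl⟩ := hx; rw [conjTranspose_field]; exact hf _
    | algebraMap r =>
      rw [← Matrix.star_eq_conjTranspose, ← algebraMap_star_comm]; exact Subalgebra.algebraMap_mem _ _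
    | add x y _ _ hx hy => rw [Matrix.conjTranspose_add]; exact add_mem hx hy
    | mul x y _ _ hx hy => rw [Matrix.conjTranspose_mul]; exact mul_mem hy hx
  refine eq_top_iff.2 fun X _ => ?_
  rw [Matrix.matrix_eq_sum_single X]
  refine sum_mem fun S _ => sum_mem fun T _ => ?_
  have h5 : Matrix.single S T (X S T) =
      X S T • ((Matrix.single (∅ : Finset Λ) S (1 : ℂ))ᴴ *
        Matrix.single (∅ : Finset Λ) T (1 : ℂ)) := by
    rw [Matrix.conjTranspose_single]; simp
  rw [h5]
  exact Subalgebra.smul_mem _ (mul_mem (hstar _ (hdown S)) (hdown T)) _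

lemma span_mono_eq_top : Submodule.span ℂ (Set.range (mono : List (Λ × Fin 2) → Op Λ)) = ⊤ := by
  have h := congrArg Subalgebra.toSubmodule (adjoin_field_eq_top (Λ := Λ))
  rw [Algebra.adjoin_eq_span, Algebra.top_toSubmodule] at h
  rw [← h]
  congr 1
  ext X
  constructor
  · rintro ⟨l, rfl⟩
    refine Submonoid.list_prod_mem _ fun x hx => ?_
    obtain ⟨u, _, rfl⟩ := List.mem_map.1 hx
    exact Submonoid.subset_closure ⟨u, rfl⟩
  · intro hX
    obtain ⟨l, hl, rfl⟩ := Submonoid.exists_list_of_mem_closure hX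
    obtain ⟨m, rfl⟩ : ∃ m : List (Λ × Fin 2), l = m.map field := by
      rw [← Set.mem_range.trans (exists_congr fun _ => eq_comm), Set.range_list_map]
      exact fun x hx => hl x hx
    exact ⟨m, rfl⟩

/-- Monomials in the fields span all operators and the trace pairing is nondegenerate, so operator
identities can be checked on correlators. -/
lemma ext_of_trace_mono {X Y : Op Λ} (h : ∀ l, (X * mono l).trace = (Y * mono l).trace) :
    X = Y := by
  have : ∀ Z : Op Λ, (X * Z).trace = (Y * Z).trace := by
    intro Z
    have hZ : Z ∈ Submodule.span ℂ (Set.range (mono : List (Λ × Fin 2) → Op Λ)) := by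
      rw [span_mono_eq_top]; trivial
    induction hZ using Submodule.span_induction with
    | mem x hx => obtain ⟨l, rfl⟩ := hx; exact h l
    | zero => simp
    | add x y _ _ hx hy => simp [mul_add, hx, hy]
    | smul c x _ hx => simp [hx]
  exact Matrix.ext_iff_trace_mul_right.2 this

end CAR

/-! ### Wick's theorem as an intertwining relation. -/

section Wick

variable {Λ : Type} [Fintype Λ] [LinearOrder Λ]

lemma expect_add (ρ X Y : Op Λ) : expect ρ (X + Y) = expect ρ X + expect ρ Y := by
  simp [expect, mul_add]

lemma expect_smul (ρ X : Op Λ) (c : ℂ) : expect ρ (c • X) = c * expect ρ X := by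
  simp [expect]

lemma expect_sum {ι : Type*} (s : Finset ι) (ρ : Op Λ) (f : ι → Op Λ) :
    expect ρ (∑ i ∈ s, f i) = ∑ i ∈ s, expect ρ (f i) := by
  simp [expect, Finset.mul_sum, Matrix.trace_sum]

/-- `ρ` commutes with the fermion parity. -/
def IsEven (ρ : Op Λ) : Prop := parity * ρ = ρ * parity

/-- An intertwining relation between `ρ` and the fields that characterizes Gaussian states. -/
def Intertwines (ρ : Op Λ) : Prop :=
  ∀ b ∈ fieldSpan Λ, ∃ b' ∈ fieldSpan Λ, ρ * b = ρ * b' + b' * ρ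

lemma IsEven.expect_odd {ρ : Op Λ} (h : IsEven ρ) {l : List (Λ × Fin 2)} (hl : Odd l.length) :
    expect ρ (mono l) = 0 := by
  have h1 : expect ρ (mono l) = -expect ρ (mono l) := by
    calc expect ρ (mono l) = (ρ * mono l * (parity * parity)).trace := by
          rw [parity_mul_self, mul_one, expect]
      _ = (ρ * parity * mono l * parity).trace := by
          rw [← mul_assoc, Matrix.trace_mul_comm, ← mul_assoc, ← mul_assoc, h]
      _ = -(ρ * mono l * (parity * parity)).trace := by
          rw [mul_assoc ρ, parity_mono, hl.neg_one_pow]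
          simp [mul_assoc]
      _ = _ := by rw [parity_mul_self, mul_one, expect]
  exact self_eq_neg.1 h1

lemma SatisfiesWick.expect_mono_cons {ρ : Op Λ} (h : SatisfiesWick ρ) (u : Λ × Fin 2)
    (l : List (Λ × Fin 2)) : expect ρ (field u * mono l) = ∑ j : Fin l.length,
        (-1 : ℂ) ^ (j : ℕ) * expect ρ (field u * field (l.get j)) *
          expect ρ (mono (l.eraseIdx j)) := h u l

lemma SatisfiesWick.expect_odd {ρ : Op Λ} (h : SatisfiesWick ρ) (n : ℕ) (l : List (Λ × Fin 2))
    (hl : l.length = 2 * n + 1) : expect ρ (mono l) = 0 := by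
  induction n generalizing l with
  | zero =>
    obtain ⟨u, rfl⟩ := List.length_eq_one_iff.1 hl
    have := h u []
    simpa using this
  | succ n ih =>
    cases l with
    | nil => simp at hl
    | cons u l =>
      rw [mono_cons, h.expect_mono_cons]
      refine Finset.sum_eq_zero fun j _ => ?_
      rw [ih, mul_zero]
      rw [List.length_eraseIdx_of_lt j.2]
      simp at hl
      omega

/-- Conjugation by the parity multiplies a correlator of length r by (-1)^r, and the correlators of
odd length vanish. -/
lemma SatisfiesWick.isEven {ρ : Op Λ} (h : SatisfiesWick ρ) : IsEven ρ := by
  have key : parity * ρ * parity = ρ := by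
    refine ext_of_trace_mono fun l => ?_
    have h1 : (parity * ρ * parity * mono l).trace = (-1) ^ l.length * expect ρ (mono l) := by
      rw [mul_assoc, Matrix.trace_mul_comm, parity_mono, smul_mul_assoc, mul_assoc,
        ← mul_assoc parity parity, parity_mul_self, one_mul, Matrix.trace_smul,
        Matrix.trace_mul_comm, smul_eq_mul, expect]
    rw [h1]
    rcases Nat.even_or_odd l.length with hl | hl
    · rw [hl.neg_one_pow, one_mul, expect]
    · obtain ⟨n, hn⟩ := hl
      rw [h.expect_odd n l hn, mul_zero, ← expect, h.expect_odd n l hn]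
  calc parity * ρ = parity * ρ * (parity * parity) := by rw [parity_mul_self, mul_one]
    _ = ρ * parity := by rw [← mul_assoc, key]

/-- The coefficients of the operator `b'` in the intertwining relation of a Gaussian state. -/
def partner (ρ : Op Λ) (u x : Λ × Fin 2) : ℂ := expect ρ (field u * field (dual x))

/-- Tested against a monomial X of odd length, the right side is the expectation of b X + X b, where
b is the combination of fields whose anticommutators are the two-point functions. Moving b through X
produces exactly the Wick expansion. -/
lemma SatisfiesWick.field_intertwines {ρ : Op Λ} (h : SatisfiesWick ρ) (u : Λ × Fin 2) :
    ρ * field u = ρ * lin (partner ρ u) + lin (partner ρ u) * ρ := by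
  have hc : ∀ x, lin (partner ρ u) * field x + field x * lin (partner ρ u) =
      expect ρ (field u * field x) • 1 := by
    intro x
    have hl := lin_anticomm (partner ρ u) (Pi.single x 1)
    rw [lin_single] at hl
    rw [hl]
    congr 1
    rw [Finset.sum_eq_single (dual x)]
    · simp [partner]
    · intro y _ hy
      have : dual y ≠ x := fun h => hy (by rw [← h, dual_dual])
      simp [this]
    · simp
  refine ext_of_trace_mono fun l => ?_
  rw [add_mul, Matrix.trace_add, mul_assoc, mul_assoc, mul_assoc,
    Matrix.trace_mul_comm (lin _) (ρ * mono l), mul_assoc]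
  change expect ρ (field u * mono l) = expect ρ _ + expect ρ _
  rw [← expect_add, graded_comm_mono _ hc l]
  -- For even length, each term contains a correlator of odd length and vanishes. For odd length,
  -- the sign in `graded_comm_mono` cancels the term `mono l * b` and leaves the sum over
  -- contractions.
  rcases Nat.even_or_odd l.length with hl | hl
  · have h0 := h.isEven.expect_odd (l := u :: l) (by simpa using hl.add_one)
    rw [mono_cons] at h0
    have h2 : expect ρ (mono l * lin (partner ρ u)) = 0 := by
      rw [lin_apply, Finset.mul_sum, expect_sum]
      refine Finset.sum_eq_zero fun x _ => ?_
      have h3 : mono l * partner ρ u x • field x = partner ρ u x • mono (l ++ [x]) := by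
        simp [mono]
      rw [h3, expect_smul, h.isEven.expect_odd, mul_zero]
      simpa using hl.add_one
    rw [h0, hl.neg_one_pow, one_smul, expect_add, expect_add, h2, expect_sum]
    rw [Finset.sum_eq_zero]
    · simp
    intro j _
    rw [expect_smul, h.isEven.expect_odd, mul_zero]
    rw [List.length_eraseIdx_of_lt j.2]
    exact Nat.Even.sub_odd (by have := j.2; omega) hl odd_one
  · rw [h.expect_mono_cons, hl.neg_one_pow, neg_smul, one_smul, add_comm (-_), add_assoc,
      neg_add_cancel, add_zero, expect_sum]
    simp [expect_smul]

lemma SatisfiesWick.intertwines {ρ : Op Λ} (h : SatisfiesWick ρ) : Intertwines ρ := by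
  intro b hb
  induction hb using Submodule.span_induction with
  | mem x hx => obtain ⟨u, rfl⟩ := hx; exact ⟨_, lin_mem _, h.field_intertwines u⟩
  | zero => exact ⟨0, zero_mem _, by simp⟩
  | add x y _ _ hx hy =>
    obtain ⟨x', hx', ex⟩ := hx
    obtain ⟨y', hy', ey⟩ := hy
    exact ⟨x' + y', add_mem hx' hy', by rw [mul_add, ex, ey, mul_add, add_mul]; abel⟩
  | smul c x _ hx =>
    obtain ⟨x', hx', ex⟩ := hx
    exact ⟨c • x', Submodule.smul_mem _ _ hx', by simp [ex]⟩

/-- Cyclicity turns the relation into ⟨f X⟩ = ⟨b X + X b⟩. For a single field X the anticommutator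
is a scalar, which trace one identifies as the two-point function; moving `b` through a longer X
then gives Wick's expansion. -/
lemma Intertwines.satisfiesWick {ρ : Op Λ} (h : Intertwines ρ) (he : IsEven ρ)
    (htr : ρ.trace = 1) : SatisfiesWick ρ := by
  intro u l
  change expect ρ (field u * mono l) = ∑ j : Fin l.length, (-1 : ℂ) ^ (j : ℕ) *
    expect ρ (field u * field (l.get j)) * expect ρ (mono (l.eraseIdx j))
  obtain ⟨b, hb, hub⟩ := h _ (field_mem u)
  have key : ∀ X, expect ρ (field u * X) = expect ρ (b * X + X * b) := by
    intro X
    rw [expect_add]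
    unfold expect
    rw [← mul_assoc, hub, add_mul, Matrix.trace_add, mul_assoc, mul_assoc b,
      Matrix.trace_mul_comm b, mul_assoc]
  have hc : ∀ x, b * field x + field x * b = expect ρ (field u * field x) • 1 := by
    intro x
    obtain ⟨z, hz⟩ := fieldSpan_anticomm hb (field_mem x)
    rw [key, hz, expect_smul]
    simp [expect, htr]
  rcases Nat.even_or_odd l.length with hl | hl
  · have h0 := he.expect_odd (l := u :: l) (by simpa using hl.add_one)
    rw [mono_cons] at h0
    rw [h0, Finset.sum_eq_zero]
    intro j _
    rw [he.expect_odd, mul_zero]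
    rw [List.length_eraseIdx_of_lt j.2]
    exact Nat.Even.sub_odd (by have := j.2; omega) hl odd_one
  · rw [key, graded_comm_mono _ hc l, hl.neg_one_pow, neg_smul, one_smul, add_comm (-_), add_assoc,
      neg_add_cancel, add_zero, expect_sum]
    simp [expect_smul]

/-- Wick's expansion reduces each correlator to two-point functions and shorter correlators, so
induction on the length determines all of them. -/
lemma SatisfiesWick.eq_of_expect_eq {ρ σ : Op Λ} (hρ : SatisfiesWick ρ) (hσ : SatisfiesWick σ)
    (htr : ρ.trace = σ.trace)
    (h : ∀ u x, expect ρ (field u * field x) = expect σ (field u * field x)) : ρ = σ := by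
  refine ext_of_trace_mono fun l => ?_
  change expect ρ _ = expect σ _
  induction hn : l.length using Nat.strong_induction_on generalizing l with
  | _ n ih =>
    cases l with
    | nil => simpa [expect] using htr
    | cons u l =>
      rw [mono_cons, hρ.expect_mono_cons, hσ.expect_mono_cons]
      refine Finset.sum_congr rfl fun j _ => ?_
      rw [h, ih _ _ _ rfl]
      rw [List.length_eraseIdx_of_lt j.2]
      simp at hn
      omega

/-- The relation refers to the fields only through their span, so it is transported by any
conjugation that preserves the span. -/
lemma Intertwines.conj {ρ : Op Λ} (h : Intertwines ρ) {U V : Op Λ} (hVU : V * U = 1)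
    (h1 : ∀ b ∈ fieldSpan Λ, U * b * V ∈ fieldSpan Λ)
    (h2 : ∀ b ∈ fieldSpan Λ, V * b * U ∈ fieldSpan Λ) : Intertwines (U * ρ * V) := by
  intro b hb
  have hUV : U * V = 1 := mul_eq_one_comm.1 hVU
  obtain ⟨b', hb', e⟩ := h _ (h2 b hb)
  refine ⟨U * b' * V, h1 _ hb', ?_⟩
  calc U * ρ * V * b = U * (ρ * (V * b * U)) * V := by
        simp only [mul_assoc, hUV, mul_one]
    _ = U * (ρ * b') * V + U * (b' * ρ) * V := by rw [e, mul_add, add_mul]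
    _ = U * ρ * (V * U) * b' * V + U * b' * (V * U) * ρ * V := by
        simp only [hVU, mul_one, mul_assoc]
    _ = _ := by simp only [mul_assoc]

/-- The adjoint action of a product of two fields preserves the span of the fields. -/
lemma commutator_mem {f g b : Op Λ} (hf : f ∈ fieldSpan Λ) (hg : g ∈ fieldSpan Λ)
    (hb : b ∈ fieldSpan Λ) : f * g * b - b * (f * g) ∈ fieldSpan Λ := by
  obtain ⟨z, hz⟩ := fieldSpan_anticomm hg hb
  obtain ⟨w, hw⟩ := fieldSpan_anticomm hf hb
  have : f * g * b - b * (f * g) = z • f - w • g := by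
    rw [mul_assoc, eq_sub_of_add_eq hz, mul_sub, ← mul_assoc b, eq_sub_of_add_eq' hw, sub_mul]
    simp [mul_assoc]
  rw [this]
  exact sub_mem (Submodule.smul_mem _ _ hf) (Submodule.smul_mem _ _ hg)

end Wick

/-! ### Conjugation by exponentials of quadratic operators. -/

section Evolution

/-- Conjugation by `exp a` preserves a closed subspace that is preserved by the commutator with
`a`. -/
lemma exp_conj_mem {𝔸 : Type*} [NormedRing 𝔸] [NormedAlgebra ℂ 𝔸] [CompleteSpace 𝔸]
    (F : Submodule ℂ 𝔸) (hF : IsClosed (F : Set 𝔸)) (a : 𝔸)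
    (h : ∀ b ∈ F, a * b - b * a ∈ F) {b : 𝔸} (hb : b ∈ F) :
    NormedSpace.exp a * b * NormedSpace.exp (-a) ∈ F := by
  let _ : NormedAlgebra ℚ 𝔸 := NormedAlgebra.restrictScalars ℚ ℂ 𝔸
  let _ : NormedAlgebra ℚ (𝔸 →L[ℂ] 𝔸) := NormedAlgebra.restrictScalars ℚ ℂ _
  -- Left multiplication by a and right multiplication by -a commute, so the exponential of their
  -- sum, the commutator with a, is conjugation by exp a. Each term of its power series keeps `b` in
  -- the closed subspace.
  let lf : 𝔸 →+* (𝔸 →L[ℂ] 𝔸) :=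
    { toFun := fun x => ContinuousLinearMap.mul ℂ 𝔸 x
      map_one' := by ext; simp
      map_mul' := fun x y => by ext; simp [mul_assoc]
      map_zero' := by simp
      map_add' := fun x y => by simp }
  let rf : 𝔸ᵐᵒᵖ →+* (𝔸 →L[ℂ] 𝔸) :=
    { toFun := fun x => (ContinuousLinearMap.mul ℂ 𝔸).flip x.unop
      map_one' := by ext; simp
      map_mul' := fun x y => by ext; simp [mul_assoc]
      map_zero' := by simp
      map_add' := fun x y => by simp }
  have hl : lf (NormedSpace.exp a) = NormedSpace.exp (lf a) :=
    NormedSpace.map_exp lf (ContinuousLinearMap.mul ℂ 𝔸).continuous a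
  have hr : rf (NormedSpace.exp (.op (-a))) = NormedSpace.exp (rf (.op (-a))) :=
    NormedSpace.map_exp rf
      ((ContinuousLinearMap.mul ℂ 𝔸).flip.continuous.comp MulOpposite.continuous_unop) _
  have hcomm : Commute (lf a) (rf (.op (-a))) := by
    ext x
    simp [lf, rf, mul_assoc]
  have he := NormedSpace.exp_add_of_commute hcomm
  rw [← hl, ← hr, NormedSpace.exp_op] at he
  have hval : NormedSpace.exp (lf a + rf (.op (-a))) b =
      NormedSpace.exp a * b * NormedSpace.exp (-a) := by
    rw [he]
    simp [lf, rf, mul_assoc]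
  rw [← hval, NormedSpace.exp_eq_tsum ℂ]
  have hs := NormedSpace.expSeries_summable' (𝕂 := ℂ) (lf a + rf (.op (-a)))
  have hev : (∑' n : ℕ, ((n.factorial : ℂ)⁻¹) • (lf a + rf (.op (-a))) ^ n) b =
      ∑' n : ℕ, ((n.factorial : ℂ)⁻¹) • ((lf a + rf (.op (-a))) ^ n) b :=
    ((ContinuousLinearMap.apply ℂ 𝔸 b).map_tsum hs)
  beta_reduce
  rw [hev]
  refine tsum_mem hF fun n => Submodule.smul_mem _ _ ?_
  induction n with
  | zero => simpa using hb
  | succ n ih =>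
    rw [pow_succ', mul_apply_eq_comp]
    have := h _ ih
    simpa [lf, rf, sub_eq_add_neg] using this

variable {Λ : Type} [Fintype Λ] [LinearOrder Λ]

lemma exp_conj_mem_fieldSpan (a : Op Λ)
    (h : ∀ b ∈ fieldSpan Λ, a * b - b * a ∈ fieldSpan Λ) {b : Op Λ} (hb : b ∈ fieldSpan Λ) :
    NormedSpace.exp a * b * NormedSpace.exp (-a) ∈ fieldSpan Λ := by
  open scoped Matrix.Norms.Operator in
  exact exp_conj_mem (fieldSpan Λ) (Submodule.closed_of_finiteDimensional _) a h hb

variable (Λ) in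
/-- The span of the products of two fields. -/
def quadraticSpan : Submodule ℂ (Op Λ) :=
  Submodule.span ℂ {X | ∃ f ∈ fieldSpan Λ, ∃ g ∈ fieldSpan Λ, X = f * g}

lemma mul_mem_quadraticSpan {f g : Op Λ} (hf : f ∈ fieldSpan Λ) (hg : g ∈ fieldSpan Λ) :
    f * g ∈ quadraticSpan Λ := Submodule.subset_span ⟨f, hf, g, hg, rfl⟩

lemma quadraticSpan_commutator_mem {a b : Op Λ} (ha : a ∈ quadraticSpan Λ)
    (hb : b ∈ fieldSpan Λ) : a * b - b * a ∈ fieldSpan Λ := by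
  induction ha using Submodule.span_induction with
  | mem x hx => obtain ⟨f, hf, g, hg, rfl⟩ := hx; exact commutator_mem hf hg hb
  | zero => simp
  | add x y _ _ hx hy =>
    rw [add_mul, mul_add, add_sub_add_comm]
    exact add_mem hx hy
  | smul c x _ hx =>
    rw [smul_mul_assoc, mul_smul_comm, ← smul_sub]
    exact Submodule.smul_mem _ _ hx

lemma quadraticSpan_commute_parity {a : Op Λ} (ha : a ∈ quadraticSpan Λ) :
    Commute parity a := by
  induction ha using Submodule.span_induction with
  | mem x hx =>
    obtain ⟨f, hf, g, hg, rfl⟩ := hx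
    rw [Commute, SemiconjBy, ← mul_assoc, parity_fieldSpan hf, neg_mul, mul_assoc,
      parity_fieldSpan hg, mul_neg, neg_neg, mul_assoc]
  | zero => exact Commute.zero_right _
  | add x y _ _ hx hy => exact hx.add_right hy
  | smul c x _ hx => exact hx.smul_right c

lemma exp_neg_mul_exp (a : Op Λ) : NormedSpace.exp (-a) * NormedSpace.exp a = 1 := by
  rw [← Matrix.exp_add_of_commute _ _ (Commute.refl a).neg_left, neg_add_cancel,
    NormedSpace.exp_zero]

/-- Gaussian states are mapped to Gaussian states by conjugation with the exponential of a
quadratic operator. -/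
lemma SatisfiesWick.exp_conj {ρ : Op Λ} (h : SatisfiesWick ρ) (htr : ρ.trace = 1) {a : Op Λ}
    (ha : a ∈ quadraticSpan Λ) :
    SatisfiesWick (NormedSpace.exp a * ρ * NormedSpace.exp (-a)) := by
  have ha' : -a ∈ quadraticSpan Λ := neg_mem ha
  have hVU := exp_neg_mul_exp a
  refine Intertwines.satisfiesWick (h.intertwines.conj hVU (fun b hb => ?_) fun b hb => ?_) ?_ ?_
  · exact exp_conj_mem_fieldSpan a (fun b hb => quadraticSpan_commutator_mem ha hb) hb
  · have := exp_conj_mem_fieldSpan (-a) (fun b hb => quadraticSpan_commutator_mem ha' hb) hb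
    rwa [neg_neg] at this
  · have h1 : Commute parity ρ := h.isEven
    exact ((quadraticSpan_commute_parity ha).exp_right.mul_right h1).mul_right
      (quadraticSpan_commute_parity ha').exp_right
  · rw [Matrix.trace_mul_comm, ← mul_assoc, hVU, one_mul, htr]

lemma pureState_mulVec (U : Op Λ) (ψ : Finset Λ → ℂ) :
    pureState (U *ᵥ ψ) = U * pureState ψ * Uᴴ := by
  rw [pureState, pureState, Matrix.star_mulVec, Matrix.mul_vecMulVec, Matrix.vecMulVec_mul]

lemma pureState_isDensity {ψ : Finset Λ → ℂ} (h : star ψ ⬝ᵥ ψ = 1) : IsDensity (pureState ψ) :=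
  ⟨Matrix.posSemidef_vecMulVec_self_star ψ, by
    rw [pureState, Matrix.trace_vecMulVec, dotProduct_comm, h]⟩

end Evolution

/-! ### The hopping Hamiltonian and the time-evolved state. -/

section Lattice

variable {Lx Ly : ℕ} [NeZero Lx] [NeZero Ly]

lemma ann_mem {Λ : Type} [Fintype Λ] [LinearOrder Λ] (i : Λ) : ann i ∈ fieldSpan Λ := by
  simpa [field, doublet] using field_mem (i, 1)

lemma conjTranspose_ann_mem {Λ : Type} [Fintype Λ] [LinearOrder Λ] (i : Λ) :
    (ann i)ᴴ ∈ fieldSpan Λ := by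
  simpa [field, doublet] using field_mem (i, 0)

lemma hamiltonian_mem : hamiltonian Lx Ly ∈ quadraticSpan (Site Lx Ly) := by
  have h : ∀ i j : Site Lx Ly, (ann i)ᴴ * ann j ∈ quadraticSpan (Site Lx Ly) := fun i j =>
    mul_mem_quadraticSpan (conjTranspose_ann_mem i) (ann_mem j)
  unfold hamiltonian
  apply Submodule.smul_mem
  refine Submodule.sum_mem _ fun x _ => ?_
  refine Submodule.sum_mem _ fun y _ => ?_
  apply Submodule.add_mem
  all_goals apply Submodule.add_mem
  all_goals exact h _ _

lemma hamiltonian_isHermitian : (hamiltonian Lx Ly)ᴴ = hamiltonian Lx Ly := by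
  rw [hamiltonian, Matrix.conjTranspose_smul, Matrix.conjTranspose_sum]
  refine congrArg₂ (· • ·) (by simp) (Finset.sum_congr rfl fun x _ => ?_)
  rw [Matrix.conjTranspose_sum]
  refine Finset.sum_congr rfl fun y _ => ?_
  simp only [Matrix.conjTranspose_add, Matrix.conjTranspose_mul, Matrix.conjTranspose_conjTranspose]
  exact congrArg₂ (· + ·) (add_comm _ _) (add_comm _ _)

lemma conjTranspose_exp_hamiltonian (t : ℝ) :
    (NormedSpace.exp (-(Complex.I * t) • hamiltonian Lx Ly))ᴴ =
      NormedSpace.exp (-(-(Complex.I * t) • hamiltonian Lx Ly)) := by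
  rw [← Matrix.exp_conjTranspose, Matrix.conjTranspose_smul, hamiltonian_isHermitian]
  simp

lemma pureState_evolve (t : ℝ) (ψ₀ : Finset (Site Lx Ly) → ℂ) :
    pureState (evolve t ψ₀) = NormedSpace.exp (-(Complex.I * t) • hamiltonian Lx Ly) *
      pureState ψ₀ * NormedSpace.exp (-(-(Complex.I * t) • hamiltonian Lx Ly)) := by
  rw [evolve, pureState_mulVec, conjTranspose_exp_hamiltonian]

lemma evolve_norm (t : ℝ) {ψ₀ : Finset (Site Lx Ly) → ℂ} (h : star ψ₀ ⬝ᵥ ψ₀ = 1) :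
    star (evolve t ψ₀) ⬝ᵥ evolve t ψ₀ = 1 := by
  rw [evolve, Matrix.star_mulVec, conjTranspose_exp_hamiltonian, Matrix.dotProduct_mulVec,
    Matrix.vecMul_vecMul, exp_neg_mul_exp, Matrix.vecMul_one, h]

lemma evolve_satisfiesWick (t : ℝ) {ψ₀ : Finset (Site Lx Ly) → ℂ} (h : star ψ₀ ⬝ᵥ ψ₀ = 1)
    (hW : SatisfiesWick (pureState ψ₀)) : SatisfiesWick (pureState (evolve t ψ₀)) := by
  rw [pureState_evolve]
  exact hW.exp_conj (pureState_isDensity h).2 (Submodule.smul_mem _ _ hamiltonian_mem)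

end Lattice

/-! ### Joint spectral projections of commuting idempotents. -/

section JointProjections

variable {R : Type*} [Ring R] {J : Type*} [Fintype J] [DecidableEq J]

/-- `P_S` are the joint spectral projections of the commuting idempotents `n_j`. -/
structure IsJointProj (n : J → R) (P : Finset J → R) : Prop where
  left : ∀ S i, n i * P S = if i ∈ S then P S else 0
  right : ∀ S i, P S * n i = if i ∈ S then P S else 0
  sum : ∑ S, P S = 1

lemma exists_isJointProj (n : J → R) (hidem : ∀ j, n j * n j = n j)
    (hcomm : ∀ i j, Commute (n i) (n j)) : ∃ P, IsJointProj n P := by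
  -- Each step multiplies by n_j or 1 - n_j. Before all idempotents are included, only the subsets
  -- of `s` enter the resolution of the identity.
  have key : ∀ s : Finset J, ∃ P : Finset J → R,
      (∀ S, ∀ i ∈ s, n i * P S = if i ∈ S then P S else 0) ∧
      (∀ S i, Commute (n i) (P S)) ∧ ∑ S ∈ s.powerset, P S = 1 := by
    intro s
    induction s using Finset.induction_on with
    | empty => exact ⟨fun _ => 1, by simp, fun _ _ => Commute.one_right _, by simp⟩
    | insert j s hj ih =>
      obtain ⟨P, h1, h2, h3⟩ := ih
      have hc : ∀ (S : Finset J) i, Commute (n i) (if j ∈ S then n j else 1 - n j) := by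
        intro S i
        split_ifs
        · exact hcomm _ _
        · exact (Commute.one_right _).sub_right (hcomm _ _)
      refine ⟨fun S => (if j ∈ S then n j else 1 - n j) * P (S.erase j), ?_,
        fun S i => (hc S i).mul_right (h2 _ _), ?_⟩
      · intro S i hi
        rcases eq_or_ne i j with rfl | hij
        · beta_reduce
          rw [← mul_assoc]
          split_ifs with h
          · rw [hidem]
          · rw [mul_sub, hidem, mul_one, sub_self, zero_mul]
        · rw [← mul_assoc, (hc S i).eq, mul_assoc,
            h1 _ i ((Finset.mem_insert.1 hi).resolve_left hij)]
          simp [hij]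
      · rw [Finset.sum_powerset_insert hj, ← Finset.sum_add_distrib]
        refine .trans ?_ h3
        refine Finset.sum_congr rfl fun S hS => ?_
        have hjS : j ∉ S := fun h => hj (Finset.mem_powerset.1 hS h)
        rw [if_neg hjS, if_pos (Finset.mem_insert_self _ _), Finset.erase_insert hjS,
          Finset.erase_eq_of_notMem hjS, ← add_mul, sub_add_cancel, one_mul]
  obtain ⟨P, h1, h2, h3⟩ := key Finset.univ
  exact ⟨P, fun S i => h1 S i (Finset.mem_univ i),
    fun S i => by rw [← (h2 S i).eq]; exact h1 S i (Finset.mem_univ i), by simpa using h3⟩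

namespace IsJointProj

variable {n : J → R} {P : Finset J → R} (h : IsJointProj n P)

include h in
-- A projection with S ≠ T kills X because the two disagree on some idempotent; the resolution of
-- the identity then leaves P_T X = X. Taking X to be P_T or its adjoint yields orthogonality and
-- self-adjointness.
lemma mul_of_left {T : Finset J} {X : R} (hX : ∀ i, n i * X = if i ∈ T then X else 0)
    (S : Finset J) : P S * X = if S = T then X else 0 := by
  have hne : ∀ S, S ≠ T → P S * X = 0 := by
    intro S hS
    obtain ⟨i, hi⟩ := not_forall.1 (fun h => hS (Finset.ext h))
    have h1 : P S * n i * X = P S * (n i * X) := mul_assoc _ _ _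
    rw [h.right, hX] at h1
    by_cases hiS : i ∈ S <;> by_cases hiT : i ∈ T <;> simp_all
  split_ifs with hS
  · subst hS
    calc P S * X = ∑ U, P U * X := by
          rw [Finset.sum_eq_single S (fun U _ hU => hne U hU) (by simp)]
      _ = X := by rw [← Finset.sum_mul, h.sum, one_mul]
  · exact hne S hS

include h in
lemma mul_proj (S T : Finset J) : P S * P T = if S = T then P T else 0 :=
  h.mul_of_left (h.left T) S

end IsJointProj

end JointProjections

/-! ### Fermionic modes and functions of their occupation numbers. -/

section Modes

variable {R : Type*} [Ring R] [Algebra ℂ R] {J : Type*} [Fintype J] [DecidableEq J]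

/-- The operator `∑_S f(S) P_S`. -/
def spectralSum (P : Finset J → R) (f : Finset J → ℂ) : R := ∑ S, f S • P S

variable {n : J → R} {P : Finset J → R}

lemma IsJointProj.spectralSum_mul (h : IsJointProj n P) (f g : Finset J → ℂ) :
    spectralSum P f * spectralSum P g = spectralSum P (f * g) := by
  simp only [spectralSum, Finset.sum_mul_sum, smul_mul_smul_comm, h.mul_proj]
  simp

lemma IsJointProj.aeval_spectralSum (h : IsJointProj n P) (f : Finset J → ℂ)
    (q : Polynomial ℂ) : Polynomial.aeval (spectralSum P f) q =
      spectralSum P (fun S => q.eval (f S)) := by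
  induction q using Polynomial.induction_on with
  | C a => simp [spectralSum, ← Finset.smul_sum, h.sum, Algebra.algebraMap_eq_smul_one]
  | add p q hp hq => simp [spectralSum, add_smul, Finset.sum_add_distrib] at hp hq ⊢; rw [hp, hq]
  | monomial k a ih =>
    rw [pow_succ, ← mul_assoc, map_mul, ih, Polynomial.aeval_X, h.spectralSum_mul]
    simp [spectralSum]

/-- An operator that shifts the occupation numbers from `g T` to `T`. -/
lemma IsJointProj.shift (h : IsJointProj n P) {x : R} (g : Finset J → Finset J)
    (hx : ∀ T S, P T * x * P S ≠ 0 → S = g T) (f : Finset J → ℂ) :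
    x * spectralSum P f = spectralSum P (f ∘ g) * x := by
  have h1 : ∀ T, P T * x * spectralSum P f = f (g T) • (P T * x) := by
    intro T
    have h2 : ∀ S, P T * x * f S • P S = f (g T) • (P T * x * P S) := by
      intro S
      rw [mul_smul_comm]
      by_cases h0 : P T * x * P S = 0
      · simp [h0]
      · rw [hx T S h0]
    rw [spectralSum, Finset.mul_sum, Finset.sum_congr rfl fun S _ => h2 S, ← Finset.smul_sum,
      ← Finset.mul_sum, h.sum, mul_one]
  calc x * spectralSum P f = ∑ T, P T * x * spectralSum P f := by
        rw [← Finset.sum_mul, ← Finset.sum_mul, h.sum, one_mul]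
    _ = _ := by rw [Finset.sum_congr rfl fun T _ => h1 T]; simp [spectralSum, Finset.sum_mul]

lemma IsJointProj.commute_spectralSum (h : IsJointProj n P) {x : R}
    (hx : ∀ i, Commute (n i) x) (f : Finset J → ℂ) : x * spectralSum P f = spectralSum P f * x := by
  refine h.shift id (fun T S h0 => ?_) f
  ext i
  have h1 : P T * n i * x * P S = P T * x * (n i * P S) := by
    rw [mul_assoc (P T), (hx i).eq]; simp only [mul_assoc]
  rw [h.right, h.left] at h1
  by_cases hiS : i ∈ S <;> by_cases hiT : i ∈ T <;> simp_all

/-- The canonical anticommutation relations for modes `b_j`, with `c_j` in the role of `b_j†`. -/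
structure IsCAR (b c : J → R) : Prop where
  bb : ∀ i j, b i * b j + b j * b i = 0
  cc : ∀ i j, c i * c j + c j * c i = 0
  bc : ∀ i j, b i * c j + c j * b i = if i = j then 1 else 0

namespace IsCAR

variable {b c : J → R} (h : IsCAR b c)

include h in
lemma b_sq (i : J) : b i * b i = 0 := by
  have := h.bb i i
  rw [← two_smul ℂ] at this
  exact (smul_eq_zero.1 this).resolve_left two_ne_zero

include h in
lemma number_mul_b (i : J) : c i * b i * b i = 0 := by rw [mul_assoc, h.b_sq, mul_zero]

include h in
lemma b_mul_number (i : J) : b i * (c i * b i) = b i := by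
  have h1 := eq_sub_of_add_eq (h.bc i i)
  rw [if_pos rfl] at h1
  rw [← mul_assoc, h1, sub_mul, h.number_mul_b, one_mul, sub_zero]

include h in
lemma number_idem (i : J) : c i * b i * (c i * b i) = c i * b i := by
  rw [mul_assoc, h.b_mul_number]

omit [Fintype J] [DecidableEq J] in
/-- An operator anticommuting with two others commutes with their product. -/
lemma _root_.FreeFermion.commute_of_anticomm {x y z : R} (hx : x * z + z * x = 0)
    (hy : y * z + z * y = 0) : Commute (x * y) z := by
  rw [Commute, SemiconjBy, mul_assoc, eq_neg_of_add_eq_zero_left hy, mul_neg, ← mul_assoc,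
    eq_neg_of_add_eq_zero_left hx, neg_mul, neg_neg, mul_assoc]

include h in
lemma number_commute_b {i j : J} (hij : i ≠ j) : Commute (c i * b i) (b j) :=
  commute_of_anticomm (by rw [add_comm, h.bc, if_neg hij.symm]) (h.bb i j)

include h in
lemma number_commute_c {i j : J} (hij : i ≠ j) : Commute (c i * b i) (c j) :=
  commute_of_anticomm (h.cc i j) (by rw [h.bc, if_neg hij])

include h in
lemma number_commute (i j : J) : Commute (c i * b i) (c j * b j) := by
  rcases eq_or_ne i j with rfl | hij
  · exact Commute.refl _
  · exact (h.number_commute_c hij).mul_right (h.number_commute_b hij)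

variable (hP : IsJointProj (fun i => c i * b i) P)

include h hP

lemma proj_mul_b {j : J} {T : Finset J} (hj : j ∈ T) : P T * b j = 0 := by
  have h1 := hP.right T j
  rw [if_pos hj] at h1
  rw [← h1, mul_assoc, h.number_mul_b, mul_zero]

lemma b_mul_proj {j : J} {S : Finset J} (hj : j ∉ S) : b j * P S = 0 := by
  rw [← h.b_mul_number, mul_assoc, hP.left, if_neg hj, mul_zero]

/-- The mode b_j empties j and leaves the other occupations alone, so P_T b_j P_S ≠ 0 forces S = T ∪
{j}. On sets T that contain j the value of the weight is irrelevant, since P_T b_j = 0. -/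
lemma b_mul_spectralSum (j : J) (f : Finset J → ℂ) :
    b j * spectralSum P f = spectralSum P (fun S => f (insert j S)) * b j := by
  refine hP.shift (insert j) (fun T S h0 => ?_) f
  have hjT : j ∉ T := fun hj => h0 (by rw [h.proj_mul_b hP hj, zero_mul])
  have hjS : j ∈ S := by
    by_contra hj
    exact h0 (by rw [mul_assoc, h.b_mul_proj hP hj, mul_zero])
  ext i
  rcases eq_or_ne i j with rfl | hij
  · simp [hjS]
  have h1 : P T * (c i * b i) * b j * P S = P T * b j * (c i * b i * P S) := by
    rw [mul_assoc (P T), (h.number_commute_b hij).eq]; simp only [mul_assoc]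
  rw [hP.right, hP.left] at h1
  by_cases hiS : i ∈ S <;> by_cases hiT : i ∈ T <;> simp_all

/-- The intertwining relation of a product state in the occupation numbers of the modes. -/
lemma spectralSum_intertwine (j : J) (f : Finset J → ℂ) {p q : ℂ}
    (hf : ∀ S, j ∉ S → p * f S = q * f (insert j S)) :
    p • (spectralSum P f * b j) = q • (b j * spectralSum P f) := by
  rw [h.b_mul_spectralSum hP]
  simp only [spectralSum, Finset.sum_mul, Finset.smul_sum, smul_mul_assoc, smul_smul]
  refine Finset.sum_congr rfl fun S _ => ?_
  by_cases hj : j ∈ S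
  · rw [h.proj_mul_b hP hj, smul_zero, smul_zero]
  · rw [hf S hj]

/-- All joint projections have the same value under a trace. -/
lemma trace_proj {M : Type*} [AddCommMonoid M] (τ : R →+ M) (hτ : ∀ x y, τ (x * y) = τ (y * x))
    (S : Finset J) : τ (P S) = τ (P ∅) := by
  induction S using Finset.induction_on with
  | empty => rfl
  | insert j T hj ih =>
    rw [← ih]
    -- With this exchange, cyclicity turns c b P_{T ∪ {j}} into P_T b c under the trace, and P_T b c
    -- = P_T because j is empty in T.
    have h1 : b j * P (insert j T) = P T * b j := by
      have := h.b_mul_spectralSum hP j (Pi.single (insert j T) 1)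
      rw [show spectralSum P (Pi.single (insert j T) 1) = P (insert j T) by
        simp [spectralSum, Pi.single_apply]] at this
      rw [this, spectralSum, Finset.sum_mul, Finset.sum_eq_single T]
      · simp
      · intro S _ hS
        by_cases hjS : j ∈ S
        · rw [smul_mul_assoc, h.proj_mul_b hP hjS, smul_zero]
        · rw [Pi.single_apply, if_neg, zero_smul, zero_mul]
          intro he
          apply hS
          rw [← Finset.erase_insert hjS, he, Finset.erase_insert hj]
      · simp
    have h2 := hP.left (insert j T) j
    rw [if_pos (Finset.mem_insert_self _ _)] at h2
    have h3 := hP.right T j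
    rw [if_neg hj] at h3
    have h4 := h.bc j j
    rw [if_pos rfl] at h4
    calc τ (P (insert j T)) = τ (c j * (P T * b j)) := by rw [← h2, mul_assoc, h1]
      _ = τ (P T * (b j * c j)) := by rw [hτ, mul_assoc]
      _ = τ (P T) := by rw [eq_sub_of_add_eq h4, mul_sub, h3, sub_zero, mul_one]

end IsCAR

end Modes

/-! ### Functional calculus and traces of powers. -/

section Calculus

open Polynomial

/-- The functional calculus of a Hermitian matrix through an interpolating polynomial. -/
lemma cfc_eq_aeval {m : Type*} [Fintype m] [DecidableEq m] {M : Matrix m m ℂ}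
    (hM : M.IsHermitian) (f : ℝ → ℝ) (q : ℝ[X]) (hq : ∀ x ∈ spectrum ℝ M, q.eval x = f x) :
    cfc f M = aeval M q := by
  rw [← cfc_polynomial q M hM]
  exact cfc_congr fun x hx => (hq x hx).symm

/-- Real polynomials with prescribed values on a finite set. -/
lemma exists_interpolant (s : Set ℝ) (hs : s.Finite) (f : ℝ → ℝ) :
    ∃ q : ℝ[X], ∀ x ∈ s, q.eval x = f x :=
  ⟨Lagrange.interpolate hs.toFinset id f, fun _ hx =>
    Lagrange.eval_interpolate_at_node f (Set.injOn_id _) (hs.mem_toFinset.2 hx)⟩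

end Calculus

section TraceCalculus

open Polynomial

variable {m : Type*} [Fintype m] [DecidableEq m]

lemma trace_cfc {M : Matrix m m ℂ} (hM : M.IsHermitian) (f : ℝ → ℝ) :
    (cfc f M).trace = ∑ i, (f (hM.eigenvalues i) : ℂ) := by
  rw [hM.cfc_eq, Matrix.IsHermitian.cfc, Unitary.conjStarAlgAut_apply, Matrix.trace_mul_comm,
    ← mul_assoc, Unitary.coe_star_mul_self, one_mul, Matrix.trace_diagonal]
  simp

/-- The trace of the functional calculus only depends on the traces of the powers. -/
lemma trace_cfc_eq_sum {ι : Type*} [Fintype ι] {κ : Type*} [Fintype κ] [DecidableEq κ]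
    {M : Matrix m m ℂ} (hM : M.IsHermitian) {N : ι → Matrix κ κ ℂ}
    (hN : ∀ i, (N i).IsHermitian) (h : ∀ k : ℕ, (M ^ k).trace = ∑ i, (N i ^ k).trace)
    (f : ℝ → ℝ) : (cfc f M).trace = ∑ i, (cfc f (N i)).trace := by
  -- A single polynomial serves all the spectra, so both sides become the same linear combination of
  -- power traces.
  obtain ⟨q, hq⟩ := exists_interpolant (spectrum ℝ M ∪ ⋃ i, spectrum ℝ (N i))
    (M.finite_real_spectrum.union (Set.finite_iUnion fun i => (N i).finite_real_spectrum)) f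
  have ht : ∀ A : Matrix κ κ ℂ, (aeval A q).trace =
      ∑ k ∈ Finset.range (q.natDegree + 1), q.coeff k • (A ^ k).trace := by
    intro A
    rw [aeval_eq_sum_range, Matrix.trace_sum]
    simp
  have ht' : (aeval M q).trace =
      ∑ k ∈ Finset.range (q.natDegree + 1), q.coeff k • (M ^ k).trace := by
    rw [aeval_eq_sum_range, Matrix.trace_sum]
    simp
  rw [cfc_eq_aeval hM f q fun x hx => hq x (Or.inl hx), ht']
  have h2 : ∀ i, (cfc f (N i)).trace = (aeval (N i) q).trace := fun i => by
    rw [cfc_eq_aeval (hN i) f q fun x hx => hq x (Or.inr (Set.mem_iUnion.2 ⟨i, hx⟩))]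
  simp only [h2, ht, h, Finset.smul_sum]
  rw [Finset.sum_comm]

lemma trace_cfc_congr {κ : Type*} [Fintype κ] [DecidableEq κ] {M : Matrix m m ℂ}
    (hM : M.IsHermitian) {N : Matrix κ κ ℂ} (hN : N.IsHermitian)
    (h : ∀ k : ℕ, (M ^ k).trace = (N ^ k).trace) (f : ℝ → ℝ) :
    (cfc f M).trace = (cfc f N).trace := by
  have := trace_cfc_eq_sum hM (N := fun _ : Unit => N) (fun _ => hN) (by simpa using h) f
  simpa using this

end TraceCalculus

/-! ### Particle-hole symmetry and the spectrum of the correlation matrix. -/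

section Correlations

variable {Λ : Type} [Fintype Λ] [LinearOrder Λ]

lemma expect_conjTranspose {ρ : Op Λ} (hρ : ρ.IsHermitian) (X : Op Λ) :
    expect ρ Xᴴ = star (expect ρ X) := by
  rw [expect, expect, ← Matrix.trace_conjTranspose, Matrix.conjTranspose_mul, hρ.eq,
    Matrix.trace_mul_comm]

lemma expect_conjTranspose_mul_self_nonneg {ρ : Op Λ} (hρ : ρ.PosSemidef) (X : Op Λ) :
    0 ≤ expect ρ (Xᴴ * X) := by
  rw [expect, ← mul_assoc, Matrix.trace_mul_comm, ← mul_assoc]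
  exact (hρ.mul_mul_conjTranspose_same X).trace_nonneg

lemma corr_isHermitian {κ : Type} [DecidableEq κ] {ρ : Op Λ} (hρ : ρ.IsHermitian) (B : κ → Op Λ) :
    (corr ρ B).IsHermitian := by
  ext u v
  have : (B u)ᴴ * B v = ((B v)ᴴ * B u)ᴴ := by simp
  simp only [corr, Matrix.conjTranspose_apply, Matrix.of_apply]
  rw [this, expect_conjTranspose hρ]
  by_cases h : u = v
  · simp [h]
  · simp [h, Ne.symm h]

/-- `1 + Γ` is a Gram matrix. -/
lemma one_add_corr_posSemidef {κ : Type} [Fintype κ] [DecidableEq κ] {ρ : Op Λ}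
    (hρ : ρ.PosSemidef) (B : κ → Op Λ) : (1 + corr ρ B).PosSemidef := by
  refine Matrix.PosSemidef.of_dotProduct_mulVec_nonneg
    (Matrix.isHermitian_one.add (corr_isHermitian hρ.1 B)) fun x => ?_
  have h1 : star x ⬝ᵥ (1 + corr ρ B) *ᵥ x =
      2 * expect ρ ((∑ u, x u • B u)ᴴ * ∑ u, x u • B u) := by
    rw [Matrix.conjTranspose_sum, Finset.sum_mul_sum, expect_sum, Finset.mul_sum]
    simp only [dotProduct, Matrix.mulVec, Pi.star_apply]
    refine Finset.sum_congr rfl fun u _ => ?_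
    rw [expect_sum, Finset.mul_sum, Finset.mul_sum]
    refine Finset.sum_congr rfl fun v _ => ?_
    simp only [Matrix.add_apply, Matrix.one_apply, corr, Matrix.of_apply, Matrix.conjTranspose_smul,
      smul_mul_smul_comm, expect_smul]
    ring
  rw [h1]
  exact mul_nonneg zero_le_two (expect_conjTranspose_mul_self_nonneg hρ _)

lemma neg_one_le_of_eigen {κ : Type} [Fintype κ] [DecidableEq κ] {M : Matrix κ κ ℂ}
    (hM : (1 + M).PosSemidef) {a : ℝ} {v : κ → ℂ} (hv : v ≠ 0)
    (h : M *ᵥ v = (a : ℂ) • v) : -1 ≤ a := by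
  have h1 := hM.dotProduct_mulVec_nonneg v
  rw [Matrix.add_mulVec, Matrix.one_mulVec, h, dotProduct_add, dotProduct_smul, smul_eq_mul] at h1
  have h2 : 0 < star v ⬝ᵥ v := Matrix.dotProduct_star_self_pos_iff.2 hv
  have h3 : star v ⬝ᵥ v = ((star v ⬝ᵥ v).re : ℂ) :=
    Complex.ext rfl (by simpa using (Complex.lt_def.1 h2).2.symm)
  have h4 : 0 < (star v ⬝ᵥ v).re := by simpa using (Complex.lt_def.1 h2).1
  rw [h3] at h1
  have h5 : 0 ≤ (star v ⬝ᵥ v).re + a * (star v ⬝ᵥ v).re := by exact_mod_cast h1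
  nlinarith

lemma orthogonal_of_eigen {κ : Type} [Fintype κ] [DecidableEq κ] {M : Matrix κ κ ℂ}
    (hM : M.IsHermitian) {a b : ℝ} {v w : κ → ℂ} (hv : M *ᵥ v = (a : ℂ) • v)
    (hw : M *ᵥ w = (b : ℂ) • w) (hab : a ≠ b) : star v ⬝ᵥ w = 0 := by
  have h1 : star v ⬝ᵥ (M *ᵥ w) = star (M *ᵥ v) ⬝ᵥ w := by
    rw [Matrix.star_mulVec, hM.eq, Matrix.dotProduct_mulVec]
  rw [hv, hw, dotProduct_smul, star_smul, smul_dotProduct, smul_eq_mul, smul_eq_mul] at h1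
  simp only [Complex.star_def, Complex.conj_ofReal] at h1
  have h2 : ((a : ℂ) - b) * (star v ⬝ᵥ w) = 0 := by rw [sub_mul, h1, sub_self]
  exact (mul_eq_zero.1 h2).resolve_left (sub_ne_zero.2 (by exact_mod_cast hab))

/-- The charge conjugation of coefficient vectors: `(lin v)† = lin (conjugate v)`. -/
def conjugate (v : Λ × Fin 2 → ℂ) : Λ × Fin 2 → ℂ := fun u => star (v (dual u))

@[simp] lemma conjugate_conjugate (v : Λ × Fin 2 → ℂ) : conjugate (conjugate v) = v := by
  ext u; simp [conjugate]

/-- The exchange of creation and annihilation operators as a permutation. -/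
def dualEquiv : Λ × Fin 2 ≃ Λ × Fin 2 := ⟨dual, dual, dual_dual, dual_dual⟩

lemma conjTranspose_lin (v : Λ × Fin 2 → ℂ) : (lin v)ᴴ = lin (conjugate v) := by
  rw [lin_apply, lin_apply, Matrix.conjTranspose_sum, ← dualEquiv.sum_comp]
  simp [conjugate, dualEquiv, Matrix.conjTranspose_smul, conjTranspose_field]

/-- Written as a Hermitian pairing, the anticommutator turns orthogonality of eigenvectors into
anticommutation of modes. -/
lemma lin_anticomm' (v w : Λ × Fin 2 → ℂ) :
    lin v * lin w + lin w * lin v = (star (conjugate v) ⬝ᵥ w) • (1 : Op Λ) := by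
  rw [lin_anticomm]
  congr 1
  rw [dotProduct, ← dualEquiv.sum_comp]
  simp [conjugate, dualEquiv]

/-- Particle-hole symmetry: reversing the order of two fields changes the sign of the correlator up
to the constant anticommutator, which the subtracted delta absorbs. -/
lemma corr_field_dual {ρ : Op Λ} (hρ : ρ.trace = 1) (u w : Λ × Fin 2) :
    corr ρ field (dual u) (dual w) = - corr ρ field w u := by
  have h := field_anticomm u (dual w)
  have h1 : expect ρ (field u * field (dual w)) = (if u = w then 1 else 0) -
      expect ρ (field (dual w) * field u) := by
    rw [eq_sub_iff_add_eq, ← expect_add, h]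
    have : dual w = dual u ↔ u = w := (dualEquiv.injective.eq_iff' rfl).trans eq_comm
    simp only [this]
    split_ifs <;> simp [expect, hρ]
  have h2 : (dual u = dual w) = (u = w) := propext (dualEquiv.injective.eq_iff' rfl)
  simp only [corr, Matrix.of_apply, conjTranspose_field, dual_dual, h1, h2, eq_comm (a := w)]
  ring

/-- The map to intertwining partners is thus (1 - Γ)/2, so eigenvectors of Γ diagonalize the
intertwining relation. -/
lemma partner_eq {ρ : Op Λ} (hρ : ρ.trace = 1) (u x : Λ × Fin 2) :
    partner ρ u x = (1 / 2) * ((if u = x then 1 else 0) - corr ρ field x u) := by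
  have h := corr_field_dual hρ u x
  have h2 : (dual u = dual x) = (u = x) := propext (dualEquiv.injective.eq_iff' rfl)
  have h3 : corr ρ field x u = -(2 * partner ρ u x - if u = x then 1 else 0) := by
    rw [← neg_eq_iff_eq_neg, ← h]
    simp [corr, partner, conjTranspose_field, h2]
  rw [h3]
  ring

/-- Particle-hole symmetry combined with Hermiticity makes the antilinear charge conjugation
anticommute with Γ. -/
lemma corr_mulVec_conjugate {ρ : Op Λ} (hH : ρ.IsHermitian) (hρ : ρ.trace = 1) {a : ℝ}
    {v : Λ × Fin 2 → ℂ} (h : corr ρ field *ᵥ v = (a : ℂ) • v) :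
    corr ρ field *ᵥ conjugate v = ((-a : ℝ) : ℂ) • conjugate v := by
  ext u
  have h1 := congrArg star (congrFun h (dual u))
  simp only [Matrix.mulVec, dotProduct, Pi.smul_apply, smul_eq_mul, star_sum, star_mul'] at h1 ⊢
  have h2 : star (v (dual u)) = conjugate v u := rfl
  rw [h2] at h1
  rw [Complex.ofReal_neg, neg_mul]
  simp only [Complex.star_def, Complex.conj_ofReal] at h1
  rw [← h1, ← dualEquiv.sum_comp, ← Finset.sum_neg_distrib]
  refine Finset.sum_congr rfl fun w _ => ?_
  have h3 := corr_field_dual hρ (dual u) w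
  rw [dual_dual] at h3
  have h4 := congrFun (congrFun (corr_isHermitian hH field) w) (dual u)
  rw [Matrix.conjTranspose_apply] at h4
  rw [← Complex.star_def, h4]
  change corr ρ field u (dual w) * star (v (dual (dual w))) = _
  rw [h3, dual_dual, Complex.star_def, neg_mul]

lemma conjugate_ne_zero {v : Λ × Fin 2 → ℂ} (hv : v ≠ 0) : conjugate v ≠ 0 := by
  intro h
  apply hv
  rw [← conjugate_conjugate v, h]
  ext u; simp [conjugate]

/-- Positivity of the Gram matrix 1 + Γ gives the lower bound; the upper bound is the lower one for
the conjugate vector, whose eigenvalue is -a. -/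
lemma corr_field_eigen_le {ρ : Op Λ} (hρ : IsDensity ρ) {a : ℝ} {v : Λ × Fin 2 → ℂ} (hv : v ≠ 0)
    (h : corr ρ field *ᵥ v = (a : ℂ) • v) : -1 ≤ a ∧ a ≤ 1 := by
  have h1 := one_add_corr_posSemidef hρ.1 field
  refine ⟨neg_one_le_of_eigen h1 hv h, ?_⟩
  have := neg_one_le_of_eigen h1 (conjugate_ne_zero hv) (corr_mulVec_conjugate hρ.1.1 hρ.2 h)
  linarith

/-- -Γ is a permuted transpose of Γ. This yields the symmetry of the spectrum with multiplicities,
without matching individual eigenvectors. -/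
lemma corr_field_trace_neg_pow {ρ : Op Λ} (hρ : ρ.trace = 1) (k : ℕ) :
    ((-corr ρ field) ^ k).trace = (corr ρ field ^ k).trace := by
  have h : -corr ρ field = ((corr ρ field).submatrix dualEquiv dualEquiv)ᵀ := by
    ext u w
    simp [dualEquiv, corr_field_dual hρ]
  have h2 : ∀ k : ℕ, ((corr ρ field).submatrix dualEquiv dualEquiv) ^ k =
      (corr ρ field ^ k).submatrix dualEquiv dualEquiv := by
    intro k
    have := map_pow (Matrix.reindexAlgEquiv ℂ ℂ (dualEquiv (Λ := Λ)).symm) (corr ρ field) k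
    simpa [Matrix.coe_reindexAlgEquiv, Matrix.reindex_apply] using this.symm
  rw [h, ← Matrix.transpose_pow, Matrix.trace_transpose, h2]
  exact (dualEquiv (Λ := Λ)).sum_comp (fun i => (corr ρ field ^ k) i i)

/-- The eigenvalues of the correlation matrix come in pairs of opposite sign. -/
lemma sum_eigenvalues_even {ρ : Op Λ} (hρ : ρ.trace = 1) (hΓ : (corr ρ field).IsHermitian)
    (g : ℝ → ℝ) (hg : ∀ x, g (-x) = g x) :
    ∑ i, g (hΓ.eigenvalues i) =
      2 * ∑ j : {i // 0 < hΓ.eigenvalues i}, (g (hΓ.eigenvalues j) - g 0) +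
        2 * Fintype.card Λ * g 0 := by
  -- This cutoff satisfies g(x) = f(x) + f(-x) + g(0), and the symmetry of the spectrum identifies
  -- the sums of the first two terms.
  set f : ℝ → ℝ := fun x => if 0 < x then g x - g 0 else 0 with hf
  have hsymm : ∑ i, f (-hΓ.eigenvalues i) = ∑ i, f (hΓ.eigenvalues i) := by
    have h1 := trace_cfc_congr hΓ.neg hΓ (corr_field_trace_neg_pow hρ) f
    rw [← cfc_comp_neg f (corr ρ field)
      (hf := (Matrix.finite_real_spectrum.image _).continuousOn _) (ha := hΓ.isSelfAdjoint),
      trace_cfc hΓ, trace_cfc hΓ] at h1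
    exact_mod_cast h1
  have hsum : ∀ x, g x = f x + f (-x) + g 0 := by
    intro x
    simp only [hf]
    rcases lt_trichotomy x 0 with h | rfl | h
    · simp [h, h.not_gt, hg]
    · simp
    · simp [h, h.not_gt]
  have hJ : ∑ i, f (hΓ.eigenvalues i) =
      ∑ j : {i // 0 < hΓ.eigenvalues i}, (g (hΓ.eigenvalues j) - g 0) := by
    simp only [hf]
    rw [← Finset.sum_filter, Finset.sum_subtype (p := fun i => 0 < hΓ.eigenvalues i) _ (by simp)]
  rw [Finset.sum_congr rfl fun i _ => hsum _, Finset.sum_add_distrib, Finset.sum_add_distrib,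
    hsymm, hJ]
  simp
  ring

end Correlations

/-! ### Normal form and entropy of a Gaussian state. -/

section Spectrum

variable {Λ : Type} [Fintype Λ] [LinearOrder Λ]

/-- The joint projections of self-adjoint idempotents are self-adjoint. -/
lemma IsJointProj.conjTranspose {J : Type*} [Fintype J] [DecidableEq J] {n : J → Op Λ}
    {P : Finset J → Op Λ} (h : IsJointProj n P) (hn : ∀ j, (n j)ᴴ = n j) (S : Finset J) :
    (P S)ᴴ = P S := by
  have hl : ∀ T i, n i * (P T)ᴴ = if i ∈ T then (P T)ᴴ else 0 := by
    intro T i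
    rw [← hn i, ← Matrix.conjTranspose_mul, h.right]
    split_ifs <;> simp
  have h1 : ∀ T, P S * (P T)ᴴ = if S = T then (P T)ᴴ else 0 := fun T => h.mul_of_left (hl T) S
  have h2 : ∑ T, (P T)ᴴ = 1 := by rw [← Matrix.conjTranspose_sum, h.sum, Matrix.conjTranspose_one]
  have h3 : P S = ∑ T, P S * (P T)ᴴ := by rw [← Finset.mul_sum, h2, mul_one]
  rw [Finset.sum_congr rfl fun T _ => h1 T] at h3
  simpa using h3.symm

/-- The occupation probability of the set `S` of modes. -/
def occupation {J : Type*} [Fintype J] [DecidableEq J] (a : J → ℝ) (S : Finset J) : ℝ :=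
  ∏ j, S.piecewise (fun j => (1 + a j) / 2) (fun j => (1 - a j) / 2) j

/-- Only the factor at j changes, from (1 - a_j)/2 to (1 + a_j)/2. This is the ratio of weights that
the intertwining relation of the mode demands. -/
lemma occupation_insert {J : Type*} [Fintype J] [DecidableEq J] (a : J → ℝ) {S : Finset J} {j : J}
    (hj : j ∉ S) :
    (1 + a j) * occupation a S = (1 - a j) * occupation a (insert j S) := by
  have h : ∀ T : Finset J, occupation a T =
      T.piecewise (fun j => (1 + a j) / 2) (fun j => (1 - a j) / 2) j *
      ∏ i ∈ Finset.univ.erase j, T.piecewise (fun j => (1 + a j) / 2) (fun j => (1 - a j) / 2) i :=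
    fun T => (Finset.mul_prod_erase _ _ (Finset.mem_univ j)).symm
  have h2 : ∏ i ∈ Finset.univ.erase j,
      (insert j S).piecewise (fun j => (1 + a j) / 2) (fun j => (1 - a j) / 2) i =
      ∏ i ∈ Finset.univ.erase j, S.piecewise (fun j => (1 + a j) / 2) (fun j => (1 - a j) / 2) i := by
    refine Finset.prod_congr rfl fun i hi => ?_
    rw [Finset.piecewise_insert_of_ne _ _ _ (Finset.ne_of_mem_erase hi)]
  rw [h S, h (insert j S), h2, Finset.piecewise_insert_self, Finset.piecewise_eq_of_notMem _ _ _ hj]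
  ring

lemma sum_prod_piecewise {J : Type*} [Fintype J] [DecidableEq J] (f g : J → ℝ) :
    ∑ S : Finset J, ∏ j, S.piecewise f g j = ∏ j, (f j + g j) := by
  rw [Finset.prod_add]
  simp [Finset.prod_piecewise]

lemma sum_occupation {J : Type*} [Fintype J] [DecidableEq J] (a : J → ℝ) :
    ∑ S, occupation a S = 1 := by
  unfold occupation
  rw [sum_prod_piecewise]
  refine Finset.prod_eq_one fun j _ => ?_
  ring

lemma occupation_nonneg {J : Type*} [Fintype J] [DecidableEq J] {a : J → ℝ}
    (ha : ∀ j, -1 ≤ a j ∧ a j ≤ 1) (S : Finset J) : 0 ≤ occupation a S := by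
  refine Finset.prod_nonneg fun j _ => ?_
  have := ha j
  by_cases hj : j ∈ S
  · rw [Finset.piecewise_eq_of_mem _ _ _ hj]; linarith
  · rw [Finset.piecewise_eq_of_notMem _ _ _ hj]; linarith

/-- The eigenvectors of the correlation matrix. -/
def eigvec {ρ : Op Λ} (hΓ : (corr ρ field).IsHermitian) (i : Λ × Fin 2) : Λ × Fin 2 → ℂ :=
  hΓ.eigenvectorBasis i

section Eigvec

variable {ρ : Op Λ} (hΓ : (corr ρ field).IsHermitian)

lemma corr_mulVec_eigvec (i : Λ × Fin 2) :
    corr ρ field *ᵥ eigvec hΓ i = (hΓ.eigenvalues i : ℂ) • eigvec hΓ i := by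
  have := hΓ.mulVec_eigenvectorBasis i
  rw [eigvec, this]
  ext u; simp

lemma eigvec_orthonormal (i j : Λ × Fin 2) :
    star (eigvec hΓ i) ⬝ᵥ eigvec hΓ j = if i = j then 1 else 0 := by
  have h := orthonormal_iff_ite.1 hΓ.eigenvectorBasis.orthonormal i j
  rw [← h, EuclideanSpace.inner_eq_star_dotProduct, dotProduct_comm]
  rfl

lemma eigvec_ne_zero (i : Λ × Fin 2) : eigvec hΓ i ≠ 0 := by
  intro h
  have := eigvec_orthonormal hΓ i i
  simp [h] at this

lemma sum_eigvec (v : Λ × Fin 2 → ℂ) : v = ∑ i, (star (eigvec hΓ i) ⬝ᵥ v) • eigvec hΓ i := by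
  have h := hΓ.eigenvectorBasis.sum_repr' (WithLp.toLp 2 v)
  have h2 := congrArg WithLp.ofLp h
  rw [WithLp.ofLp_sum] at h2
  refine h2.symm.trans (Finset.sum_congr rfl fun i _ => ?_)
  rw [WithLp.ofLp_smul, EuclideanSpace.inner_eq_star_dotProduct, dotProduct_comm]
  rfl

/-- The conjugate of an eigenvector with a > 0 has a negative eigenvalue and is orthogonal to all
the modes retained. Strict positivity matters: conjugation maps the kernel to itself, where this
argument fails. -/
lemma lin_modes (hρ : IsDensity ρ) :
    IsCAR (fun j : {i // 0 < hΓ.eigenvalues i} => lin (eigvec hΓ j))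
      (fun j => lin (conjugate (eigvec hΓ j))) := by
  have hbb : ∀ i j : {i // 0 < hΓ.eigenvalues i},
      lin (eigvec hΓ i) * lin (eigvec hΓ j) + lin (eigvec hΓ j) * lin (eigvec hΓ i) = 0 := by
    intro i j
    rw [lin_anticomm', orthogonal_of_eigen hΓ
      (corr_mulVec_conjugate hρ.1.1 hρ.2 (corr_mulVec_eigvec hΓ i)) (corr_mulVec_eigvec hΓ j),
      zero_smul]
    have := i.2; have := j.2; linarith
  refine ⟨hbb, fun i j => ?_, fun i j => ?_⟩
  · have := congrArg Matrix.conjTranspose (hbb j i)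
    simpa [conjTranspose_lin] using this
  · rw [add_comm, lin_anticomm', conjugate_conjugate, eigvec_orthonormal]
    simp only [Subtype.coe_inj, eq_comm (a := j)]
    split_ifs <;> simp

/-- A Gaussian state is determined by its intertwining relations with the eigenmodes of its
correlation matrix. -/
lemma SatisfiesWick.eq_of_eigvec_intertwine (hρ : IsDensity ρ) (hW : SatisfiesWick ρ) {σ : Op Λ}
    (hσ : IsEven σ) (htr : σ.trace = 1)
    (h : ∀ i, (1 + hΓ.eigenvalues i : ℂ) • (σ * lin (eigvec hΓ i)) =
      (1 - hΓ.eigenvalues i : ℂ) • (lin (eigvec hΓ i) * σ)) : ρ = σ := by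
  -- `G` extends the partner map linearly. On an eigenvector it is multiplication by (1 - a)/2, so
  -- the hypothesis reads σ b = σ (G b) + (G b) σ, and linearity carries this to every field.
  set G : (Λ × Fin 2 → ℂ) →ₗ[ℂ] (Λ × Fin 2 → ℂ) :=
    (1 / 2 : ℂ) • (LinearMap.id - (corr ρ field).mulVecLin) with hG
  have hGe : ∀ i, G (eigvec hΓ i) = ((1 - hΓ.eigenvalues i) / 2 : ℂ) • eigvec hΓ i := by
    intro i
    simp only [hG, LinearMap.smul_apply, LinearMap.sub_apply, LinearMap.id_apply,
      Matrix.mulVecLin_apply, corr_mulVec_eigvec]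
    rw [smul_sub, smul_smul, ← sub_smul]
    congr 1
    ring
  have hGs : ∀ u, G (Pi.single u 1) = partner ρ u := by
    intro u
    ext x
    simp only [hG, LinearMap.smul_apply, LinearMap.sub_apply, LinearMap.id_apply,
      Matrix.mulVecLin_apply, Matrix.mulVec_single_one, partner_eq hρ.2, Pi.smul_apply,
      Pi.sub_apply, Pi.single_apply, Matrix.col_apply, smul_eq_mul, eq_comm (a := u)]
  have hall : ∀ v, σ * lin v = σ * lin (G v) + lin (G v) * σ := by
    intro v
    rw [sum_eigvec hΓ v]
    simp only [map_sum, map_smul, Finset.mul_sum, Finset.sum_mul, ← Finset.sum_add_distrib]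
    refine Finset.sum_congr rfl fun i _ => ?_
    rw [hGe, map_smul, smul_smul, mul_smul_comm, mul_smul_comm, smul_mul_assoc, mul_smul, mul_smul,
      ← smul_add]
    congr 1
    have h1 : ((1 - hΓ.eigenvalues i) / 2 : ℂ) • (lin (eigvec hΓ i) * σ) =
        ((1 + hΓ.eigenvalues i) / 2 : ℂ) • (σ * lin (eigvec hΓ i)) := by
      rw [div_eq_inv_mul, mul_smul, ← h i, ← mul_smul, ← div_eq_inv_mul]
    rw [h1, ← add_smul, ← add_div]
    rw [show (1 - (hΓ.eigenvalues i : ℂ) + (1 + hΓ.eigenvalues i)) / 2 = 1 by ring, one_smul]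
  have hI : Intertwines σ := by
    intro b hb
    obtain ⟨v, rfl⟩ := mem_fieldSpan_iff.1 hb
    exact ⟨_, lin_mem _, hall v⟩
  -- The common relation also gives common two-point functions: each is the scalar anticommutator of
  -- the partner with the second field.
  refine hW.eq_of_expect_eq (hI.satisfiesWick hσ htr) (hρ.2.trans htr.symm) fun u x => ?_
  have h1 := hall (Pi.single u 1)
  rw [lin_single, hGs] at h1
  have h2 : expect σ (field u * field x) =
      expect σ (lin (partner ρ u) * lin (Pi.single x 1) +
        lin (Pi.single x 1) * lin (partner ρ u)) := by
    rw [lin_single, expect_add]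
    unfold expect
    rw [← mul_assoc, h1, add_mul, Matrix.trace_add, mul_assoc, mul_assoc (lin _),
      Matrix.trace_mul_comm (lin _), mul_assoc]
  rw [h2, lin_anticomm, expect_smul, Finset.sum_eq_single (dual x)]
  · simp [partner, expect, htr]
  · intro y _ hy
    have : dual y ≠ x := fun h => hy (by rw [← h, dual_dual])
    simp [this]
  · simp

/-- The eigenvalues of the correlation matrix of a state lie in `[-1, 1]`. -/
lemma eigenvalues_mem (hρ : IsDensity ρ) (i : Λ × Fin 2) :
    -1 ≤ hΓ.eigenvalues i ∧ hΓ.eigenvalues i ≤ 1 :=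
  corr_field_eigen_le hρ (eigvec_ne_zero hΓ i) (corr_mulVec_eigvec hΓ i)

/-- The modes with a positive eigenvalue of the correlation matrix. -/
abbrev PosMode : Type := {i // 0 < hΓ.eigenvalues i}

/-- The inverse of the dimension of the joint eigenspaces of the occupation numbers. -/
def mixing : ℝ := 2 ^ Fintype.card (PosMode hΓ) / 2 ^ Fintype.card Λ

lemma mixing_pos : 0 < mixing hΓ := by unfold mixing; positivity

/-- The probabilities of the occupation numbers. -/
def modeProb (S : Finset (PosMode hΓ)) : ℝ :=
  occupation (fun j : PosMode hΓ => hΓ.eigenvalues j) S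

/-- The normal form of a Gaussian state. The modes with a vanishing eigenvalue of the correlation
matrix are maximally mixed. -/
theorem gaussian_normal_form (hρ : IsDensity ρ) (hW : SatisfiesWick ρ) :
    ∃ (n : PosMode hΓ → Op Λ) (P : Finset (PosMode hΓ) → Op Λ), IsJointProj n P ∧
      (∀ S, (P S).trace = (((mixing hΓ)⁻¹ : ℝ) : ℂ)) ∧
      ρ = spectralSum P fun S => ((mixing hΓ * modeProb hΓ S : ℝ) : ℂ) := by
  have hCAR := lin_modes hΓ hρ
  obtain ⟨P, hP⟩ := exists_isJointProj _ hCAR.number_idem hCAR.number_commute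
  have htrP : ∀ S, (P S).trace = (((mixing hΓ)⁻¹ : ℝ) : ℂ) := by
    have h1 : ∀ S, (P S).trace = (P ∅).trace := fun S =>
      hCAR.trace_proj hP (Matrix.traceAddMonoidHom (Finset Λ) ℂ) Matrix.trace_mul_comm S
    -- The 2^{#modes} equal traces add up to the dimension of Fock space, which fixes their common
    -- value.
    have h2 : ∑ S, (P S).trace = 2 ^ Fintype.card Λ := by
      rw [← Matrix.trace_sum, hP.sum, Matrix.trace_one, Fintype.card_finset]; simp
    rw [Finset.sum_congr rfl fun S _ => h1 S, Finset.sum_const, Finset.card_univ,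
      Fintype.card_finset, nsmul_eq_mul] at h2
    intro S
    rw [h1, mixing, inv_div, Complex.ofReal_div, eq_div_iff (by simp)]
    push_cast at h2 ⊢
    rw [mul_comm, h2]
  refine ⟨_, P, hP, htrP, ?_⟩
  have hKne := (mixing_pos hΓ).ne'
  generalize mixing hΓ = K at *
  set w : Finset (PosMode hΓ) → ℂ := fun S => ((K * modeProb hΓ S : ℝ) : ℂ) with hw
  have hherm : (spectralSum P w)ᴴ = spectralSum P w := by
    have := hP.conjTranspose (fun j => by
      rw [Matrix.conjTranspose_mul, conjTranspose_lin, conjTranspose_lin, conjugate_conjugate])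
    simp [spectralSum, Matrix.conjTranspose_sum, Matrix.conjTranspose_smul, this, hw]
  have hpos : ∀ j : PosMode hΓ,
      (1 + hΓ.eigenvalues j : ℂ) • (spectralSum P w * lin (eigvec hΓ j)) =
      (1 - hΓ.eigenvalues j : ℂ) • (lin (eigvec hΓ j) * spectralSum P w) := by
    intro j
    refine hCAR.spectralSum_intertwine hP j w fun S hS => ?_
    have := occupation_insert (fun j : PosMode hΓ => hΓ.eigenvalues j) hS
    simp only [hw, modeProb]
    norm_cast
    linear_combination K * this
  refine hW.eq_of_eigvec_intertwine hΓ hρ ?_ ?_ fun i => ?_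
  · refine hP.commute_spectralSum (fun j => ?_) w
    exact (quadraticSpan_commute_parity (mul_mem_quadraticSpan (lin_mem _) (lin_mem _))).symm
  · rw [spectralSum, Matrix.trace_sum]
    simp only [Matrix.trace_smul, htrP, hw, smul_eq_mul, ← Complex.ofReal_mul,
      ← Complex.ofReal_sum]
    rw [Complex.ofReal_eq_one, ← sum_occupation (fun j : PosMode hΓ => hΓ.eigenvalues j)]
    refine Finset.sum_congr rfl fun S _ => ?_
    rw [mul_right_comm, mul_inv_cancel₀ hKne, one_mul, modeProb]
  · rcases lt_trichotomy (hΓ.eigenvalues i) 0 with hi | hi | hi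
    · -- the adjoint of the relation for the conjugate vector
      set x := conjugate (eigvec hΓ i) with hx
      have hxe := corr_mulVec_conjugate hρ.1.1 hρ.2 (corr_mulVec_eigvec hΓ i)
      have hrel : (1 - hΓ.eigenvalues i : ℂ) • (spectralSum P w * lin x) =
          (1 + hΓ.eigenvalues i : ℂ) • (lin x * spectralSum P w) := by
        -- The conjugate vector need not belong to the eigenbasis. Its expansion involves only
        -- eigenvectors of the positive eigenvalue -a, for which the relation is already known.
        rw [sum_eigvec hΓ x]
        simp only [map_sum, map_smul, Finset.mul_sum, Finset.sum_mul, Finset.smul_sum]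
        refine Finset.sum_congr rfl fun l _ => ?_
        rw [mul_smul_comm, smul_mul_assoc, smul_comm, smul_comm (1 + _ : ℂ)]
        by_cases hl : hΓ.eigenvalues l = -hΓ.eigenvalues i
        · congr 1
          have := hpos ⟨l, by rw [hl]; linarith⟩
          simp only [hl] at this
          push_cast at this
          rw [← sub_eq_add_neg, sub_neg_eq_add] at this
          exact this
        · rw [orthogonal_of_eigen hΓ (corr_mulVec_eigvec hΓ l) hxe hl, zero_smul, zero_smul]
      have hadj := congrArg Matrix.conjTranspose hrel
      simp only [Matrix.conjTranspose_smul, Matrix.conjTranspose_mul, hherm, conjTranspose_lin, hx,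
        conjugate_conjugate] at hadj
      simpa using hadj.symm
    -- For a = 0 the relation says that the field commutes with the candidate state. A null vector
    -- anticommutes with every b_j and its adjoint, hence commutes with the number operators.
    · have hb0 : ∀ j : PosMode hΓ, lin (eigvec hΓ j) * lin (eigvec hΓ i) +
          lin (eigvec hΓ i) * lin (eigvec hΓ j) = 0 := by
        intro j
        rw [lin_anticomm', orthogonal_of_eigen hΓ
          (corr_mulVec_conjugate hρ.1.1 hρ.2 (corr_mulVec_eigvec hΓ j)) (corr_mulVec_eigvec hΓ i),
          zero_smul]
        have := j.2
        rw [hi]; linarith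
      have hc0 : ∀ j : PosMode hΓ, lin (conjugate (eigvec hΓ j)) * lin (eigvec hΓ i) +
          lin (eigvec hΓ i) * lin (conjugate (eigvec hΓ j)) = 0 := by
        intro j
        rw [lin_anticomm', conjugate_conjugate, eigvec_orthonormal, if_neg, zero_smul]
        rintro rfl
        exact j.2.ne' hi
      have := hP.commute_spectralSum (x := lin (eigvec hΓ i))
        (fun j => commute_of_anticomm (hc0 j) (hb0 j)) w
      simp [hi, this]
    · exact hpos ⟨i, hi⟩

/-- Traces of functions of a Gaussian state. -/
theorem trace_cfc_gaussian (hρ : IsDensity ρ) (hW : SatisfiesWick ρ) (f : ℝ → ℝ) :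
    (cfc f ρ).trace =
      ((∑ S, (mixing hΓ)⁻¹ * f (mixing hΓ * modeProb hΓ S) : ℝ) : ℂ) := by
  obtain ⟨n, P, hP, htr, hform⟩ := gaussian_normal_form hΓ hρ hW
  -- Interpolating also at the weights makes it unnecessary to identify them with the spectrum of ρ.
  obtain ⟨q, hq⟩ := exists_interpolant
    (spectrum ℝ ρ ∪ Set.range fun S => mixing hΓ * modeProb hΓ S)
    (ρ.finite_real_spectrum.union (Set.finite_range _)) f
  have h1 : (Polynomial.aeval ρ q).trace =
      ∑ S, ((q.eval (mixing hΓ * modeProb hΓ S) : ℝ) : ℂ) * (((mixing hΓ)⁻¹ : ℝ) : ℂ) := by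
    have h2 := congrArg (fun M => (Polynomial.aeval M (q.map (algebraMap ℝ ℂ))).trace) hform
    beta_reduce at h2
    rw [← Polynomial.aeval_map_algebraMap ℂ, h2, hP.aeval_spectralSum, spectralSum,
      Matrix.trace_sum]
    refine Finset.sum_congr rfl fun S _ => ?_
    rw [Matrix.trace_smul, htr, smul_eq_mul]
    rw [Polynomial.eval_map]
    exact congrArg (· * _) (Polynomial.eval₂_at_apply (algebraMap ℝ ℂ) _)
  rw [cfc_eq_aeval hρ.1.1 f q fun x hx => hq x (Or.inl hx), h1, Complex.ofReal_sum]
  refine Finset.sum_congr rfl fun S _ => ?_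
  rw [hq _ (Or.inr ⟨S, rfl⟩), mul_comm, Complex.ofReal_mul]

end Eigvec

lemma hFun_neg (n x : ℝ) : hFun n (-x) = hFun n x := by
  simp only [hFun, ← sub_eq_add_neg, sub_neg_eq_add]
  split_ifs
  · rw [add_comm]
  · rw [add_comm (((1 - x) / 2) ^ n)]

lemma hFun_zero (n : ℝ) : hFun n 0 = Real.log 2 := by
  unfold hFun
  split_ifs with h
  · simp only [Real.negMulLog, add_zero, sub_zero, one_div, Real.log_inv]
    ring
  · rw [add_zero, sub_zero, ← two_mul, Real.log_mul (by norm_num) (by positivity),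
      Real.log_rpow (by norm_num), one_div, Real.log_inv]
    have : (1 : ℝ) - n ≠ 0 := sub_ne_zero.2 (Ne.symm h)
    field_simp
    ring

/-- The Shannon entropy of independent random bits is additive. -/
lemma sum_negMulLog_prod {J : Type*} [DecidableEq J] (f g : J → ℝ) (s : Finset J)
    (h : ∀ j, f j + g j = 1) :
    ∑ S ∈ s.powerset, ∏ j ∈ s, S.piecewise f g j = 1 ∧
    ∑ S ∈ s.powerset, Real.negMulLog (∏ j ∈ s, S.piecewise f g j) =
      ∑ j ∈ s, (Real.negMulLog (f j) + Real.negMulLog (g j)) := by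
  induction s using Finset.induction_on with
  | empty => simp
  | insert j s hj ih =>
    have h1 : ∀ S ∈ s.powerset, ∏ i ∈ insert j s, S.piecewise f g i =
        g j * ∏ i ∈ s, S.piecewise f g i := by
      intro S hS
      rw [Finset.prod_insert hj, Finset.piecewise_eq_of_notMem _ _ _
        fun h => hj (Finset.mem_powerset.1 hS h)]
    have h2 : ∀ S ∈ s.powerset, ∏ i ∈ insert j s, (insert j S).piecewise f g i =
        f j * ∏ i ∈ s, S.piecewise f g i := by
      intro S _
      rw [Finset.prod_insert hj, Finset.piecewise_insert_self]
      congr 1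
      refine Finset.prod_congr rfl fun i hi => ?_
      rw [Finset.piecewise_insert_of_ne]
      rintro rfl
      exact hj hi
    rw [Finset.sum_powerset_insert hj, Finset.sum_powerset_insert hj, Finset.sum_insert hj,
      Finset.sum_congr rfl h1, Finset.sum_congr rfl h2,
      Finset.sum_congr rfl fun S hS => congrArg Real.negMulLog (h1 S hS),
      Finset.sum_congr rfl fun S hS => congrArg Real.negMulLog (h2 S hS)]
    simp only [Real.negMulLog_mul, Finset.sum_add_distrib, ← Finset.mul_sum, ← Finset.sum_mul,
      ih.1, ih.2]
    refine ⟨by linarith [h j], ?_⟩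
    linear_combination
      (∑ i ∈ s, Real.negMulLog (f i) + ∑ i ∈ s, Real.negMulLog (g i)) * h j

lemma corrEntropy_eq_sum {m : Type} [Fintype m] [DecidableEq m] {M : Matrix m m ℂ}
    (hM : M.IsHermitian) (n : ℝ) :
    corrEntropy n M = (1 / 2) * ∑ i, hFun n (hM.eigenvalues i) := by
  rw [corrEntropy, trace_cfc hM, ← Complex.ofReal_sum, Complex.ofReal_re]

/-- The Rényi entropy of a Gaussian state is that of its correlation matrix. -/
theorem renyiEntropy_gaussian {ρ : Op Λ} (hρ : IsDensity ρ) (hW : SatisfiesWick ρ) (n : ℝ) :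
    renyiEntropy n ρ = corrEntropy n (corr ρ field) := by
  have hΓ : (corr ρ field).IsHermitian := corr_isHermitian hρ.1.1 field
  have hK := mixing_pos hΓ
  have hlogK : Real.log (mixing hΓ) =
      (Fintype.card (PosMode hΓ) - Fintype.card Λ : ℝ) * Real.log 2 := by
    rw [mixing, Real.log_div (by positivity) (by positivity), Real.log_pow, Real.log_pow]
    ring
  -- Each zero eigenvalue contributes h_n(0) = log 2, halved by the prefactor; together they give
  -- (|Λ| - #modes) log 2, which is minus the logarithm of `mixing`.
  have hR : corrEntropy n (corr ρ field) =
      ∑ j : PosMode hΓ, hFun n (hΓ.eigenvalues j) - Real.log (mixing hΓ) := by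
    rw [corrEntropy_eq_sum hΓ, sum_eigenvalues_even hρ.2 hΓ _ (hFun_neg n), hFun_zero,
      Finset.sum_sub_distrib, hlogK]
    simp only [Finset.sum_const, Finset.card_univ, nsmul_eq_mul]
    ring
  have hbd : ∀ j : PosMode hΓ, -1 ≤ hΓ.eigenvalues j ∧ hΓ.eigenvalues j ≤ 1 :=
    fun j => eigenvalues_mem hΓ hρ j
  rw [hR, renyiEntropy, trace_cfc_gaussian hΓ hρ hW, trace_cfc_gaussian hΓ hρ hW,
    Complex.ofReal_re, Complex.ofReal_re]
  split_ifs with h1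
  · have h2 := sum_negMulLog_prod (fun j : PosMode hΓ => (1 + hΓ.eigenvalues j) / 2)
      (fun j => (1 - hΓ.eigenvalues j) / 2) Finset.univ (fun j => by ring)
    rw [Finset.powerset_univ] at h2
    have h3 : ∀ S : Finset (PosMode hΓ),
        (mixing hΓ)⁻¹ * Real.negMulLog (mixing hΓ * modeProb hΓ S) =
          Real.negMulLog (modeProb hΓ S) - modeProb hΓ S * Real.log (mixing hΓ) := by
      intro S
      rw [Real.negMulLog_mul, Real.negMulLog]
      field_simp
      ring
    simp only [h3, Finset.sum_sub_distrib, ← Finset.sum_mul]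
    rw [show ∑ S, modeProb hΓ S = 1 from h2.1, one_mul]
    congr 1
    refine h2.2.trans (Finset.sum_congr rfl fun j _ => ?_)
    simp [hFun, h1]
  · have h0 : (1 : ℝ) - n ≠ 0 := sub_ne_zero.2 (Ne.symm h1)
    have h3 : ∀ S : Finset (PosMode hΓ), (mixing hΓ)⁻¹ * (mixing hΓ * modeProb hΓ S) ^ n =
        (mixing hΓ) ^ (n - 1) * ∏ j, S.piecewise
          (fun j : PosMode hΓ => ((1 + hΓ.eigenvalues j) / 2) ^ n)
          (fun j => ((1 - hΓ.eigenvalues j) / 2) ^ n) j := by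
      intro S
      rw [modeProb, Real.mul_rpow hK.le (occupation_nonneg hbd S), Real.rpow_sub_one hK.ne',
        occupation, ← Real.finsetProd_rpow]
      · rw [← mul_assoc, inv_mul_eq_div]
        congr 1
        refine Finset.prod_congr rfl fun j _ => ?_
        by_cases hj : j ∈ S <;> simp [hj]
      · intro j _
        have := hbd j
        by_cases hj : j ∈ S
        · rw [Finset.piecewise_eq_of_mem _ _ _ hj]; linarith
        · rw [Finset.piecewise_eq_of_notMem _ _ _ hj]; linarith
    -- Nonvanishing is needed to take the logarithm of the product. A positive eigenvalue keeps the
    -- first summand positive even at a = 1.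
    have hpos : ∀ j : PosMode hΓ,
        ((1 + hΓ.eigenvalues j) / 2) ^ n + ((1 - hΓ.eigenvalues j) / 2) ^ n ≠ 0 := by
      intro j
      have h4 := hbd j
      have h5 : 0 < ((1 + hΓ.eigenvalues j) / 2) ^ n :=
        Real.rpow_pos_of_pos (by linarith [j.2]) _
      have h6 : 0 ≤ ((1 - hΓ.eigenvalues j) / 2) ^ n := Real.rpow_nonneg (by linarith) _
      positivity
    simp only [h3, ← Finset.mul_sum, sum_prod_piecewise]
    rw [Real.log_mul (by positivity) (Finset.prod_ne_zero_iff.2 fun j _ => hpos j),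
      Real.log_rpow hK, Real.log_prod (fun j _ => hpos j), mul_add, Finset.mul_sum]
    simp only [hFun, h1, if_false]
    field_simp
    ring

end Spectrum

/-! ### Reduced states of an initial segment of sites. -/

section Reduction

open scoped Kronecker

variable {Λ Λ' : Type} [Fintype Λ] [LinearOrder Λ] [Fintype Λ'] [LinearOrder Λ'] (φ : Λ' ↪o Λ)

/-- The sites outside of the subsystem `Λ'`. -/
abbrev Outside : Type := {i // i ∉ Finset.univ.map φ.toEmbedding}

/-- Sets of sites as pairs of a subset of the subsystem and a subset of its complement. -/
def splitEquiv : Finset Λ ≃ Finset Λ' × Finset (Outside φ) where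
  toFun S := (Finset.univ.filter (φ · ∈ S), S.subtype (· ∉ Finset.univ.map φ.toEmbedding))
  invFun p := p.1.map φ.toEmbedding ∪ p.2.map (Function.Embedding.subtype _)
  left_inv S := by
    ext i
    by_cases hi : ∃ a, φ a = i
    · obtain ⟨a, rfl⟩ := hi
      simp
    · have : ∀ a, φ a ≠ i := fun a h => hi ⟨a, h⟩
      simp [this]
  right_inv p := by
    refine Prod.ext ?_ ?_
    · ext a
      simp
    · ext ⟨i, hi⟩
      have : ∀ a, φ a ≠ i := by simpa using hi
      simp [this]

/-- The operators of the subsystem as operators on the full Fock space. -/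
def embedOp (X : Op Λ') : Op Λ :=
  (X ⊗ₖ (1 : Matrix (Finset (Outside φ)) (Finset (Outside φ)) ℂ)).submatrix
    (splitEquiv φ) (splitEquiv φ)

/-- The reduced density matrix of the subsystem. -/
def restrict (ρ : Op Λ) : Op Λ' :=
  ∑ R : Finset (Outside φ), ρ.submatrix (fun S => (splitEquiv φ).symm (S, R))
    (fun S => (splitEquiv φ).symm (S, R))

lemma embedOp_one : embedOp φ 1 = 1 := by
  simp [embedOp, Matrix.submatrix_one_equiv]

lemma embedOp_mul (X Y : Op Λ') : embedOp φ (X * Y) = embedOp φ X * embedOp φ Y := by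
  rw [embedOp, embedOp, embedOp, Matrix.submatrix_mul_equiv, ← Matrix.mul_kronecker_mul, one_mul]

lemma embedOp_conjTranspose (X : Op Λ') : embedOp φ Xᴴ = (embedOp φ X)ᴴ := by
  rw [embedOp, embedOp, Matrix.conjTranspose_submatrix, Matrix.conjTranspose_kronecker,
    Matrix.conjTranspose_one]

lemma embedOp_list_prod (l : List (Op Λ')) : embedOp φ l.prod = (l.map (embedOp φ)).prod := by
  induction l with
  | nil => simp [embedOp_one]
  | cons X l ih => simp [embedOp_mul, ih]

/-- The partial trace is adjoint to X ↦ X ⊗ 1. -/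
lemma expect_restrict (ρ : Op Λ) (X : Op Λ') :
    expect (restrict φ ρ) X = expect ρ (embedOp φ X) := by
  have h1 : expect ρ (embedOp φ X) = ∑ p, ∑ q, ρ ((splitEquiv φ).symm p) ((splitEquiv φ).symm q) *
      (X ⊗ₖ (1 : Matrix (Finset (Outside φ)) (Finset (Outside φ)) ℂ)) q p := by
    rw [expect, Matrix.trace, ← (splitEquiv φ).symm.sum_comp]
    refine Finset.sum_congr rfl fun p _ => ?_
    rw [Matrix.diag_apply, Matrix.mul_apply, ← (splitEquiv φ).symm.sum_comp]
    simp [embedOp]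
  rw [h1, expect, restrict, Finset.sum_mul, Matrix.trace_sum, Fintype.sum_prod_type_right]
  refine Finset.sum_congr rfl fun R _ => ?_
  rw [Matrix.trace]
  refine Finset.sum_congr rfl fun S _ => ?_
  rw [Matrix.diag_apply, Matrix.mul_apply, Fintype.sum_prod_type]
  refine Finset.sum_congr rfl fun T _ => ?_
  rw [Finset.sum_eq_single R]
  · simp
  · intro R' _ hR'
    simp [Matrix.one_apply, hR']
  · simp

lemma restrict_isDensity {ρ : Op Λ} (hρ : IsDensity ρ) : IsDensity (restrict φ ρ) := by
  refine ⟨Matrix.posSemidef_sum _ fun R _ => hρ.1.submatrix _, ?_⟩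
  have h := expect_restrict φ ρ 1
  rw [embedOp_one, expect, expect, mul_one, mul_one, hρ.2] at h
  exact h

lemma splitEquiv_erase (i : Λ') (T : Finset Λ) : splitEquiv φ (T.erase (φ i)) =
    ((splitEquiv φ T).1.erase i, (splitEquiv φ T).2) := by
  refine Prod.ext ?_ ?_
  · ext j
    simp [splitEquiv]
  · ext ⟨j, hj⟩
    have : j ≠ φ i := fun h => hj (by simp [h])
    simp [splitEquiv, this]

variable {φ} (hφ : ∀ i, ∀ j < φ i, ∃ a, φ a = j)

include hφ

/-- By `hφ` every site below `φ i` lies in the subsystem, so the fermionic sign only counts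
particles there and no string crosses the complement. -/
lemma embedOp_ann (i : Λ') : embedOp φ (ann i) = ann (φ i) := by
  ext S T
  rw [embedOp, Matrix.submatrix_apply, Matrix.kroneckerMap_apply, Matrix.one_apply, ann, ann,
    Matrix.of_apply, Matrix.of_apply]
  have h2 : φ i ∈ T ↔ i ∈ (splitEquiv φ T).1 := by simp [splitEquiv]
  have h3 : S = T.erase (φ i) ↔ (splitEquiv φ S).1 = (splitEquiv φ T).1.erase i ∧
      (splitEquiv φ S).2 = (splitEquiv φ T).2 := by
    rw [← (splitEquiv φ).injective.eq_iff, splitEquiv_erase, Prod.ext_iff]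
  have h4 : (T.filter (fun j => j < φ i)).card =
      ((splitEquiv φ T).1.filter (fun j => j < i)).card := by
    rw [← Finset.card_map φ.toEmbedding]
    congr 1
    ext j
    simp only [Finset.mem_filter, Finset.mem_map, splitEquiv, Equiv.coe_fn_mk, Finset.mem_univ,
      true_and, RelEmbedding.coe_toEmbedding]
    constructor
    · rintro ⟨hT, hj⟩
      obtain ⟨a, rfl⟩ := hφ i j hj
      exact ⟨a, ⟨hT, φ.lt_iff_lt.1 hj⟩, rfl⟩
    · rintro ⟨a, ⟨hT, ha⟩, rfl⟩
      exact ⟨hT, φ.lt_iff_lt.2 ha⟩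
  rw [h4]
  by_cases hi : i ∈ (splitEquiv φ T).1 <;>
    by_cases hS : (splitEquiv φ S).1 = (splitEquiv φ T).1.erase i <;>
    by_cases hR : (splitEquiv φ S).2 = (splitEquiv φ T).2 <;>
    simp only [h2, h3, hi, hS, hR, if_true, if_false, and_true, and_false, true_and, mul_one,
      mul_zero, zero_mul, and_self]

lemma embedOp_field (u : Λ' × Fin 2) : embedOp φ (field u) = field (φ u.1, u.2) := by
  obtain ⟨i, c⟩ := u
  fin_cases c
  · simp [field, doublet, embedOp_conjTranspose, embedOp_ann hφ]
  · simp [field, doublet, embedOp_ann hφ]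

lemma expect_restrict_prod (ρ : Op Λ) (l : List (Λ' × Fin 2)) :
    expect (restrict φ ρ) (l.map field).prod =
      expect ρ ((l.map fun u => (φ u.1, u.2)).map field).prod := by
  rw [expect_restrict, embedOp_list_prod, List.map_map, List.map_map]
  congr 3
  exact funext fun u => embedOp_field hφ u

/-- Correlators of the reduced state are correlators of the full state at the embedded sites, so
Wick's expansion is inherited term by term. -/
lemma restrict_satisfiesWick {ρ : Op Λ} (hW : SatisfiesWick ρ) : SatisfiesWick (restrict φ ρ) := by
  intro u l
  have h1 := expect_restrict_prod hφ ρ (u :: l)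
  have h2 := hW (φ u.1, u.2) (l.map fun u => (φ u.1, u.2))
  simp only [List.map_cons, List.prod_cons] at h1
  rw [h1, h2]
  refine Fintype.sum_equiv (finCongr (by simp)) _ _ fun j => ?_
  have h3 := expect_restrict_prod hφ ρ (l.eraseIdx j)
  have h4 := expect_restrict_prod hφ ρ [u, l.get (finCongr (by simp) j)]
  simp only [List.map_cons, List.prod_cons, List.map_nil, List.prod_nil, mul_one] at h4
  rw [List.eraseIdx_map]
  simp only [List.get_eq_getElem, List.getElem_map, finCongr_apply, Fin.val_cast] at h3 h4 ⊢
  rw [h3, h4]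

lemma corr_restrict (ρ : Op Λ) (u v : Λ' × Fin 2) :
    corr (restrict φ ρ) field u v = corr ρ field (φ u.1, u.2) (φ v.1, v.2) := by
  simp only [corr, Matrix.of_apply, expect_restrict, embedOp_mul, embedOp_conjTranspose,
    embedOp_field hφ, Prod.ext_iff, φ.injective.eq_iff]

end Reduction

/-! ### Invariance of entropies under relabelling. -/

section ReindexEntropy

variable {m κ : Type} [Fintype m] [DecidableEq m] [Fintype κ] [DecidableEq κ]

lemma submatrix_equiv_pow (M : Matrix m m ℂ) (e : κ ≃ m) (k : ℕ) :
    (M.submatrix e e) ^ k = (M ^ k).submatrix e e := by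
  have := map_pow (Matrix.reindexAlgEquiv ℂ ℂ e.symm) M k
  simpa [Matrix.coe_reindexAlgEquiv, Matrix.reindex_apply] using this.symm

lemma trace_cfc_submatrix {M : Matrix m m ℂ} (hM : M.IsHermitian) (e : κ ≃ m) (f : ℝ → ℝ) :
    (cfc f (M.submatrix e e)).trace = (cfc f M).trace := by
  refine trace_cfc_congr (hM.submatrix e) hM (fun k => ?_) f
  rw [submatrix_equiv_pow]
  exact e.sum_comp (fun i => (M ^ k) i i)

lemma renyiEntropy_submatrix {M : Matrix m m ℂ} (hM : M.IsHermitian) (e : κ ≃ m) (n : ℝ) :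
    renyiEntropy n (M.submatrix e e) = renyiEntropy n M := by
  simp only [renyiEntropy, trace_cfc_submatrix hM]

lemma corrEntropy_submatrix {M : Matrix m m ℂ} (hM : M.IsHermitian) (e : κ ≃ m) (n : ℝ) :
    corrEntropy n (M.submatrix e e) = corrEntropy n M := by
  simp only [corrEntropy, trace_cfc_submatrix hM]

end ReindexEntropy

/-! ### The strip as an initial segment of the lattice. -/

section Strip

variable {Lx Ly ℓ : ℕ}

/-- The inclusion of the strip in the lattice. -/
def stripEmb (hℓ : ℓ ≤ Lx) : Site ℓ Ly ↪o Site Lx Ly :=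
  OrderEmbedding.ofStrictMono (fun i => toLex (Fin.castLE hℓ (ofLex i).1, (ofLex i).2)) <| by
    intro i j h
    rcases Prod.Lex.lt_iff.1 h with h | ⟨h, h'⟩
    · exact Prod.Lex.lt_iff.2 (Or.inl h)
    · exact Prod.Lex.lt_iff.2 (Or.inr ⟨congrArg (Fin.castLE hℓ) h, h'⟩)

lemma exists_stripEmb_iff (hℓ : ℓ ≤ Lx) (i : Site Lx Ly) :
    (∃ a, stripEmb hℓ a = i) ↔ i ∈ strip Lx Ly ℓ := by
  constructor
  · rintro ⟨a, rfl⟩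
    simp only [strip, Finset.mem_filter, Finset.mem_univ, true_and]
    exact (ofLex a).1.2
  · intro h
    exact ⟨toLex (⟨((ofLex i).1 : ℕ), by simpa [strip] using h⟩, (ofLex i).2), rfl⟩

/-- The lexicographic order compares i_x first; this provides the hypothesis that removes the sign
strings. -/
lemma stripEmb_lower (hℓ : ℓ ≤ Lx) (i : Site ℓ Ly) (j : Site Lx Ly) (hj : j < stripEmb hℓ i) :
    ∃ a, stripEmb hℓ a = j := by
  have hi := (exists_stripEmb_iff hℓ _).1 ⟨i, rfl⟩
  rw [exists_stripEmb_iff]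
  simp only [strip, Finset.mem_filter, Finset.mem_univ, true_and] at hi ⊢
  rcases Prod.Lex.lt_iff.1 hj with h | ⟨h, _⟩
  · exact lt_trans h hi
  · rw [h]; exact hi

lemma notMem_outside (hℓ : ℓ ≤ Lx) (i : Site Lx Ly) :
    i ∉ Finset.univ.map (stripEmb hℓ).toEmbedding ↔ i ∉ strip Lx Ly ℓ := by
  rw [← exists_stripEmb_iff hℓ]
  simp

/-- The subsets of the strip. -/
def powersetEquiv (hℓ : ℓ ≤ Lx) : Finset (Site ℓ Ly) ≃ ↥(strip Lx Ly ℓ).powerset where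
  toFun S := ⟨S.map (stripEmb hℓ).toEmbedding, by
    rw [Finset.mem_powerset]
    intro i hi
    obtain ⟨a, _, rfl⟩ := Finset.mem_map.1 hi
    exact (exists_stripEmb_iff hℓ _).1 ⟨a, rfl⟩⟩
  invFun S := Finset.univ.filter (stripEmb hℓ · ∈ S.1)
  left_inv S := by ext i; simp
  right_inv S := by
    have := Finset.mem_powerset.1 S.2
    apply Subtype.ext
    ext i
    simp only [Finset.mem_map, Finset.mem_filter, Finset.mem_univ, true_and]
    constructor
    · rintro ⟨a, ha, rfl⟩
      exact ha
    · intro hi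
      obtain ⟨a, rfl⟩ := (exists_stripEmb_iff hℓ _).2 (this hi)
      exact ⟨a, hi, rfl⟩

lemma reducedDensity_submatrix (hℓ : ℓ ≤ Lx) (ρ : Op (Site Lx Ly)) :
    (reducedDensity ℓ ρ).submatrix (powersetEquiv hℓ) (powersetEquiv hℓ) =
      restrict (stripEmb hℓ) ρ := by
  ext S T
  rw [Matrix.submatrix_apply, reducedDensity, Matrix.of_apply, restrict, Matrix.sum_apply]
  have hmap : ∀ R ∈ (strip Lx Ly ℓ)ᶜ.powerset,
      (R.subtype (· ∉ Finset.univ.map (stripEmb hℓ).toEmbedding)).map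
        (Function.Embedding.subtype _) = R := by
    intro R hR
    rw [Finset.subtype_map, Finset.filter_eq_self]
    intro i hi
    rw [notMem_outside]
    exact Finset.mem_compl.1 (Finset.mem_powerset.1 hR hi)
  refine Finset.sum_bij'
    (fun R _ => R.subtype (· ∉ Finset.univ.map (stripEmb hℓ).toEmbedding))
    (fun R _ => R.map (Function.Embedding.subtype _)) ?_ ?_ hmap ?_ ?_
  · simp
  · intro R _
    rw [Finset.mem_powerset]
    intro i hi
    obtain ⟨j, _, rfl⟩ := Finset.mem_map.1 hi
    exact Finset.mem_compl.2 ((notMem_outside hℓ _).1 j.2)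
  · intro R _
    ext i
    rw [Finset.mem_subtype]
    exact Finset.mem_map' (Function.Embedding.subtype _)
  · intro R hR
    simp only [Matrix.submatrix_apply, splitEquiv, Equiv.coe_fn_symm_mk, hmap R hR, powersetEquiv,
      Equiv.coe_fn_mk]

/-- The sites of the strip as an ordered set. -/
def stripIndex (ℓ Ly : ℕ) : (Fin ℓ × Fin Ly) × Fin 2 ≃ Site ℓ Ly × Fin 2 :=
  toLex.prodCongr (Equiv.refl _)

lemma stripCorr_eq_submatrix (hℓ : ℓ ≤ Lx) (ρ : Op (Site Lx Ly)) :
    stripCorr hℓ ρ = (corr (restrict (stripEmb hℓ) ρ) field).submatrix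
      (stripIndex ℓ Ly) (stripIndex ℓ Ly) := by
  ext u v
  rw [Matrix.submatrix_apply, corr_restrict (stripEmb_lower hℓ)]
  have h : u = v ↔ ((stripEmb hℓ (stripIndex ℓ Ly u).1, (stripIndex ℓ Ly u).2) =
      (stripEmb hℓ (stripIndex ℓ Ly v).1, (stripIndex ℓ Ly v).2)) :=
    ⟨fun h => by rw [h], fun h => (stripIndex ℓ Ly).injective
      (Prod.ext ((stripEmb hℓ).injective (congrArg Prod.fst h)) (congrArg Prod.snd h :))⟩
  simp only [corr, Matrix.of_apply, ← h]
  simp only [stripCorr, corr, Matrix.of_apply]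
  rfl

/-- The entropy of the strip in a Gaussian state is that of its correlation matrix. -/
theorem renyiEntropy_reducedDensity (hℓ : ℓ ≤ Lx) {ρ : Op (Site Lx Ly)} (hρ : IsDensity ρ)
    (hW : SatisfiesWick ρ) (n : ℝ) :
    renyiEntropy n (reducedDensity ℓ ρ) = corrEntropy n (stripCorr hℓ ρ) := by
  have hρA := restrict_isDensity (stripEmb hℓ) hρ
  have hWA := restrict_satisfiesWick (stripEmb_lower hℓ) hW
  have h1 : reducedDensity ℓ ρ = (restrict (stripEmb hℓ) ρ).submatrix
      (powersetEquiv hℓ).symm (powersetEquiv hℓ).symm := by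
    rw [← reducedDensity_submatrix, Matrix.submatrix_submatrix]
    simp
  rw [h1, renyiEntropy_submatrix hρA.1.1, renyiEntropy_gaussian hρA hWA, stripCorr_eq_submatrix,
    corrEntropy_submatrix (corr_isHermitian hρA.1.1 _)]

end Strip

/-! ### Second quantization and selection rules. -/

section SecondQuantization

variable {Λ : Type} [Fintype Λ] [LinearOrder Λ]

/-- Inserting an anticommuting factor into an ordered product. -/
lemma mul_ordered_prod {R : Type*} [Ring R] [Algebra ℂ R] (c : Λ → R)
    (hc : ∀ i j, c i * c j + c j * c i = 0) (i : Λ) (l : List Λ) (hl : l.Pairwise (· < ·)) :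
    c i * (l.map c).prod = if i ∈ l then 0 else
      (-1 : ℂ) ^ (l.filter (· < i)).length • ((l.orderedInsert (· ≤ ·) i).map c).prod := by
  have hsq : c i * c i = 0 := by
    have := hc i i
    rw [← two_smul ℂ] at this
    exact (smul_eq_zero.1 this).resolve_left two_ne_zero
  induction l with
  | nil => simp
  | cons b l ih =>
    have hl' := List.pairwise_cons.1 hl
    rw [List.map_cons, List.prod_cons, ← mul_assoc]
    rcases lt_trichotomy i b with h | h | h
    · have hi : i ∉ b :: l := by
        intro hm
        rcases List.mem_cons.1 hm with rfl | hm
        · exact lt_irrefl _ h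
        · exact lt_asymm h (hl'.1 _ hm)
      have hf : (b :: l).filter (· < i) = [] := by
        rw [List.filter_eq_nil_iff]
        intro a ha
        rcases List.mem_cons.1 ha with rfl | ha
        · simpa using h.le
        · simpa using (h.trans (hl'.1 _ ha)).le
      rw [if_neg hi, hf, List.orderedInsert_cons, if_pos h.le]
      simp [mul_assoc]
    · subst h
      simp [hsq]
    · rw [eq_neg_of_add_eq_zero_left (hc i b), neg_mul, mul_assoc, ih hl'.2]
      have hib : i ≠ b := h.ne'
      by_cases hi : i ∈ l
      · simp [hi]
      · rw [if_neg hi, if_neg (by simp [hi, hib]), List.filter_cons_of_pos (by simpa using h),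
          List.orderedInsert_cons, if_neg h.not_ge, List.map_cons, List.prod_cons,
          List.length_cons, pow_succ, mul_smul_comm]
        simp

/-- The reordering sign depends only on anticommutation and equals the Fock space sign. Applied to
the creation operators at the images of the sites, it makes second quantization intertwine creation
operators. -/
lemma mul_sort_prod {R : Type*} [Ring R] [Algebra ℂ R] (c : Λ → R)
    (hc : ∀ i j, c i * c j + c j * c i = 0) (i : Λ) (S : Finset Λ) :
    c i * (S.sort.map c).prod =
      if i ∈ S then 0 else sgn i S • ((insert i S).sort.map c).prod := by
  rw [mul_ordered_prod c hc i (S.sort (· ≤ ·)) (Finset.sortedLT_sort S).pairwise]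
  simp only [Finset.mem_sort]
  split_ifs with hi
  · rfl
  · have h1 : (S.sort.filter (· < i)).length = (S.filter (fun j => j < i)).card := by
      rw [Finset.card, Finset.filter_val, ← Finset.sort_eq S (· ≤ ·), Multiset.filter_coe,
        Multiset.coe_card]
    have h2 : S.sort.orderedInsert (· ≤ ·) i = (insert i S).sort := by
      refine List.Perm.eq_of_pairwise' (List.Pairwise.orderedInsert i _ (Finset.pairwise_sort S _))
        (Finset.pairwise_sort _ _) ((List.perm_orderedInsert _ i _).trans ?_)
      rw [← Multiset.coe_eq_coe, ← Multiset.cons_coe, Finset.sort_eq, Finset.sort_eq,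
        Finset.insert_val_of_notMem hi]
    rw [h1, h2, sgn]

lemma conjTranspose_ann_anticomm (i j : Λ) :
    (ann i)ᴴ * (ann j)ᴴ + (ann j)ᴴ * (ann i)ᴴ = 0 := by
  rw [← Matrix.conjTranspose_mul, ← Matrix.conjTranspose_mul, ← Matrix.conjTranspose_add,
    ann_anticomm_ann, Matrix.conjTranspose_zero]

lemma secondQuantize_col (σ : Λ → Λ) (T : Finset Λ) :
    (fun S => secondQuantize σ S T) =
      ((T.sort.map fun i => (ann (σ i))ᴴ).prod) *ᵥ vacuum := rfl

lemma secondQuantize_conjTranspose_ann (σ : Λ → Λ) (i : Λ) :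
    secondQuantize σ * (ann i)ᴴ = (ann (σ i))ᴴ * secondQuantize σ := by
  ext S T
  have h1 : ((ann (σ i))ᴴ * secondQuantize σ) S T =
      (((ann (σ i))ᴴ * (T.sort.map fun i => (ann (σ i))ᴴ).prod) *ᵥ vacuum) S := by
    rw [← Matrix.mulVec_mulVec, ← secondQuantize_col]
    rfl
  rw [h1, mul_conjTranspose_ann_apply,
    mul_sort_prod (fun i => (ann (σ i))ᴴ) (fun _ _ => conjTranspose_ann_anticomm _ _)]
  split_ifs with hi
  · simp
  · rw [Matrix.smul_mulVec, Pi.smul_apply, ← secondQuantize_col, smul_eq_mul]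

lemma conjTranspose_ann_mulVec_single (i : Λ) (S : Finset Λ) (hi : i ∉ S) :
    (ann i)ᴴ *ᵥ Pi.single S 1 = sgn i S • Pi.single (insert i S) (1 : ℂ) := by
  ext U
  rw [Matrix.mulVec_single_one, Matrix.col_apply]
  have := mul_conjTranspose_ann_apply (1 : Op Λ) i U S
  rw [one_mul, if_neg hi] at this
  rw [this, Matrix.one_apply]
  simp [Pi.single_apply]

/-- The reordering sign is left unspecified: unitarity of the second quantization uses only its
modulus. -/
lemma creation_list_vacuum (l : List Λ) (hl : l.Nodup) :
    ∃ ε : ℂ, star ε * ε = 1 ∧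
      (l.map fun i => (ann i)ᴴ).prod *ᵥ vacuum = ε • Pi.single l.toFinset 1 := by
  induction l with
  | nil => exact ⟨1, by simp, by simp only [List.map_nil, List.prod_nil, Matrix.one_mulVec, vacuum, List.toFinset_nil, one_smul]⟩
  | cons i l ih =>
    obtain ⟨hi, hl⟩ := List.nodup_cons.1 hl
    obtain ⟨ε, h1, h2⟩ := ih hl
    refine ⟨ε * sgn i l.toFinset, ?_, ?_⟩
    · rw [star_mul, star_sgn, mul_mul_mul_comm]
      rw [show sgn i l.toFinset * ε * (star ε * sgn i l.toFinset) =
        (star ε * ε) * (sgn i l.toFinset * sgn i l.toFinset) by ring, h1, sgn_mul_self, one_mul]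
    · rw [List.map_cons, List.prod_cons, ← Matrix.mulVec_mulVec, h2, Matrix.mulVec_smul,
        conjTranspose_ann_mulVec_single _ _ (by simpa using hi), smul_smul, List.toFinset_cons]

lemma secondQuantize_unitary {σ : Λ → Λ} (hσ : Function.Injective σ) :
    (secondQuantize σ)ᴴ * secondQuantize σ = 1 := by
  have h : ∀ T : Finset Λ, ∃ ε : ℂ, star ε * ε = 1 ∧
      ∀ S, secondQuantize σ S T = ε * (Pi.single (T.image σ) 1 : Finset Λ → ℂ) S := by
    intro T
    obtain ⟨ε, h1, h2⟩ := creation_list_vacuum (T.sort.map σ) ((Finset.sort_nodup T _).map hσ)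
    refine ⟨ε, h1, fun S => ?_⟩
    rw [List.map_map] at h2
    have h3 := congrFun h2 S
    have h4 : (T.sort.map σ).toFinset = T.image σ := by
      ext; simp
    rw [h4] at h3
    exact h3
  choose ε h1 h2 using h
  ext T T'
  rw [Matrix.mul_apply, Finset.sum_eq_single (T'.image σ)]
  · rw [Matrix.conjTranspose_apply, h2, h2, Matrix.one_apply]
    by_cases hT : T = T'
    · subst hT
      simpa using h1 T
    · have : T'.image σ ≠ T.image σ := fun h => hT (Finset.image_injective hσ h).symm
      simp [hT, this]
  · intro S _ hS
    rw [h2 T']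
    simp [hS]
  · simp

/-- This is the adjoint of the relation for creation operators, with unitarity used to move the
second quantization back to the left. -/
lemma secondQuantize_ann {σ : Λ → Λ} (hσ : Function.Injective σ) (i : Λ) :
    secondQuantize σ * ann i = ann (σ i) * secondQuantize σ := by
  have hu := secondQuantize_unitary hσ
  have hu' := mul_eq_one_comm.1 hu
  have h := congrArg Matrix.conjTranspose (secondQuantize_conjTranspose_ann σ i)
  rw [Matrix.conjTranspose_mul, Matrix.conjTranspose_mul, Matrix.conjTranspose_conjTranspose,
    Matrix.conjTranspose_conjTranspose] at h
  calc secondQuantize σ * ann i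
      = secondQuantize σ * (ann i * (secondQuantize σ)ᴴ) * secondQuantize σ := by
        rw [mul_assoc, mul_assoc, hu, mul_one]
    _ = _ := by rw [h, ← mul_assoc, hu', one_mul]

lemma secondQuantize_field {σ : Λ → Λ} (hσ : Function.Injective σ) (u : Λ × Fin 2) :
    secondQuantize σ * field u = field (σ u.1, u.2) * secondQuantize σ := by
  obtain ⟨i, c⟩ := u
  fin_cases c
  · simpa [field, doublet] using secondQuantize_conjTranspose_ann σ i
  · simpa [field, doublet] using secondQuantize_ann hσ i

/-- Selection rule: an operator that acquires a nontrivial phase under a symmetry of the state has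
vanishing expectation value. -/
lemma expect_eq_zero_of_phase {ρ V X : Op Λ} (hV : Vᴴ * V = 1) (hρ : V * ρ = ρ * V) {z : ℂ}
    (hz : z ≠ 1) (hX : V * X = z • (X * V)) : expect ρ X = 0 := by
  have h1 : expect ρ X = z * expect ρ X := by
    calc expect ρ X = (Vᴴ * (V * ρ) * X).trace := by rw [← mul_assoc, hV, one_mul, expect]
      _ = z * (ρ * X * (V * Vᴴ)).trace := by
        rw [hρ, mul_assoc, mul_assoc, hX, Matrix.trace_mul_comm]
        simp [mul_assoc]
      _ = _ := by rw [mul_eq_one_comm.1 hV, mul_one, expect]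
  have h2 : (1 - z) * expect ρ X = 0 := by rw [sub_mul, one_mul, ← h1, sub_self]
  exact (mul_eq_zero.1 h2).resolve_left (sub_ne_zero.2 hz.symm)

end SecondQuantization

/-! ### Translation invariance along the evolution. -/

section Translation

variable {Lx Ly : ℕ} [NeZero Lx] [NeZero Ly]

/-- The translation of the sites by `k` in the `y`-direction. -/
def shiftY (k : ℕ) (i : Site Lx Ly) : Site Lx Ly :=
  toLex ((ofLex i).1, (ofLex i).2 + Fin.ofNat Ly k)

lemma shiftY_injective (k : ℕ) : Function.Injective (shiftY k : Site Lx Ly → Site Lx Ly) := by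
  intro i j h
  have h' := toLex.injective h
  have h1 := congrArg Prod.fst h'
  have h2 := add_right_cancel (congrArg Prod.snd h')
  exact ofLex.injective (Prod.ext h1 h2)

lemma translateY_unitary (k : ℕ) : (translateY Lx Ly k)ᴴ * translateY Lx Ly k = 1 :=
  secondQuantize_unitary (shiftY_injective k)

lemma translateY_field (k : ℕ) (u : Site Lx Ly × Fin 2) :
    translateY Lx Ly k * field u = field (shiftY k u.1, u.2) * translateY Lx Ly k :=
  secondQuantize_field (shiftY_injective k) u

lemma translateY_hop (k : ℕ) (i j : Site Lx Ly) :
    translateY Lx Ly k * ((ann i)ᴴ * ann j) =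
      (ann (shiftY k i))ᴴ * ann (shiftY k j) * translateY Lx Ly k := by
  have h1 : translateY Lx Ly k * (ann i)ᴴ = (ann (shiftY k i))ᴴ * translateY Lx Ly k :=
    secondQuantize_conjTranspose_ann _ i
  have h2 : translateY Lx Ly k * ann j = ann (shiftY k j) * translateY Lx Ly k :=
    secondQuantize_ann (shiftY_injective k) j
  rw [← mul_assoc, h1, mul_assoc, h2, mul_assoc]

/-- Translation permutes the bonds, and reindexing the sum over y undoes the permutation. -/
lemma translateY_hamiltonian (k : ℕ) :
    translateY Lx Ly k * hamiltonian Lx Ly = hamiltonian Lx Ly * translateY Lx Ly k := by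
  have hs : ∀ x y, shiftY k (toLex (x, y) : Site Lx Ly) = toLex (x, y + Fin.ofNat Ly k) :=
    fun _ _ => rfl
  have hop := translateY_hop (Lx := Lx) (Ly := Ly) k
  rw [hamiltonian, mul_smul_comm, smul_mul_assoc, Finset.mul_sum, Finset.sum_mul]
  generalize Fin.ofNat Ly k = κ at hs
  generalize translateY Lx Ly k = V at hop ⊢
  refine congrArg _ (Finset.sum_congr rfl fun x _ => ?_)
  rw [Finset.mul_sum, Finset.sum_mul]
  refine .trans ?_ (Equiv.sum_comp (Equiv.addRight κ) _)
  refine Finset.sum_congr rfl fun y _ => ?_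
  rw [Equiv.coe_addRight, mul_add, mul_add, mul_add, add_mul, add_mul, add_mul, hop, hop, hop, hop,
    hs, hs, hs, add_right_comm y 1 κ]

lemma evolve_invariant {k : ℕ} {ψ₀ : Finset (Site Lx Ly) → ℂ} (h : IsTranslationInvariant k ψ₀)
    (t : ℝ) : IsTranslationInvariant k (evolve t ψ₀) := by
  obtain ⟨c, hc⟩ := h
  refine ⟨c, ?_⟩
  have h1 : Commute (translateY Lx Ly k) (NormedSpace.exp (-(Complex.I * t) • hamiltonian Lx Ly)) :=
    (Commute.smul_right (translateY_hamiltonian k) _).exp_right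
  rw [evolve, Matrix.mulVec_mulVec, h1.eq, ← Matrix.mulVec_mulVec, hc, Matrix.mulVec_smul]

/-- The density matrix of an invariant vector commutes with the translation. -/
lemma translateY_commute_pureState {k : ℕ} {ψ : Finset (Site Lx Ly) → ℂ}
    (h : IsTranslationInvariant k ψ) :
    translateY Lx Ly k * pureState ψ = pureState ψ * translateY Lx Ly k := by
  obtain ⟨c, hc⟩ := h
  have hu := translateY_unitary (Lx := Lx) (Ly := Ly) k
  have hpure : translateY Lx Ly k * pureState ψ * (translateY Lx Ly k)ᴴ =
      (c * star c) • pureState ψ := by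
    rw [← pureState_mulVec, hc, pureState, pureState, star_smul, Matrix.vecMulVec_smul,
      Matrix.smul_vecMulVec, smul_smul, mul_comm]
  have hmul : translateY Lx Ly k * pureState ψ =
      (c * star c) • (pureState ψ * translateY Lx Ly k) := by
    rw [← smul_mul_assoc, ← hpure, mul_assoc, hu, mul_one]
  -- Conjugation by a unitary preserves the trace, so the factor |c|² is 1 unless the vector
  -- vanishes.
  have htr := congrArg Matrix.trace hpure
  rw [Matrix.trace_mul_comm, ← mul_assoc, hu, one_mul, Matrix.trace_smul, smul_eq_mul] at htr
  by_cases h0 : (pureState ψ).trace = 0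
  · have : ψ = 0 := by
      rw [pureState, Matrix.trace_vecMulVec, dotProduct_comm] at h0
      exact dotProduct_star_self_eq_zero.1 h0
    simp [this, pureState]
  · have : c * star c = 1 := by
      have := mul_right_cancel₀ h0 ((one_mul _).trans htr)
      exact this.symm
    rw [hmul, this, one_smul]

end Translation

/-! ### The transverse Fourier transform and its momentum sectors. -/

section Fourier

variable {Ly k : ℕ}

/-- The integer labelling the momentum `q_y + 2π p / k` in units of `2π / L_y`. -/
def momentumIndex (Ly k n p : ℕ) : ℕ := n + p * (Ly / k)

lemma momentum_mul (hk : k ∣ Ly) (hL : Ly ≠ 0) (n p : ℕ) :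
    momentum Ly k n p * Ly = 2 * Real.pi * momentumIndex Ly k n p := by
  obtain ⟨D, rfl⟩ := hk
  obtain ⟨hk0, hD0⟩ := mul_ne_zero_iff.1 hL
  have h1 : (k : ℝ) ≠ 0 := by exact_mod_cast hk0
  have h2 : (D : ℝ) ≠ 0 := by exact_mod_cast hD0
  rw [momentum, momentumIndex, Nat.mul_div_cancel_left D (Nat.pos_of_ne_zero hk0)]
  push_cast
  field_simp

/-- n and p are the remainder and the quotient of the index upon division by L_y/k. -/
lemma momentumIndex_injective {n n' p p' : ℕ} (hn : n < Ly / k)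
    (hn' : n' < Ly / k) (h : momentumIndex Ly k n p = momentumIndex Ly k n' p') :
    n = n' ∧ p = p' := by
  unfold momentumIndex at h
  have hD : 0 < Ly / k := by omega
  have h1 := congrArg (· % (Ly / k)) h
  have h2 := congrArg (· / (Ly / k)) h
  simp only [Nat.add_mul_mod_self_right, Nat.mod_eq_of_lt hn, Nat.mod_eq_of_lt hn',
    Nat.add_mul_div_right _ _ hD, Nat.div_eq_of_lt hn, Nat.div_eq_of_lt hn', zero_add] at h1 h2
  exact ⟨h1, h2⟩

lemma momentumIndex_lt (hk : k ∣ Ly) {n p : ℕ} (hn : n < Ly / k) (hp : p < k) :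
    momentumIndex Ly k n p < Ly := by
  unfold momentumIndex
  calc n + p * (Ly / k) < Ly / k + p * (Ly / k) := by omega
    _ = (p + 1) * (Ly / k) := by ring
    _ ≤ k * (Ly / k) := Nat.mul_le_mul_right _ hp
    _ = Ly := Nat.mul_div_cancel' hk

/-- The phase `e^{-iqy}`. -/
def phase (q : ℝ) (y : ℕ) : ℂ := Complex.exp (-Complex.I * q * y)

lemma phase_eq_pow (q : ℝ) (y : ℕ) : phase q y = phase q 1 ^ y := by
  rw [phase, phase, ← Complex.exp_nat_mul]
  congr 1
  push_cast
  ring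

lemma star_phase (q : ℝ) (y : ℕ) : star (phase q y) = phase (-q) y := by
  rw [phase, phase, Complex.star_def, ← Complex.exp_conj]
  congr 1
  simp

lemma phase_neg_mul (q : ℝ) (y : ℕ) : phase (-q) y * phase q y = 1 := by
  rw [phase, phase, ← Complex.exp_add, ← Complex.exp_zero]
  congr 1
  push_cast
  ring

lemma phase_mul (q q' : ℝ) (y : ℕ) : phase q y * phase q' y = phase (q + q') y := by
  rw [phase, phase, phase, ← Complex.exp_add]
  congr 1
  push_cast
  ring

lemma phase_add (q : ℝ) (y y' : ℕ) : phase q (y + y') = phase q y * phase q y' := by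
  rw [phase_eq_pow q (y + y'), phase_eq_pow q y, phase_eq_pow q y', pow_add]

lemma phase_eq_one_iff {q : ℝ} {y : ℕ} :
    phase q y = 1 ↔ ∃ j : ℤ, q * y = j * (2 * Real.pi) := by
  rw [phase, Complex.exp_eq_one_iff]
  constructor
  · rintro ⟨j, hj⟩
    refine ⟨-j, ?_⟩
    have h : ((q * y : ℝ) : ℂ) = ((-j : ℤ) * (2 * Real.pi) : ℝ) := by
      push_cast
      have hI := Complex.I_sq
      linear_combination Complex.I * hj + (q * y + j * (2 * Real.pi) : ℂ) * hI
    exact_mod_cast h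
  · rintro ⟨j, hj⟩
    refine ⟨-j, ?_⟩
    have h : ((q * y : ℝ) : ℂ) = (j * (2 * Real.pi) : ℝ) := by rw [hj]
    push_cast at h ⊢
    linear_combination -Complex.I * h

lemma phase_momentum (hk : k ∣ Ly) (hL : Ly ≠ 0) (n p : ℕ) :
    phase (momentum Ly k n p) Ly = 1 :=
  phase_eq_one_iff.2 ⟨momentumIndex Ly k n p, by rw [momentum_mul hk hL]; push_cast; ring⟩

/-- For allowed momenta the phase does not see the wrap-around of addition in `Fin Ly`. -/
lemma phase_mod {q : ℝ} (hq : phase q Ly = 1) (y : ℕ) : phase q (y % Ly) = phase q y := by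
  conv_rhs => rw [← Nat.mod_add_div y Ly, phase_add, phase_eq_pow q (Ly * _), pow_mul,
    ← phase_eq_pow, hq, one_pow, mul_one]

/-- A geometric sum whose ratio has L_y-th power 1. The ratio is 1 only when the indices agree
modulo L_y, and both lie in [0, L_y). -/
lemma sum_phase (hk : k ∣ Ly) (hL : Ly ≠ 0) {n n' p p' : ℕ} (hn : n < Ly / k) (hn' : n' < Ly / k)
    (hp : p < k) (hp' : p' < k) :
    ∑ y : Fin Ly, phase (momentum Ly k n p) y * phase (-momentum Ly k n' p') y =
      if n = n' ∧ p = p' then (Ly : ℂ) else 0 := by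
  split_ifs with h
  · obtain ⟨rfl, rfl⟩ := h
    simp [mul_comm (phase (momentum _ _ _ _) _), phase_neg_mul]
  · set q := momentum Ly k n p + -momentum Ly k n' p' with hq
    have hL' : phase q Ly = 1 := by
      rw [hq, ← phase_mul, phase_momentum hk hL, ← star_phase, phase_momentum hk hL]
      simp
    have h1 : phase q 1 ≠ 1 := by
      intro h1
      obtain ⟨j, hj⟩ := phase_eq_one_iff.1 h1
      have hm := momentum_mul hk hL n p
      have hm' := momentum_mul hk hL n' p'
      have h2 : ((momentumIndex Ly k n p : ℤ) - momentumIndex Ly k n' p') = j * Ly := by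
        have : ((momentumIndex Ly k n p : ℝ) - momentumIndex Ly k n' p') * (2 * Real.pi) =
            j * Ly * (2 * Real.pi) := by
          rw [hq] at hj
          push_cast at hj
          linear_combination hm' - hm + Ly * hj
        exact_mod_cast mul_right_cancel₀ Real.two_pi_pos.ne' this
      have hlt := momentumIndex_lt hk hn hp
      have hlt' := momentumIndex_lt hk hn' hp'
      have hj0 : j = 0 := by
        by_contra hj0
        rcases lt_or_gt_of_ne hj0 with hj0 | hj0
        · nlinarith
        · nlinarith
      rw [hj0, zero_mul, sub_eq_zero] at h2
      exact h (momentumIndex_injective hn hn' (by exact_mod_cast h2))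
    rw [Fin.sum_univ_eq_sum_range
      (fun y => phase (momentum Ly k n p) y * phase (-momentum Ly k n' p') y)]
    simp only [phase_mul, ← hq]
    rw [Finset.sum_congr rfl fun y _ => phase_eq_pow q y, geom_sum_eq h1, ← phase_eq_pow, hL',
      sub_self, zero_div]

variable {Lx ℓ : ℕ}

lemma fourierY_apply (r : ((Fin ℓ × Fin k) × Fin 2) × Fin (Ly / k))
    (s : (Fin ℓ × Fin Ly) × Fin 2) : fourierY ℓ Ly k r s =
      if r.1.1.1 = s.1.1 ∧ r.1.2 = s.2 then
        ((1 / Real.sqrt Ly : ℝ) : ℂ) * phase (momentum Ly k r.2 r.1.1.2) s.1.2 else 0 := rfl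

lemma sum_fourierY (r : ((Fin ℓ × Fin k) × Fin 2) × Fin (Ly / k)) {M : Type*} [AddCommMonoid M]
    (f : (Fin ℓ × Fin Ly) × Fin 2 → M) (hf : ∀ s, ¬(r.1.1.1 = s.1.1 ∧ r.1.2 = s.2) → f s = 0) :
    ∑ s, f s = ∑ y, f ((r.1.1.1, y), r.1.2) := by
  rw [Fintype.sum_prod_type, Fintype.sum_prod_type, Finset.sum_eq_single r.1.1.1]
  · refine Finset.sum_congr rfl fun y _ => ?_
    rw [Finset.sum_eq_single r.1.2]
    · intro c _ hc
      exact hf _ fun h => hc h.2.symm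
    · simp
  · intro x _ hx
    exact Finset.sum_eq_zero fun y _ => Finset.sum_eq_zero fun c _ => hf _ fun h => hx h.1.symm
  · simp

lemma fourierY_mul_conjTranspose (hk : k ∣ Ly) (hL : Ly ≠ 0) :
    fourierY ℓ Ly k * (fourierY ℓ Ly k)ᴴ = 1 := by
  ext r r'
  rw [Matrix.mul_apply, sum_fourierY r]
  · simp only [Matrix.conjTranspose_apply, fourierY_apply, and_self, if_true]
    have hs : ((1 / Real.sqrt Ly : ℝ) : ℂ) * ((1 / Real.sqrt Ly : ℝ) : ℂ) * Ly = 1 := by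
      have : (1 / Real.sqrt Ly) * (1 / Real.sqrt Ly) * (Ly : ℝ) = 1 := by
        have h0 : (0 : ℝ) < Ly := by exact_mod_cast Nat.pos_of_ne_zero hL
        have h1 := Real.mul_self_sqrt h0.le
        field_simp
        nlinarith
      exact_mod_cast this
    by_cases h : r'.1.1.1 = r.1.1.1 ∧ r'.1.2 = r.1.2
    · simp only [h, and_self, if_true, star_mul', star_phase]
      have h1 : ∀ y : Fin Ly, ((1 / Real.sqrt Ly : ℝ) : ℂ) * phase (momentum Ly k r.2 r.1.1.2) y *
          (star ((1 / Real.sqrt Ly : ℝ) : ℂ) * phase (-momentum Ly k r'.2 r'.1.1.2) y) =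
          ((1 / Real.sqrt Ly : ℝ) : ℂ) * ((1 / Real.sqrt Ly : ℝ) : ℂ) *
          (phase (momentum Ly k r.2 r.1.1.2) y * phase (-momentum Ly k r'.2 r'.1.1.2) y) := by
        intro y
        rw [Complex.star_def, Complex.conj_ofReal]
        ring
      rw [Finset.sum_congr rfl fun y _ => h1 y, ← Finset.mul_sum,
        sum_phase hk hL r.2.2 r'.2.2 r.1.1.2.2 r'.1.1.2.2, Matrix.one_apply]
      have h2 : r = r' ↔ (r.2 : ℕ) = r'.2 ∧ (r.1.1.2 : ℕ) = r'.1.1.2 := by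
        simp only [Prod.ext_iff, ← Fin.ext_iff, h, true_and, and_true]
        exact and_comm
      simp only [h2]
      split_ifs
      · exact hs
      · rw [mul_zero]
    · have hne : r ≠ r' := fun he => h (by rw [he]; exact ⟨rfl, rfl⟩)
      simp [h, Matrix.one_apply, hne]
  · intro s hs
    rw [fourierY_apply, if_neg hs, zero_mul]

/-- A one-sided inverse is two-sided because k (L_y/k) = L_y makes the two index types equinumerous.
-/
lemma fourierY_conjTranspose_mul (hk : k ∣ Ly) (hL : Ly ≠ 0) :
    (fourierY ℓ Ly k)ᴴ * fourierY ℓ Ly k = 1 := by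
  rw [← Matrix.mul_eq_one_comm_of_card_eq]
  · exact fourierY_mul_conjTranspose hk hL
  · simp only [Fintype.card_prod, Fintype.card_fin]
    obtain ⟨D, rfl⟩ := hk
    rw [Nat.mul_div_cancel_left D (Nat.pos_of_ne_zero (mul_ne_zero_iff.1 hL).1)]
    ring

/-- The Nambu operators of the momentum sectors. -/
def sectorField (hℓ : ℓ ≤ Lx) (k n : ℕ) (u : (Fin ℓ × Fin k) × Fin 2) : Op (Site Lx Ly) :=
  doublet (fun v : Fin ℓ × Fin k => mixedAnn (Fin.castLE hℓ v.1) (momentum Ly k n v.2))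
    (fun v : Fin ℓ × Fin k => mixedAnn (Fin.castLE hℓ v.1) (-momentum Ly k n v.2)) u

/-- Pairing c_q† with c_{-q} gives both components the same phase e^{iqy}, so one Fourier matrix,
the identity on components, serves for both. -/
lemma sectorField_eq (hℓ : ℓ ≤ Lx) (n : ℕ) (u : (Fin ℓ × Fin k) × Fin 2) :
    (sectorField hℓ k n u : Op (Site Lx Ly)) = ∑ y : Fin Ly,
      (((1 / Real.sqrt Ly : ℝ) : ℂ) * phase (-momentum Ly k n u.1.2) y) •
        field (toLex (Fin.castLE hℓ u.1.1, y), u.2) := by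
  obtain ⟨⟨x, p⟩, c⟩ := u
  fin_cases c
  · simp only [sectorField, doublet, mixedAnn, field]
    simp only [Fin.zero_eta, Fin.isValue, Matrix.cons_val_zero, Matrix.conjTranspose_smul,
      Matrix.conjTranspose_sum, Finset.smul_sum, smul_smul]
    refine Finset.sum_congr rfl fun y _ => ?_
    rw [← star_phase, phase, Complex.star_def, map_mul, Complex.conj_ofReal]
  · simp only [sectorField, doublet, mixedAnn, field]
    simp only [Fin.mk_one, Fin.isValue, Matrix.cons_val_one, Matrix.cons_val_fin_one,
      Finset.smul_sum, smul_smul]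
    rfl

lemma sectorField_eq_fourierY (hℓ : ℓ ≤ Lx) (r : ((Fin ℓ × Fin k) × Fin 2) × Fin (Ly / k)) :
    (sectorField hℓ k r.2 r.1 : Op (Site Lx Ly)) = ∑ s : (Fin ℓ × Fin Ly) × Fin 2,
      star (fourierY ℓ Ly k r s) • field (toLex (Fin.castLE hℓ s.1.1, s.1.2), s.2) := by
  rw [sum_fourierY r, sectorField_eq]
  · refine Finset.sum_congr rfl fun y _ => ?_
    rw [fourierY_apply, if_pos ⟨rfl, rfl⟩, star_mul', star_phase, Complex.star_def,
      Complex.conj_ofReal]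
  · intro s hs
    rw [fourierY_apply, if_neg hs, star_zero, zero_smul]

/-- Change of basis in a correlation matrix. -/
lemma mul_corr_mul_conjTranspose {Λ κ ι : Type} [Fintype Λ] [LinearOrder Λ] [Fintype κ]
    [DecidableEq κ] (ρ : Op Λ) (B : κ → Op Λ) (W : Matrix ι κ ℂ) (r r' : ι) :
    (W * corr ρ B * Wᴴ) r r' =
      2 * expect ρ ((∑ s, star (W r s) • B s)ᴴ * ∑ s, star (W r' s) • B s) - (W * Wᴴ) r r' := by
  have h1 : corr ρ B = Matrix.of (fun u v => 2 * expect ρ ((B u)ᴴ * B v)) - 1 := by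
    ext u v
    simp [corr, Matrix.one_apply]
  rw [h1, Matrix.mul_sub, Matrix.sub_mul, Matrix.mul_one, Matrix.sub_apply, Matrix.conjTranspose_sum,
    Finset.sum_mul_sum, Finset.sum_comm, expect_sum, Finset.mul_sum]
  congr 1
  rw [Matrix.mul_apply]
  refine Finset.sum_congr rfl fun s' _ => ?_
  rw [Matrix.mul_apply, Finset.sum_mul, expect_sum, Finset.mul_sum]
  refine Finset.sum_congr rfl fun s _ => ?_
  rw [Matrix.conjTranspose_smul, star_star, smul_mul_smul_comm, expect_smul, Matrix.of_apply,
    Matrix.conjTranspose_apply]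
  ring

variable [NeZero Lx] [NeZero Ly]

lemma translateY_sectorField (hk : k ∣ Ly) (hℓ : ℓ ≤ Lx) (n : ℕ) (u : (Fin ℓ × Fin k) × Fin 2) :
    translateY Lx Ly k * sectorField hℓ k n u =
      phase (momentum Ly k n u.1.2) k • (sectorField hℓ k n u * translateY Lx Ly k) := by
  have hq : phase (-momentum Ly k n u.1.2) Ly = 1 := by
    rw [← star_phase, phase_momentum hk (NeZero.ne Ly), star_one]
  rw [sectorField_eq, Finset.mul_sum, Finset.sum_mul, Finset.smul_sum]
  refine .trans ?_ (Equiv.sum_comp (Equiv.addRight (Fin.ofNat Ly k)) _)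
  refine Finset.sum_congr rfl fun y _ => ?_
  have h1 : phase (-momentum Ly k n u.1.2) ((y + Fin.ofNat Ly k : Fin Ly) : ℕ) =
      phase (-momentum Ly k n u.1.2) y * phase (-momentum Ly k n u.1.2) k := by
    rw [Fin.val_add, phase_mod hq, phase_add, Fin.val_ofNat, phase_mod hq]
  have h2 : shiftY k (toLex (Fin.castLE hℓ u.1.1, y) : Site Lx Ly) =
      toLex (Fin.castLE hℓ u.1.1, y + Fin.ofNat Ly k) := rfl
  have h3 := phase_neg_mul (momentum Ly k n u.1.2) k
  rw [mul_smul_comm, translateY_field, h2, Equiv.coe_addRight, h1, smul_mul_assoc, smul_smul]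
  congr 1
  linear_combination -(((1 / Real.sqrt Ly : ℝ) : ℂ) * phase (-momentum Ly k n u.1.2) y) * h3

/-- After k sites the part 2πp/k of the momentum contributes a full turn, so the phase sees only n
modulo L_y/k. -/
lemma phase_sector_ne (hk : k ∣ Ly) {n n' p p' : ℕ} (hn : n < Ly / k) (hn' : n' < Ly / k)
    (h : n ≠ n') :
    phase (-momentum Ly k n p) k * phase (momentum Ly k n' p') k ≠ 1 := by
  have hL := NeZero.ne Ly
  rw [phase_mul]
  intro h1
  obtain ⟨j, hj⟩ := phase_eq_one_iff.1 h1
  have hm := momentum_mul hk hL n p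
  have hm' := momentum_mul hk hL n' p'
  have hkD : (k : ℝ) * (Ly / k : ℕ) = Ly := by exact_mod_cast Nat.mul_div_cancel' hk
  have hk0 : (k : ℝ) ≠ 0 := by
    intro h0
    rw [h0, zero_mul] at hkD
    exact hL (by exact_mod_cast hkD.symm)
  have h2 : ((momentumIndex Ly k n' p' : ℤ) - momentumIndex Ly k n p) = j * (Ly / k : ℕ) := by
    have : ((momentumIndex Ly k n' p' : ℝ) - momentumIndex Ly k n p) * (2 * Real.pi * k) =
        j * (Ly / k : ℕ) * (2 * Real.pi * k) := by
      linear_combination k * hm - k * hm' + Ly * hj - j * 2 * Real.pi * hkD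
    have h := mul_right_cancel₀ (mul_ne_zero Real.two_pi_pos.ne' hk0) this
    apply Int.cast_injective (α := ℝ)
    push_cast at h ⊢
    exact h
  have h3 : (n : ℤ) ≡ n' [ZMOD (Ly / k : ℕ)] := by
    rw [Int.modEq_iff_dvd]
    refine ⟨j + p - p', ?_⟩
    unfold momentumIndex at h2
    rw [Nat.cast_add, Nat.cast_add, Nat.cast_mul, Nat.cast_mul] at h2
    linear_combination h2
  have h4 := Int.natCast_modEq_iff.1 h3
  exact h (Nat.ModEq.eq_of_lt_of_lt h4 hn hn')

/-- The transverse Fourier transform block-diagonalizes the correlation matrix of an invariant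
state. -/
theorem fourierY_block (hk : k ∣ Ly) (hℓ : ℓ ≤ Lx) {ρ : Op (Site Lx Ly)}
    (hρ : translateY Lx Ly k * ρ = ρ * translateY Lx Ly k) :
    fourierY ℓ Ly k * stripCorr hℓ ρ * (fourierY ℓ Ly k)ᴴ =
      Matrix.blockDiagonal (fun ny : Fin (Ly / k) => sectorCorr hℓ k ρ ny) := by
  ext r r'
  rw [stripCorr, mul_corr_mul_conjTranspose, ← sectorField_eq_fourierY hℓ r,
    ← sectorField_eq_fourierY hℓ r', fourierY_mul_conjTranspose hk (NeZero.ne Ly),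
    Matrix.blockDiagonal_apply, Matrix.one_apply]
  have hu := translateY_unitary (Lx := Lx) (Ly := Ly) k
  by_cases h : r.2 = r'.2
  · have h2 : r = r' ↔ r.1 = r'.1 := by simp [Prod.ext_iff, h]
    rw [if_pos h, h]
    simp only [sectorCorr, corr, Matrix.of_apply, h2, sectorField]
  · have hne : r ≠ r' := fun he => h (by rw [he])
    have h0 : expect ρ ((sectorField hℓ k r.2 r.1)ᴴ * sectorField hℓ k r'.2 r'.1) = 0 := by
      -- Blocks with different n_y carry different phases under translation by k, so the selection
      -- rule kills the correlator.
      refine expect_eq_zero_of_phase hu hρ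
        (phase_sector_ne (p := r.1.1.2) (p' := r'.1.1.2) hk r.2.2 r'.2.2
          (fun he => h (Fin.ext he))) ?_
      have h1 := translateY_sectorField hk hℓ r.2 r.1
      have h2 := translateY_sectorField hk hℓ r'.2 r'.1
      have h3 : translateY Lx Ly k * (sectorField hℓ k r.2 r.1)ᴴ =
          phase (-momentum Ly k r.2 r.1.1.2) k •
            ((sectorField hℓ k r.2 r.1)ᴴ * translateY Lx Ly k) := by
        have h4 := congrArg Matrix.conjTranspose h1
        rw [Matrix.conjTranspose_mul, Matrix.conjTranspose_smul, Matrix.conjTranspose_mul,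
          star_phase] at h4
        have h5 := congrArg (fun X => translateY Lx Ly k * X * translateY Lx Ly k) h4
        beta_reduce at h5
        rw [mul_assoc, mul_assoc, hu, mul_one, mul_smul_comm, smul_mul_assoc, ← mul_assoc,
          mul_eq_one_comm.1 hu, one_mul] at h5
        exact h5
      rw [← mul_assoc, h3, smul_mul_assoc, mul_assoc, h2, mul_smul_comm, smul_smul, mul_assoc]
    rw [h0, if_neg hne, if_neg h]
    simp

end Fourier

/-! ### Spectra and entropies of the sectors. -/

section Sectors

variable {Lx Ly k ℓ : ℕ} [NeZero Lx] [NeZero Ly]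

lemma conj_pow_of_unitary {ι κ : Type*} [Fintype ι] [DecidableEq ι] [Fintype κ] [DecidableEq κ]
    {W : Matrix ι κ ℂ} (h1 : W * Wᴴ = 1) (h2 : Wᴴ * W = 1) (M : Matrix κ κ ℂ) (j : ℕ) :
    (W * M * Wᴴ) ^ j = W * M ^ j * Wᴴ := by
  induction j with
  | zero => simp [h1]
  | succ j ih =>
    calc (W * M * Wᴴ) ^ (j + 1) = W * M ^ j * (Wᴴ * W) * M * Wᴴ := by
          rw [pow_succ, ih]; simp only [Matrix.mul_assoc]
      _ = _ := by rw [h2, Matrix.mul_one, pow_succ]; simp only [Matrix.mul_assoc]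

lemma trace_stripCorr_pow (hk : k ∣ Ly) (hℓ : ℓ ≤ Lx) {ρ : Op (Site Lx Ly)}
    (hρ : translateY Lx Ly k * ρ = ρ * translateY Lx Ly k) (j : ℕ) :
    (stripCorr hℓ ρ ^ j).trace = ∑ ny : Fin (Ly / k), (sectorCorr hℓ k ρ ny ^ j).trace := by
  have h1 := fourierY_mul_conjTranspose (ℓ := ℓ) hk (NeZero.ne Ly)
  have h2 := fourierY_conjTranspose_mul (ℓ := ℓ) hk (NeZero.ne Ly)
  have h3 : fourierY ℓ Ly k * stripCorr hℓ ρ ^ j * (fourierY ℓ Ly k)ᴴ = Matrix.blockDiagonal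
      (fun ny : Fin (Ly / k) => sectorCorr hℓ k ρ ny ^ j) := by
    rw [← conj_pow_of_unitary h1 h2, fourierY_block hk hℓ hρ, ← Matrix.blockDiagonal_pow]
    rfl
  rw [← Matrix.trace_blockDiagonal, ← h3, Matrix.trace_mul_comm, ← Matrix.mul_assoc, h2,
    Matrix.one_mul]

/-- The entropy of the correlation matrix of the strip is the sum of those of the sectors. -/
lemma corrEntropy_stripCorr (hk : k ∣ Ly) (hℓ : ℓ ≤ Lx) {ρ : Op (Site Lx Ly)} (hH : ρ.IsHermitian)
    (hρ : translateY Lx Ly k * ρ = ρ * translateY Lx Ly k) (n : ℝ) :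
    corrEntropy n (stripCorr hℓ ρ) =
      ∑ ny : Fin (Ly / k), corrEntropy n (sectorCorr hℓ k ρ ny) := by
  unfold corrEntropy
  have h1 : (stripCorr hℓ ρ).IsHermitian := corr_isHermitian hH _
  have h2 : ∀ ny : Fin (Ly / k), (sectorCorr hℓ k ρ ny).IsHermitian :=
    fun ny => corr_isHermitian hH _
  rw [trace_cfc_eq_sum h1 h2 (trace_stripCorr_pow hk hℓ hρ), Complex.re_sum, Finset.mul_sum]

lemma stripCorr_eigen_mem (hℓ : ℓ ≤ Lx) {ρ : Op (Site Lx Ly)} (hρ : IsDensity ρ) {a : ℝ}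
    {v : (Fin ℓ × Fin Ly) × Fin 2 → ℂ} (hv : v ≠ 0) (h : stripCorr hℓ ρ *ᵥ v = (a : ℂ) • v) :
    -1 ≤ a ∧ a ≤ 1 := by
  have hv' : v ∘ (stripIndex ℓ Ly).symm ≠ 0 := by
    intro h0
    apply hv
    ext i
    simpa using congrFun h0 (stripIndex ℓ Ly i)
  refine corr_field_eigen_le (restrict_isDensity (stripEmb hℓ) hρ) hv' ?_
  rw [stripCorr_eq_submatrix, Matrix.submatrix_mulVec_equiv] at h
  ext i
  simpa using congrFun h ((stripIndex ℓ Ly).symm i)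

/-- Charge conjugation sends q to -q and need not preserve a single sector. Hence the eigenvector is
extended by zero and pulled back to the strip, where both bounds hold. -/
lemma sectorCorr_eigen_mem (hk : k ∣ Ly) (hℓ : ℓ ≤ Lx) {ρ : Op (Site Lx Ly)} (hd : IsDensity ρ)
    (hρ : translateY Lx Ly k * ρ = ρ * translateY Lx Ly k) (ny : Fin (Ly / k)) {a : ℝ}
    {v : (Fin ℓ × Fin k) × Fin 2 → ℂ} (hv : v ≠ 0)
    (h : sectorCorr hℓ k ρ ny *ᵥ v = (a : ℂ) • v) : -1 ≤ a ∧ a ≤ 1 := by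
  have h1 := fourierY_mul_conjTranspose (ℓ := ℓ) hk (NeZero.ne Ly)
  have h2 := fourierY_conjTranspose_mul (ℓ := ℓ) hk (NeZero.ne Ly)
  set e : ((Fin ℓ × Fin k) × Fin 2) × Fin (Ly / k) → ℂ := fun u => if u.2 = ny then v u.1 else 0
    with he
  have hB : Matrix.blockDiagonal (fun ny : Fin (Ly / k) => sectorCorr hℓ k ρ ny) *ᵥ e =
      (a : ℂ) • e := by
    ext ⟨u, m⟩
    have h3 := congrFun h u
    simp only [Matrix.mulVec, dotProduct, Fintype.sum_prod_type (α₁ := (Fin ℓ × Fin k) × Fin 2),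
      Matrix.blockDiagonal_apply, he, Pi.smul_apply] at h3 ⊢
    by_cases hm : m = ny
    · subst hm
      simpa using h3
    · simp [hm]
  have hW : stripCorr hℓ ρ * (fourierY ℓ Ly k)ᴴ = (fourierY ℓ Ly k)ᴴ *
      Matrix.blockDiagonal (fun ny : Fin (Ly / k) => sectorCorr hℓ k ρ ny) := by
    rw [← fourierY_block hk hℓ hρ, Matrix.mul_assoc, ← Matrix.mul_assoc, h2, Matrix.one_mul]
  refine stripCorr_eigen_mem hℓ hd (v := (fourierY ℓ Ly k)ᴴ *ᵥ e) ?_ ?_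
  · intro h0
    have h4 := congrArg (fun x => fourierY ℓ Ly k *ᵥ x) h0
    simp only [Matrix.mulVec_mulVec, h1, Matrix.one_mulVec, Matrix.mulVec_zero] at h4
    apply hv
    ext u
    simpa [he] using congrFun h4 (u, ny)
  · rw [Matrix.mulVec_mulVec, hW, ← Matrix.mulVec_mulVec, hB, Matrix.mulVec_smul]

lemma eigenvalues_mem_of_eigen {m : Type*} [Fintype m] [DecidableEq m] {M : Matrix m m ℂ}
    (hM : M.IsHermitian) {P : ℝ → Prop}
    (h : ∀ (a : ℝ) (v : m → ℂ), v ≠ 0 → M *ᵥ v = (a : ℂ) • v → P a) (i : m) :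
    P (hM.eigenvalues i) := by
  refine h _ (hM.eigenvectorBasis i).ofLp (fun h0 => ?_) (hM.mulVec_eigenvectorBasis i)
  have h1 := hM.eigenvectorBasis.orthonormal.ne_zero i
  exact h1 (by ext j; exact congrFun h0 j)

end Sectors

/-! ### The Taylor series of the entropy function and Abel's theorem. -/

section Taylor

open Filter Topology

/-- On the closed interval at least one of (1 ± x)/2 is positive, so the logarithm stays away from
zero; positivity of n makes the powers continuous at the endpoints. -/
lemma hFun_continuousOn {n : ℝ} (hn : 0 < n) : ContinuousOn (hFun n) (Set.Icc (-1) 1) := by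
  unfold hFun
  split_ifs with h1
  · exact ((Real.continuous_negMulLog.comp (by fun_prop)).add
      (Real.continuous_negMulLog.comp (by fun_prop))).continuousOn
  · refine continuousOn_const.mul (ContinuousOn.log ?_ ?_)
    · have h2 := Real.continuous_rpow_const hn.le
      exact ((h2.comp (by fun_prop : Continuous fun x : ℝ => (1 + x) / 2)).add
        (h2.comp (by fun_prop : Continuous fun x : ℝ => (1 - x) / 2))).continuousOn
    · intro x hx
      have hp : 0 ≤ (1 + x) / 2 := by linarith [hx.1]
      have hm : 0 ≤ (1 - x) / 2 := by linarith [hx.2]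
      rcases lt_or_ge x 0 with h0 | h0
      · exact (add_pos_of_nonneg_of_pos (Real.rpow_nonneg hp n)
          (Real.rpow_pos_of_pos (by linarith) n)).ne'
      · exact (add_pos_of_pos_of_nonneg (Real.rpow_pos_of_pos (by linarith) n)
          (Real.rpow_nonneg hm n)).ne'

lemma analyticAt_rpow_of_pos {f : ℝ → ℝ} {x : ℝ} (hf : AnalyticAt ℝ f x) (h : 0 < f x) (n : ℝ) :
    AnalyticAt ℝ (fun y => f y ^ n) x := by
  have h1 : AnalyticAt ℝ (fun y => Real.exp (Real.log (f y) * n)) x :=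
    ((hf.log h).mul analyticAt_const).rexp'
  refine h1.congr ?_
  filter_upwards [hf.continuousAt.eventually (lt_mem_nhds h)] with y hy
  exact (Real.rpow_def_of_pos hy n).symm

lemma hFun_analyticOnNhd (n : ℝ) : AnalyticOnNhd ℝ (hFun n) (Set.Ioo (-1) 1) := by
  intro x hx
  have hp : 0 < (1 + x) / 2 := by linarith [hx.1]
  have hm : 0 < (1 - x) / 2 := by linarith [hx.2]
  have ap : AnalyticAt ℝ (fun x : ℝ => (1 + x) / 2) x :=
    (analyticAt_const.add analyticAt_id).div_const
  have am : AnalyticAt ℝ (fun x : ℝ => (1 - x) / 2) x :=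
    (analyticAt_const.sub analyticAt_id).div_const
  unfold hFun
  split_ifs with h1
  · unfold Real.negMulLog
    exact (ap.neg.mul (ap.log hp)).add (am.neg.mul (am.log hm))
  · exact analyticAt_const.mul (((analyticAt_rpow_of_pos ap hp n).add
      (analyticAt_rpow_of_pos am hm n)).log
        (add_pos (Real.rpow_pos_of_pos hp n) (Real.rpow_pos_of_pos hm n)))

/-- A real analytic function on `(-1, 1)` is the sum of its Taylor series on any disc where the
terms of that series are bounded on the boundary. -/
lemma hasSum_taylor_of_bounded {h : ℝ → ℝ} (hh : AnalyticOnNhd ℝ h (Set.Ioo (-1) 1)) {R C x : ℝ}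
    (hR : R ≤ 1) (hC : ∀ m : ℕ, |iteratedDeriv m h 0 / m.factorial| * R ^ m ≤ C) (hx : |x| < R) :
    HasSum (fun m : ℕ => iteratedDeriv m h 0 / m.factorial * x ^ m) (h x) := by
  have hR0 : 0 < R := (abs_nonneg x).trans_lt hx
  have hat := hh 0 ⟨by norm_num, by norm_num⟩
  set p := FormalMultilinearSeries.ofScalars ℝ (fun m : ℕ => iteratedDeriv m h 0 / m.factorial)
    with hp
  have hp0 : HasFPowerSeriesAt h p 0 := hat.hasFPowerSeriesAt
  lift R to NNReal using hR0.le
  have hrad : (R : ENNReal) ≤ p.radius := by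
    refine p.le_radius_of_bound C fun m => ?_
    rw [hp, FormalMultilinearSeries.ofScalars_norm]
    exact hC m
  have hball : HasFPowerSeriesOnBall p.sum p 0 p.radius :=
    p.hasFPowerSeriesOnBall ((by exact_mod_cast hR0 : (0 : ENNReal) < R).trans_le hrad)
  have hmem : ∀ y : ℝ, |y| < R → y ∈ Metric.eball (0 : ℝ) p.radius := by
    intro y hy
    refine Metric.eball_subset_eball hrad ?_
    rw [Metric.eball_coe]
    simpa using hy
  -- The series is known to represent h only near 0; the identity theorem extends this to the whole
  -- interval of radius R.
  have heq : Set.EqOn p.sum h (Set.Ioo (-(R : ℝ)) R) := by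
    refine AnalyticOnNhd.eqOn_of_preconnected_of_eventuallyEq
      (fun y hy => hball.analyticOnNhd y (hmem y (abs_lt.2 hy)))
      (fun y hy => hh y ⟨by linarith [hy.1], by linarith [hy.2]⟩) isPreconnected_Ioo
      (z₀ := 0) ⟨by linarith, by linarith⟩ ?_
    have h1 := hball.hasFPowerSeriesAt.eventually_hasSum
    have h2 := hp0.eventually_hasSum
    filter_upwards [h1, h2] with y hy1 hy2
    simpa using hy1.unique hy2
  have hs := hball.hasSum (hmem x hx)
  rw [zero_add, heq (abs_lt.1 hx)] at hs
  simpa [hp, FormalMultilinearSeries.ofScalars_apply_eq, mul_comm] using hs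

lemma iteratedDeriv_odd_eq_zero {h : ℝ → ℝ} (he : ∀ x, h (-x) = h x) {m : ℕ} (hm : Odd m) :
    iteratedDeriv m h 0 = 0 := by
  have h1 := iteratedDeriv_comp_neg m h 0
  rw [funext he, hm.neg_one_pow, neg_zero, smul_eq_mul] at h1
  linarith

/-- The sum of the even moment series is determined by Abel's theorem, whenever it converges. -/
lemma moment_series_eq {ι : Type*} [Fintype ι] {h : ℝ → ℝ}
    (hh : AnalyticOnNhd ℝ h (Set.Ioo (-1) 1)) (hc : ContinuousOn h (Set.Icc (-1) 1))
    (he : ∀ x, h (-x) = h x) {a : ι → ℝ} (ha : ∀ i, -1 ≤ a i ∧ a i ≤ 1) {s : ℝ}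
    (hs : Tendsto (fun M : ℕ => ∑ m ∈ Finset.range M,
      iteratedDeriv (2 * m) h 0 / (2 * m).factorial * ∑ i, a i ^ (2 * m)) atTop (𝓝 s)) :
    s = ∑ i, h (a i) := by
  set b : ℕ → ℝ := fun m => iteratedDeriv m h 0 / m.factorial with hb
  have hodd : ∀ m, ¬ Even m → b m = 0 := by
    intro m hm
    rw [hb]
    simp [iteratedDeriv_odd_eq_zero he (Nat.not_even_iff_odd.1 hm)]
  -- The terms of a convergent series are bounded. Even powers are nonnegative, so the bound passes
  -- from the sum over i to each a_i separately and controls the radius of convergence.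
  obtain ⟨C, hC⟩ : ∃ C, ∀ m, |b (2 * m) * ∑ i, a i ^ (2 * m)| ≤ C := by
    have h1 : Tendsto (fun m => b (2 * m) * ∑ i, a i ^ (2 * m)) atTop (𝓝 0) := by
      have h2 := (hs.comp (tendsto_add_atTop_nat 1)).sub hs
      simpa [Finset.sum_range_succ, Function.comp_def] using h2
    obtain ⟨C, hC⟩ := h1.abs.bddAbove_range
    exact ⟨C, fun m => hC ⟨m, rfl⟩⟩
  have hC0 : 0 ≤ C := (abs_nonneg _).trans (hC 0)
  have hsum : ∀ i, ∀ x ∈ Set.Ioo (0 : ℝ) 1,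
      HasSum (fun m : ℕ => b (2 * m) * a i ^ (2 * m) * x ^ m) (h (√x * a i)) := by
    intro i x hx
    have hfull : HasSum (fun m : ℕ => b m * (√x * a i) ^ m) (h (√x * a i)) := by
      -- At a_i = 0 the term bound gives no positive radius, but only the constant term of the
      -- series survives.
      by_cases h0 : a i = 0
      · rw [h0, mul_zero]
        have : h 0 = b 0 * 0 ^ 0 := by simp [hb]
        rw [this]
        exact hasSum_single 0 fun m hm => by simp [hm]
      · refine hasSum_taylor_of_bounded hh (R := |a i|) (C := C) (abs_le.2 (ha i))
          (fun m => ?_) ?_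
        · change |b m| * |a i| ^ m ≤ C
          by_cases hm : Even m
          · obtain ⟨j, rfl⟩ := hm.two_dvd
            refine le_trans ?_ (hC j)
            rw [abs_mul, pow_mul, sq_abs, ← pow_mul]
            refine mul_le_mul_of_nonneg_left ?_ (abs_nonneg _)
            refine le_trans ?_ (le_abs_self _)
            exact Finset.single_le_sum (f := fun i => a i ^ (2 * j))
              (fun i _ => (even_two_mul j).pow_nonneg _) (Finset.mem_univ i)
          · rwa [hodd m hm, abs_zero, zero_mul]
        · rw [abs_mul, abs_of_nonneg (Real.sqrt_nonneg x)]
          refine mul_lt_of_lt_one_left (abs_pos.2 h0) ?_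
          rw [Real.sqrt_lt' one_pos]
          simpa using hx.2
    have h2 : Function.Injective fun m : ℕ => 2 * m := fun m m' hm => by simpa using hm
    have h3 := (h2.hasSum_iff (f := fun m : ℕ => b m * (√x * a i) ^ m) (a := h (√x * a i))
      (fun m hm => by
        rw [hodd m fun hm' => hm (by obtain ⟨j, rfl⟩ := hm'.two_dvd; exact ⟨j, rfl⟩), zero_mul])).2
          hfull
    refine h3.congr_fun ?_
    intro m
    simp only [Function.comp, mul_pow]
    rw [pow_mul √x, Real.sq_sqrt hx.1.le]
    ring
  -- The m-th term carries the (2m)-th power, so the Abel factor x^m rescales each a_i by √x; x → 1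
  -- then brings the argument to a_i from inside the interval.
  have habel := Real.tendsto_tsum_powerSeries_nhdsWithin_lt hs
  have hev : (fun x : ℝ => ∑' m, b (2 * m) * (∑ i, a i ^ (2 * m)) * x ^ m) =ᶠ[𝓝[<] 1]
      fun x => ∑ i, h (√x * a i) := by
    filter_upwards [Ioo_mem_nhdsLT (zero_lt_one (α := ℝ))] with x hx
    refine HasSum.tsum_eq ?_
    refine (hasSum_sum fun i _ => hsum i x hx).congr_fun fun m => ?_
    rw [Finset.mul_sum, Finset.sum_mul]
  have hlim : Tendsto (fun x : ℝ => ∑ i, h (√x * a i)) (𝓝[<] 1) (𝓝 (∑ i, h (a i))) := by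
    refine tendsto_finsetSum _ fun i _ => ?_
    have h1 : Tendsto (fun x : ℝ => √x * a i) (𝓝[<] 1) (𝓝[Set.Icc (-1) 1] (a i)) := by
      refine tendsto_nhdsWithin_iff.2 ⟨?_, ?_⟩
      · have : Continuous fun x : ℝ => √x * a i := by fun_prop
        simpa using (this.tendsto 1).mono_left nhdsWithin_le_nhds
      · filter_upwards [Ioo_mem_nhdsLT (zero_lt_one (α := ℝ))] with x hx
        have h2 : √x ≤ 1 := Real.sqrt_le_one.2 hx.2.le
        refine abs_le.1 ?_
        rw [abs_mul, abs_of_nonneg (Real.sqrt_nonneg x)]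
        exact mul_le_one₀ h2 (abs_nonneg _) (abs_le.2 (ha i))
    exact (hc (a i) (ha i)).tendsto.comp h1
  exact tendsto_nhds_unique (habel.congr' hev) hlim

lemma trace_pow_re {m : Type*} [Fintype m] [DecidableEq m] {M : Matrix m m ℂ} (hM : M.IsHermitian)
    (j : ℕ) : (M ^ j).trace.re = ∑ i, hM.eigenvalues i ^ j := by
  have h := trace_cfc hM (fun x => x ^ j)
  rw [cfc_eq_aeval hM _ (Polynomial.X ^ j) (by simp), map_pow, Polynomial.aeval_X] at h
  rw [h, ← Complex.ofReal_sum, Complex.ofReal_re]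

/-- If the moment series of a correlation matrix converges, its sum is the entropy. -/
lemma corrEntropy_eq_moment_series {m : Type} [Fintype m] [DecidableEq m] {M : Matrix m m ℂ}
    (hM : M.IsHermitian) (ha : ∀ i, -1 ≤ hM.eigenvalues i ∧ hM.eigenvalues i ≤ 1) {n : ℝ}
    (hn : 0 < n) {s : ℝ}
    (hs : Tendsto (fun K : ℕ => (1 / 2) * ∑ j ∈ Finset.range K,
      hCoeff n (2 * j) * (M ^ (2 * j)).trace.re) atTop (𝓝 s)) : s = corrEntropy n M := by
  have h1 := hs.const_mul 2
  simp only [trace_pow_re hM, hCoeff, ← mul_assoc] at h1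
  norm_num at h1
  have h2 := moment_series_eq (hFun_analyticOnNhd n) (hFun_continuousOn hn) (hFun_neg n) ha h1
  rw [corrEntropy_eq_sum hM, ← h2]
  ring

end Taylor

end FreeFermion

end

open FreeFermion

theorem mainTheorem1
    (Lx Ly k ℓ : ℕ) [NeZero Lx] [NeZero Ly] (hk : k ∣ Ly) (hℓ : ℓ ≤ Lx)
    (ψ₀ : Finset (Site Lx Ly) → ℂ) (hnorm : star ψ₀ ⬝ᵥ ψ₀ = 1)
    (hWick : SatisfiesWick (pureState ψ₀))
    (hinv : IsTranslationInvariant k ψ₀)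
    (t : ℝ)
    (ρ : Op (Site Lx Ly)) (hρ : ρ = pureState (evolve t ψ₀)) :
    -- the correlation matrices are Hermitian
    (stripCorr hℓ ρ).IsHermitian ∧
    (∀ ny : Fin (Ly / k), (sectorCorr hℓ k ρ ny).IsHermitian) ∧
    -- the transverse Fourier transform is unitary and block-diagonalizes the correlation matrix
    fourierY ℓ Ly k * (fourierY ℓ Ly k)ᴴ = 1 ∧
    (fourierY ℓ Ly k)ᴴ * fourierY ℓ Ly k = 1 ∧
    fourierY ℓ Ly k * stripCorr hℓ ρ * (fourierY ℓ Ly k)ᴴ =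
      Matrix.blockDiagonal (fun ny : Fin (Ly / k) => sectorCorr hℓ k ρ ny) ∧
    ∀ n : ℝ, 0 < n →
      -- the entropy of the strip is the sum of the entropies of the sectors
      renyiEntropy n (reducedDensity ℓ ρ) =
        ∑ ny : Fin (Ly / k), corrEntropy n (sectorCorr hℓ k ρ ny) ∧
      -- the entropy of a sector is the sum of its moment series, whenever the latter converges
      (∀ (ny : Fin (Ly / k)) (s : ℝ),
        Filter.Tendsto
          (fun M : ℕ => (1 / 2) * ∑ m ∈ Finset.range M,
            hCoeff n (2 * m) * ((sectorCorr hℓ k ρ ny) ^ (2 * m)).trace.re)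
          Filter.atTop (nhds s) →
        s = corrEntropy n (sectorCorr hℓ k ρ ny)) ∧
      -- the entropy of a sector is the Rényi entropy of an interval of `ℓ` cells in any Gaussian
      -- state of a chain (`N` cells of `k` orbitals) with this correlation matrix
      (∀ (ny : Fin (Ly / k)) (N : ℕ) (hN : ℓ ≤ N) (σ : Op (Site N k)),
        IsDensity σ → SatisfiesWick σ → stripCorr hN σ = sectorCorr hℓ k ρ ny →
        renyiEntropy n (reducedDensity ℓ σ) = corrEntropy n (sectorCorr hℓ k ρ ny)) := by
  subst hρ
  have hd := pureState_isDensity (evolve_norm t hnorm)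
  have hW := evolve_satisfiesWick t hnorm hWick
  have hT := translateY_commute_pureState (evolve_invariant hinv t)
  have hS : ∀ ny : Fin (Ly / k), (sectorCorr hℓ k (pureState (evolve t ψ₀)) ny).IsHermitian :=
    fun ny => corr_isHermitian hd.1.1 _
  refine ⟨corr_isHermitian hd.1.1 _, hS, fourierY_mul_conjTranspose hk (NeZero.ne Ly),
    fourierY_conjTranspose_mul hk (NeZero.ne Ly), fourierY_block hk hℓ hT, fun n hn =>
      ⟨?_, fun ny s hs => ?_, fun ny N hN σ hσ hσW h => ?_⟩⟩
  · rw [renyiEntropy_reducedDensity hℓ hd hW, corrEntropy_stripCorr hk hℓ hd.1.1 hT]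
  · exact corrEntropy_eq_moment_series (hS ny) (eigenvalues_mem_of_eigen (hS ny) fun a v hv h =>
      sectorCorr_eigen_mem hk hℓ hd hT ny hv h) hn hs
  -- A chain of N cells with k orbitals is a lattice of width N and height k, and its first ℓ cells
  -- form a strip.
  · rw [renyiEntropy_reducedDensity hN hσ hσW, h]
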